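/- Let $n\ge 1$. Consider set partitions of $\{+1,\dots,+N,-1,\dots,-N\}$, placed anticlockwise in this order on a circle. For a sign-invariant set partition $\rho$ (if $K$ is a block, so is $-K$) let $\mathrm{bk}_0(\rho)$ be the number of zero (invariant) blocks $K=-K$ and $\mathrm{nzbk}(\rho)$ half the number of blocks with $K\ne -K$. Such a $\rho$ is an *$N$-partition of type $B$* if it has at most one zero block, and it is *non-crossing* if the chords joining consecutive elements (in the order $+1<\dots<+N<-1<\dots<-N$) of its blocks do not cross. Let $NC^B_n$ be the set of non-crossing $n$-partitions of type $B$ and $B^B_n$ the set of non-crossing $2n$-partitions of type $B$ (on $4n$ points) all of whose blocks have two elements. For $\pi\in NC^B_n$ let $\beta(\pi)$ be the pairing of the $4n$ points obtained by splitting every point $p$ of the circle into two points $p^-,p^+$ (just before and just after $p$, anticlockwise) and joining $p^+$ to $q^-$, where $q$ is the cyclically next element of the block of $p$ (the boundary arcs of a regular neighbourhood of the chords). The join $\pi\vee\pi'$ is the finest set partition coarser than both $\pi$ and $\pi'$ (it is sign-invariant and may have $0$, $1$ or $2$ zero blocks); for $b,b'\in B^B_n$ the blocks of $b\vee b'$ are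 the circles obtained by gluing $b$ and $b'$ along the boundary, and $c_0(b\vee b')$, $c_d(b\vee b')$ are the number of invariant circles $C=-C$ and the number of pairs $\{C,-C\}$ with $C\neq -C$. For $\alpha,\delta$ in a commutative ring put $$J^B_n(\alpha,\delta)=\bigl(\alpha^{\mathrm{bk}_0(\pi\vee\pi')}\delta^{\mathrm{nzbk}(\pi\vee\pi')}\bigr)_{\pi,\pi'\in NC^B_n},\qquad G^B_n(\alpha,\delta)=\bigl(\alpha^{c_0(b\vee b')}\delta^{c_d(b\vee b')}\bigr)_{b,b'\in B^B_n},$$ and, if $\delta$ has an invertible square root $\delta^{1/2}$, let $P^B_n(\alpha,\delta)$ be the diagonal matrix with entries $\alpha^{\mathrm{bk}_0(\pi)}\delta^{\mathrm{nzbk}(\pi)-n/2}$, $\pi\in NC^B_n$. Then: 1. $\beta$ is a bijection $NC^B_n\to B^B_n$ and, when $B^B_n$ is identified with $NC^B_n$ by it, $J^B_n(\alpha^2,\delta^2)=P^B_n(\alpha,\delta)\,G^B_n(\alpha,\delta)\,P^B_n(\alpha,\delta)$ whenever $\delta$ has an invertible square root. 2. There is a fixed-point-free involution $\gamma$ of $NC^B_n$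 with $\mathrm{bk}_0(\pi)+\mathrm{bk}_0(\gamma(\pi))=1$ and $\mathrm{nzbk}(\pi)+\mathrm{nzbk}(\gamma(\pi))=n$ for all $\pi$; and $\det P^B_n(\alpha,\delta)=\alpha^{\frac12\binom{2n}{n}}$. 3. For all $\alpha,\delta$, $$\det J^B_n(\alpha^2,\delta^2)=\alpha^{\binom{2n}{n}}\det G^B_n(\alpha,\delta)=\alpha^{\binom{2n}{n}}\prod_{i=1}^n\bigl(T_i(\delta)^2-\alpha^2\bigr)^{\binom{2n}{n-i}},$$ where $T_0=2$, $T_1(\delta)=\delta$, $T_i(\delta)=\delta T_{i-1}(\delta)-T_{i-2}(\delta)$. -/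

import Mathlib

namespace TypeB

/-- The `2N` signed numbers `+1, …, +N, -1, …, -N`, listed in this order (which is both the linear
order `+1 < ⋯ < +N < -1 < ⋯ < -N` and the anticlockwise order on the circle), are the elements
`0, …, 2N - 1` of `Fin (2 * N)`: `+k` is `k - 1` and `-k` is `N + k - 1`.
`opp` is the sign change `x ↦ -x`. -/
def opp {N : ℕ} (i : Fin (2 * N)) : Fin (2 * N) :=
  ⟨((i : ℕ) + N) % (2 * N), Nat.mod_lt _ (lt_of_le_of_lt (Nat.zero_le _) i.isLt)⟩

/-- The invariant ("zero") blocks `K = -K` of a set partition. Set partitions are represented by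
equivalence relations; the blocks are the equivalence classes. -/
def zeroBlocks {N : ℕ} (r : Setoid (Fin (2 * N))) : Set (Set (Fin (2 * N))) :=
  {K | K ∈ r.classes ∧ opp '' K = K}

/-- The non-zero blocks `K ≠ -K`. -/
def nonzeroBlocks {N : ℕ} (r : Setoid (Fin (2 * N))) : Set (Set (Fin (2 * N))) :=
  {K | K ∈ r.classes ∧ opp '' K ≠ K}

/-- The number of zero blocks. -/
noncomputable def bk₀ {N : ℕ} (r : Setoid (Fin (2 * N))) : ℕ := (zeroBlocks r).ncard

/-- Half of the number of non-zero blocks. -/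
noncomputable def nzbk {N : ℕ} (r : Setoid (Fin (2 * N))) : ℕ := (nonzeroBlocks r).ncard / 2

/-- An `N`-partition of type B: the opposite of every block is a block, and there is at most one
zero block. -/
def IsTypeB {N : ℕ} (r : Setoid (Fin (2 * N))) : Prop :=
  (∀ K ∈ r.classes, opp '' K ∈ r.classes) ∧ (zeroBlocks r).Subsingleton

/-- There is a connection chord from `i` to `j`: they are in the same block, `i < j`, and no element
of that block lies strictly between them. -/
def IsChord {M : ℕ} (r : Setoid (Fin M)) (i j : Fin M) : Prop :=
  i < j ∧ r i j ∧ ∀ k, i < k → k < j → ¬ r i k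

/-- No two connection chords cross, i.e. no two have interleaving end points. -/
def IsNonCrossing {M : ℕ} (r : Setoid (Fin M)) : Prop :=
  ∀ i j k l, IsChord r i j → IsChord r k l → ¬ (i < k ∧ k < j ∧ j < l)

/-- The non-crossing `n`-partitions of type B. -/
abbrev NCPart (n : ℕ) : Type :=
  {r : Setoid (Fin (2 * n)) // IsTypeB r ∧ IsNonCrossing r}

/-- The non-crossing bipartitions of `4n` points of type B: the non-crossing `2n`-partitions of
type B all of whose blocks have exactly two elements. -/
abbrev NCBipart (n : ℕ) : Type :=
  {r : Setoid (Fin (2 * (2 * n))) // IsTypeB r ∧ IsNonCrossing r ∧ ∀ K ∈ r.classes, K.ncard = 2}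

instance finite_setoid (M : ℕ) : Finite (Setoid (Fin M)) :=
  Finite.of_injective (fun (r : Setoid (Fin M)) (i j : Fin M) => r i j)
    (fun _ _ h => Setoid.ext fun i j => iff_of_eq (congrFun (congrFun h i) j))

noncomputable instance (n : ℕ) : Fintype (NCPart n) := Fintype.ofFinite _

noncomputable instance (n : ℕ) : Fintype (NCBipart n) := Fintype.ofFinite _

noncomputable instance (n : ℕ) : DecidableEq (NCPart n) := Classical.decEq _

noncomputable instance (n : ℕ) : DecidableEq (NCBipart n) := Classical.decEq _

/-- `j` follows `i` in the cyclic order of the block containing `i`: either `i, j` are joined by a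
connection chord (`i < j`), or `i` is the largest and `j` the smallest element of the block (with
`i = j` for a singleton block). -/
def IsNext {M : ℕ} (r : Setoid (Fin M)) (i j : Fin M) : Prop :=
  IsChord r i j ∨ (r i j ∧ ∀ k, r i k → j ≤ k ∧ k ≤ i)

/-- The boundary arcs of a regular neighbourhood of the connection chords. A point `i` of the circle
gives the two end points `2i` (just before `i`, anticlockwise) and `2i + 1` (just after `i`); for
each `i` there is a boundary arc leaving just after `i` and arriving just before the cyclically next
element of the block of `i`. The blocks of `boundaryArcs r` are the pairs of end points of the
arcs. -/
def boundaryArcs {M : ℕ} (r : Setoid (Fin M)) : Setoid (Fin (2 * M)) :=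
  Relation.EqvGen.setoid fun x y =>
    ∃ i j : Fin M, IsNext r i j ∧ (x : ℕ) = 2 * (i : ℕ) + 1 ∧ (y : ℕ) = 2 * (j : ℕ)

/-- The two-variable matrix of chromatic joins of type B. The join `⊔` is the finest set partition
coarser than both; it is invariant under sign change and may have two zero blocks. -/
noncomputable def chromaticJoins {R : Type*} [CommRing R] (n : ℕ) (α δ : R) :
    Matrix (NCPart n) (NCPart n) R :=
  Matrix.of fun π π' => α ^ bk₀ (π.1 ⊔ π'.1) * δ ^ nzbk (π.1 ⊔ π'.1)

/-- The Gram matrix of the Temperley–Lieb algebra of type B. The circles obtained by gluing two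
bipartitions along the boundary circle correspond to the blocks of the join (the marked points that
lie on the circle); a circle is invariant iff its set of marked points is. -/
noncomputable def gram {R : Type*} [CommRing R] (n : ℕ) (α δ : R) :
    Matrix (NCBipart n) (NCBipart n) R :=
  Matrix.of fun b b' => α ^ bk₀ (b.1 ⊔ b'.1) * δ ^ nzbk (b.1 ⊔ b'.1)

/-- The diagonal matrix with entries `α ^ bk₀(π) δ ^ (nzbk(π) - n/2)`, where `s` is an invertible
square root of `δ`, so that `δ ^ (nzbk(π) - n/2) = s ^ (2 nzbk(π) - n)`. -/
noncomputable def scaling {R : Type*} [CommRing R] (n : ℕ) (α : R) (s : Rˣ) :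
    Matrix (NCPart n) (NCPart n) R :=
  Matrix.diagonal fun π => α ^ bk₀ π.1 * ((s ^ (2 * (nzbk π.1 : ℤ) - (n : ℤ)) : Rˣ) : R)

end TypeB

namespace TypeB

section Blocks

variable {N M : ℕ}

theorem val_opp (i : Fin (2 * N)) :
    ((opp i : Fin (2 * N)) : ℕ) = if (i : ℕ) < N then (i : ℕ) + N else (i : ℕ) - N := by
  have := i.isLt
  simp only [opp]
  split_ifs with h
  · exact Nat.mod_eq_of_lt (by omega)
  · rw [Nat.mod_eq_sub_mod (by omega), Nat.mod_eq_of_lt (by omega)]; omega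

@[simp] theorem opp_opp (i : Fin (2 * N)) : opp (opp i) = i := by
  have := i.isLt
  apply Fin.ext
  rw [val_opp, val_opp]
  split_ifs <;> omega

theorem opp_injective : Function.Injective (opp : Fin (2 * N) → Fin (2 * N)) :=
  Function.LeftInverse.injective opp_opp

theorem opp_ne (i : Fin (2 * N)) : opp i ≠ i := by
  intro h
  have h' := congrArg Fin.val h
  have := i.isLt
  rw [val_opp] at h'
  split_ifs at h' <;> omega

/-- A set partition is sign-invariant. -/
def OppInvariant (r : Setoid (Fin (2 * N))) : Prop := ∀ a b, r a b → r (opp a) (opp b)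

theorem OppInvariant.iff {r : Setoid (Fin (2 * N))} (h : OppInvariant r) {a b} :
    r (opp a) (opp b) ↔ r a b :=
  ⟨fun hab => by simpa using h _ _ hab, h a b⟩

theorem OppInvariant.iff' {r : Setoid (Fin (2 * N))} (h : OppInvariant r) {a b} :
    r (opp a) b ↔ r a (opp b) :=
  ⟨fun hab => by simpa using h _ _ hab, fun hab => by simpa using h _ _ hab⟩

theorem image_opp_class {r : Setoid (Fin (2 * N))} (h : OppInvariant r) (y : Fin (2 * N)) :
    opp '' {x | r x y} = {x | r x (opp y)} := by
  ext x
  constructor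
  · rintro ⟨w, hw, rfl⟩
    exact h _ _ hw
  · intro hx
    exact ⟨opp x, by simpa using h _ _ hx, opp_opp x⟩

theorem class_eq_iff {α : Type*} {r : Setoid α} {y z : α} :
    {x | r x y} = {x | r x z} ↔ r y z :=
  ⟨fun h => by
    have : y ∈ {x | r x y} := r.refl y
    rw [h] at this; exact this,
   fun h => by
    ext x; exact ⟨fun hx => r.trans hx h, fun hx => r.trans hx (r.symm h)⟩⟩

theorem opp_image_mem_classes_iff {r : Setoid (Fin (2 * N))} :
    (∀ K ∈ r.classes, opp '' K ∈ r.classes) ↔ OppInvariant r := by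
  constructor
  · intro h a b hab
    obtain ⟨c, hc⟩ := h _ (r.mem_classes b)
    have ha : opp a ∈ opp '' {x | r x b} := ⟨a, hab, rfl⟩
    have hb : opp b ∈ opp '' {x | r x b} := ⟨b, r.refl b, rfl⟩
    rw [hc] at ha hb
    exact r.trans ha (r.symm hb)
  · rintro h K ⟨y, rfl⟩
    rw [image_opp_class h]
    exact r.mem_classes _

theorem mem_zeroBlocks_iff {r : Setoid (Fin (2 * N))} (h : OppInvariant r)
    {K : Set (Fin (2 * N))} :
    K ∈ zeroBlocks r ↔ ∃ y, K = {x | r x y} ∧ r (opp y) y := by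
  constructor
  · rintro ⟨⟨y, rfl⟩, hy⟩
    rw [image_opp_class h, class_eq_iff] at hy
    exact ⟨y, rfl, hy⟩
  · rintro ⟨y, rfl, hy⟩
    refine ⟨r.mem_classes y, ?_⟩
    rw [image_opp_class h, class_eq_iff]
    exact hy

theorem mem_nonzeroBlocks_iff {r : Setoid (Fin (2 * N))} (h : OppInvariant r)
    {K : Set (Fin (2 * N))} :
    K ∈ nonzeroBlocks r ↔ ∃ y, K = {x | r x y} ∧ ¬ r (opp y) y := by
  constructor
  · rintro ⟨⟨y, rfl⟩, hy⟩
    rw [image_opp_class h, Ne, class_eq_iff] at hy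
    exact ⟨y, rfl, hy⟩
  · rintro ⟨y, rfl, hy⟩
    refine ⟨r.mem_classes y, ?_⟩
    rw [image_opp_class h, Ne, class_eq_iff]
    exact hy

theorem OppInvariant.comap {r : Setoid (Fin (2 * M))} (h : OppInvariant r)
    {φ : Fin (2 * N) → Fin (2 * M)} (hφ : ∀ a, φ (opp a) = opp (φ a)) :
    OppInvariant (r.comap φ) := by
  intro a b hab
  simp only [Setoid.comap_rel, hφ] at hab ⊢
  exact h _ _ hab

theorem OppInvariant.sup {r s : Setoid (Fin (2 * N))} (hr : OppInvariant r) (hs : OppInvariant s) :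
    OppInvariant (r ⊔ s) := by
  have : r ⊔ s ≤ (r ⊔ s).comap opp :=
    sup_le (fun a b h => (le_sup_left : r ≤ r ⊔ s) (hr _ _ h))
      (fun a b h => (le_sup_right : s ≤ r ⊔ s) (hs _ _ h))
  intro a b hab
  exact this hab

theorem preimage_injOn_classes {r : Setoid (Fin (2 * M))} (φ : Fin (2 * N) → Fin (2 * M)) :
    Set.InjOn (fun K => φ ⁻¹' K) {K | K ∈ r.classes ∧ ∃ a, φ a ∈ K} := by
  rintro K ⟨hK, a, ha⟩ L ⟨hL, -⟩ hKL
  have ha' : φ a ∈ L := by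
    have : a ∈ φ ⁻¹' K := ha
    rw [show φ ⁻¹' K = φ ⁻¹' L from hKL] at this
    exact this
  exact Setoid.eq_of_mem_classes hK ha hL ha'

theorem zeroBlocks_comap {r : Setoid (Fin (2 * M))} (h : OppInvariant r)
    {φ : Fin (2 * N) → Fin (2 * M)} (hφ : ∀ a, φ (opp a) = opp (φ a)) :
    zeroBlocks (r.comap φ) = (fun K => φ ⁻¹' K) '' {K | K ∈ zeroBlocks r ∧ ∃ a, φ a ∈ K} := by
  ext K
  rw [mem_zeroBlocks_iff (h.comap hφ)]
  constructor
  · rintro ⟨y, rfl, hy⟩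
    refine ⟨{x | r x (φ y)}, ⟨(mem_zeroBlocks_iff h).2 ⟨_, rfl, ?_⟩, y, r.refl _⟩, rfl⟩
    simpa [Setoid.comap_rel, hφ] using hy
  · rintro ⟨L, ⟨hL, a, ha⟩, rfl⟩
    obtain ⟨y, rfl, hy⟩ := (mem_zeroBlocks_iff h).1 hL
    refine ⟨a, ?_, ?_⟩
    · ext x
      exact ⟨fun hx => r.trans hx (r.symm ha), fun hx => r.trans hx ha⟩
    · rw [Setoid.comap_rel, hφ]
      exact r.trans (h _ _ ha) (r.trans hy (r.symm ha))

theorem nonzeroBlocks_comap {r : Setoid (Fin (2 * M))} (h : OppInvariant r)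
    {φ : Fin (2 * N) → Fin (2 * M)} (hφ : ∀ a, φ (opp a) = opp (φ a)) :
    nonzeroBlocks (r.comap φ) =
      (fun K => φ ⁻¹' K) '' {K | K ∈ nonzeroBlocks r ∧ ∃ a, φ a ∈ K} := by
  ext K
  rw [mem_nonzeroBlocks_iff (h.comap hφ)]
  constructor
  · rintro ⟨y, rfl, hy⟩
    refine ⟨{x | r x (φ y)}, ⟨(mem_nonzeroBlocks_iff h).2 ⟨_, rfl, ?_⟩, y, r.refl _⟩, rfl⟩
    simpa [Setoid.comap_rel, hφ] using hy
  · rintro ⟨L, ⟨hL, a, ha⟩, rfl⟩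
    obtain ⟨y, rfl, hy⟩ := (mem_nonzeroBlocks_iff h).1 hL
    refine ⟨a, ?_, ?_⟩
    · ext x
      exact ⟨fun hx => r.trans hx (r.symm ha), fun hx => r.trans hx ha⟩
    · rw [Setoid.comap_rel, hφ]
      exact fun hc => hy (r.trans (h _ _ (r.symm ha)) (r.trans hc ha))

theorem bk₀_comap {r : Setoid (Fin (2 * M))} (h : OppInvariant r)
    {φ : Fin (2 * N) → Fin (2 * M)} (hφ : ∀ a, φ (opp a) = opp (φ a)) :
    bk₀ (r.comap φ) = {K | K ∈ zeroBlocks r ∧ ∃ a, φ a ∈ K}.ncard := by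
  rw [bk₀, zeroBlocks_comap h hφ]
  exact Set.InjOn.ncard_image (Set.InjOn.mono (fun K hK => And.intro hK.1.1 hK.2)
    (preimage_injOn_classes (r := r) φ))

theorem ncard_nonzeroBlocks_comap {r : Setoid (Fin (2 * M))} (h : OppInvariant r)
    {φ : Fin (2 * N) → Fin (2 * M)} (hφ : ∀ a, φ (opp a) = opp (φ a)) :
    (nonzeroBlocks (r.comap φ)).ncard = {K | K ∈ nonzeroBlocks r ∧ ∃ a, φ a ∈ K}.ncard := by
  rw [nonzeroBlocks_comap h hφ]
  exact Set.InjOn.ncard_image (Set.InjOn.mono (fun K hK => And.intro hK.1.1 hK.2)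
    (preimage_injOn_classes (r := r) φ))

theorem exists_mem_of_mem_classes {α β : Type*} {r : Setoid β} {φ : α → β}
    (hs : Function.Surjective φ) {K : Set β} (hK : K ∈ r.classes) : ∃ a, φ a ∈ K := by
  obtain ⟨y, rfl⟩ := hK
  obtain ⟨a, rfl⟩ := hs y
  exact ⟨a, r.refl _⟩

theorem bk₀_comap_of_surjective {r : Setoid (Fin (2 * M))} (h : OppInvariant r)
    {φ : Fin (2 * N) → Fin (2 * M)} (hφ : ∀ a, φ (opp a) = opp (φ a))
    (hs : Function.Surjective φ) : bk₀ (r.comap φ) = bk₀ r := by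
  rw [bk₀_comap h hφ, bk₀]
  congr 1
  ext K
  exact ⟨fun hK => hK.1, fun hK => ⟨hK, exists_mem_of_mem_classes hs hK.1⟩⟩

theorem nzbk_comap_of_surjective {r : Setoid (Fin (2 * M))} (h : OppInvariant r)
    {φ : Fin (2 * N) → Fin (2 * M)} (hφ : ∀ a, φ (opp a) = opp (φ a))
    (hs : Function.Surjective φ) : nzbk (r.comap φ) = nzbk r := by
  rw [nzbk, ncard_nonzeroBlocks_comap h hφ, nzbk]
  congr 2
  ext K
  exact ⟨fun hK => hK.1, fun hK => ⟨hK, exists_mem_of_mem_classes hs hK.1⟩⟩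

/-- `r'` is the finest sign-invariant coarsening of `r` in which `c` and `d` are equivalent. -/
structure IsMerge (r r' : Setoid (Fin (2 * N))) (c d : Fin (2 * N)) : Prop where
  le : r ≤ r'
  rel : r' c d
  inv : OppInvariant r'
  min : ∀ s : Setoid (Fin (2 * N)), r ≤ s → s c d → s (opp c) (opp d) → r' ≤ s

theorem ncard_diff_pair {α : Type*} [Finite α] {s : Set α} {a b : α} (ha : a ∈ s) (hb : b ∈ s)
    (hab : a ≠ b) : s.ncard = (s \ {a, b}).ncard + 2 := by
  have h := Set.ncard_sdiff_add_ncard_of_subset (s := {a, b}) (t := s)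
    (by rintro x (rfl | rfl) <;> assumption)
  rw [Set.ncard_pair hab] at h
  exact h.symm

open Classical in
theorem IsMerge.counts {r r' : Setoid (Fin (2 * N))} (h : OppInvariant r) {c d : Fin (2 * N)}
    (hm : IsMerge r r' c d) (hc : ¬ r c (opp c)) (hcd : ¬ r c d) (hcd' : ¬ r c (opp d)) :
    bk₀ r' = bk₀ r ∧ nzbk r = nzbk r' + 1 := by
  have hocd : ¬ r (opp c) d := fun hh => hcd' (h.iff'.1 hh)
  set φ : Fin (2 * N) → Fin (2 * N) :=
    fun a => if r c a then d else if r (opp c) a then opp d else a with hφdef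
  have hφC : ∀ a, r c a → φ a = d := fun a ha => by simp [hφdef, ha]
  have hφC' : ∀ a, r (opp c) a → φ a = opp d := fun a ha => by
    have : ¬ r c a := fun hca => hc (r.trans hca (r.symm ha))
    simp [hφdef, ha, this]
  have hφo : ∀ a, ¬ r c a → ¬ r (opp c) a → φ a = a := fun a h1 h2 => by simp [hφdef, h1, h2]
  have hφ : ∀ a, φ (opp a) = opp (φ a) := by
    intro a
    by_cases h1 : r c a
    · rw [hφC a h1, hφC' _ (h _ _ h1)]
    by_cases h2 : r (opp c) a
    · rw [hφC' a h2, hφC _ (h.iff'.1 h2), opp_opp]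
    · rw [hφo a h1 h2, hφo _ (fun hh => h2 (h.iff'.2 hh)) (fun hh => h1 (h.iff.1 hh))]
  have heq : r' = r.comap φ := by
    apply le_antisymm
    · apply hm.min
      · intro a b hab
        rw [Setoid.comap_rel]
        by_cases h1 : r c a
        · rw [hφC a h1, hφC b (r.trans h1 hab)]
        by_cases h2 : r (opp c) a
        · rw [hφC' a h2, hφC' b (r.trans h2 hab)]
        · rw [hφo a h1 h2, hφo b (fun hh => h1 (r.trans hh (r.symm hab)))
            (fun hh => h2 (r.trans hh (r.symm hab)))]
          exact hab
      · rw [Setoid.comap_rel, hφC c (r.refl c), hφo d hcd hocd]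
      · rw [Setoid.comap_rel, hφC' _ (r.refl _), hφo (opp d) hcd' (fun hh => hcd (h.iff.1 hh))]
    · have key : ∀ a, r' a (φ a) := by
        intro a
        by_cases h1 : r c a
        · rw [hφC a h1]; exact r'.trans (hm.le (r.symm h1)) hm.rel
        by_cases h2 : r (opp c) a
        · rw [hφC' a h2]; exact r'.trans (hm.le (r.symm h2)) (hm.inv _ _ hm.rel)
        · rw [hφo a h1 h2]
      intro a b hab
      exact r'.trans (key a) (r'.trans (hm.le hab) (r'.symm (key b)))
  have hrange : ∀ y, (∃ a, r (φ a) y) ↔ ¬ r c y ∧ ¬ r (opp c) y := by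
    intro y
    constructor
    · rintro ⟨a, ha⟩
      by_cases h1 : r c a
      · rw [hφC a h1] at ha
        exact ⟨fun hh => hcd (r.trans hh (r.symm ha)), fun hh => hocd (r.trans hh (r.symm ha))⟩
      by_cases h2 : r (opp c) a
      · rw [hφC' a h2] at ha
        exact ⟨fun hh => hcd' (r.trans hh (r.symm ha)),
          fun hh => hcd (h.iff.1 (r.trans hh (r.symm ha)))⟩
      · rw [hφo a h1 h2] at ha
        exact ⟨fun hh => h1 (r.trans hh (r.symm ha)), fun hh => h2 (r.trans hh (r.symm ha))⟩
    · rintro ⟨h1, h2⟩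
      exact ⟨y, by rw [hφo y h1 h2]⟩
  constructor
  · rw [heq, bk₀_comap h hφ, bk₀]
    congr 1
    ext K
    refine ⟨fun hK => hK.1, fun hK => ⟨hK, ?_⟩⟩
    obtain ⟨y, rfl, hy⟩ := (mem_zeroBlocks_iff h).1 hK
    refine (hrange y).2 ⟨fun hh => hc ?_, fun hh => hc ?_⟩
    · exact r.trans hh (r.trans (r.symm hy) (r.symm (h _ _ hh)))
    · exact r.trans (h.iff'.1 (r.trans hh (r.symm hy))) (by
        rw [opp_opp]; exact r.symm hh)
  · have h1 : {x | r x c} ∈ nonzeroBlocks r :=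
      (mem_nonzeroBlocks_iff h).2 ⟨c, rfl, fun hh => hc (r.symm hh)⟩
    have h2 : {x | r x (opp c)} ∈ nonzeroBlocks r :=
      (mem_nonzeroBlocks_iff h).2 ⟨opp c, rfl, fun hh => hc (by simpa using hh)⟩
    have h3 : {x | r x c} ≠ {x | r x (opp c)} := fun hh => hc (class_eq_iff.1 hh)
    have h4 : {K | K ∈ nonzeroBlocks r ∧ ∃ a, φ a ∈ K} =
        nonzeroBlocks r \ {{x | r x c}, {x | r x (opp c)}} := by
      ext K
      simp only [Set.mem_ofPred_eq, Set.mem_sdiff, Set.mem_insert_iff, Set.mem_singleton_iff]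
      refine and_congr_right fun hK => ?_
      obtain ⟨y, rfl, hy⟩ := (mem_nonzeroBlocks_iff h).1 hK
      rw [class_eq_iff, class_eq_iff, not_or]
      refine (hrange y).trans (and_congr (not_congr ?_) (not_congr ?_)) <;>
        exact ⟨fun hh => r.symm hh, fun hh => r.symm hh⟩
    rw [heq, nzbk, nzbk, ncard_nonzeroBlocks_comap h hφ, h4, ncard_diff_pair h1 h2 h3]
    omega

theorem IsMerge.counts_opp {r r' : Setoid (Fin (2 * N))} (h : OppInvariant r) {c d : Fin (2 * N)}
    (hm : IsMerge r r' c d) (hc : ¬ r c (opp c)) (hcd : r c (opp d)) :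
    bk₀ r' = bk₀ r + 1 ∧ nzbk r = nzbk r' + 1 := by
  have hocd : r (opp c) d := by simpa using h _ _ hcd
  have hrel : ∀ a b, r' a b ↔ r a b ∨ ((r c a ∨ r (opp c) a) ∧ (r c b ∨ r (opp c) b)) := by
    let s : Setoid (Fin (2 * N)) :=
      { r := fun a b => r a b ∨ ((r c a ∨ r (opp c) a) ∧ (r c b ∨ r (opp c) b))
        iseqv :=
          { refl := fun a => Or.inl (r.refl a)
            symm := fun {a b} hab => hab.elim (fun h => Or.inl (r.symm h)) fun h => Or.inr h.symm
            trans := fun {a b e} hab hbe => by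
              rcases hab with hab | ⟨ha, hb⟩ <;> rcases hbe with hbe | ⟨hb', he⟩
              · exact Or.inl (r.trans hab hbe)
              · exact Or.inr ⟨hb'.imp (fun hh => r.trans hh (r.symm hab))
                  (fun hh => r.trans hh (r.symm hab)), he⟩
              · exact Or.inr ⟨ha, hb.imp (fun hh => r.trans hh hbe) (fun hh => r.trans hh hbe)⟩
              · exact Or.inr ⟨ha, he⟩ } }
    have hs : r' ≤ s := by
      apply hm.min
      · intro a b hab; exact Or.inl hab
      · exact Or.inr ⟨Or.inl (r.refl c), Or.inr hocd⟩
      · exact Or.inr ⟨Or.inr (r.refl _), Or.inl hcd⟩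
    have hcc : r' c (opp c) := r'.trans hm.rel (r'.symm (hm.le hocd))
    intro a b
    refine ⟨fun hab => hs hab, ?_⟩
    rintro (hab | ⟨ha, hb⟩)
    · exact hm.le hab
    · have : ∀ e, r c e ∨ r (opp c) e → r' c e := by
        rintro e (he | he)
        · exact hm.le he
        · exact r'.trans hcc (hm.le he)
      exact r'.trans (r'.symm (this a ha)) (this b hb)
  have hset : ∀ y, ¬ r c y → ¬ r (opp c) y → {x | r' x y} = {x | r x y} := by
    intro y h1 h2
    ext x
    simp only [Set.mem_ofPred_eq, hrel]
    tauto
  have hself : ∀ a, r c a ∨ r (opp c) a → r' (opp a) a := by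
    intro a ha
    refine (hrel _ _).2 (Or.inr ⟨?_, ha⟩)
    rcases ha with ha | ha
    · exact Or.inr (h _ _ ha)
    · exact Or.inl (h.iff'.1 ha)
  have hnz : ∀ y, r (opp y) y → ¬ r c y ∧ ¬ r (opp c) y := by
    intro y hy
    have h1 : ¬ r c y := fun hh => hc (r.trans hh (r.trans (r.symm hy) (r.symm (h _ _ hh))))
    refine ⟨h1, fun hh => h1 ?_⟩
    exact r.trans (h.iff'.1 hh) hy
  have hz : zeroBlocks r' = insert {x | r' x c} (zeroBlocks r) := by
    ext K
    rw [Set.mem_insert_iff, mem_zeroBlocks_iff h, mem_zeroBlocks_iff hm.inv]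
    constructor
    · rintro ⟨y, rfl, hy⟩
      by_cases hcy : r c y ∨ r (opp c) y
      · left
        rw [class_eq_iff, hrel]
        exact Or.inr ⟨hcy, Or.inl (r.refl c)⟩
      · push Not at hcy
        right
        refine ⟨y, hset y hcy.1 hcy.2, ?_⟩
        rw [hrel] at hy
        tauto
    · rintro (rfl | ⟨y, rfl, hy⟩)
      · exact ⟨c, rfl, hself c (Or.inl (r.refl c))⟩
      · exact ⟨y, (hset y (hnz y hy).1 (hnz y hy).2).symm, hm.le hy⟩
  have hn : nonzeroBlocks r' = nonzeroBlocks r \ {{x | r x c}, {x | r x (opp c)}} := by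
    ext K
    simp only [Set.mem_sdiff, Set.mem_insert_iff, Set.mem_singleton_iff, not_or]
    rw [mem_nonzeroBlocks_iff h, mem_nonzeroBlocks_iff hm.inv]
    constructor
    · rintro ⟨y, rfl, hy⟩
      have hcy : ¬ (r c y ∨ r (opp c) y) := fun hh => hy (hself y hh)
      push Not at hcy
      rw [hset y hcy.1 hcy.2]
      refine ⟨⟨y, rfl, fun hh => hy (hm.le hh)⟩, ?_, ?_⟩ <;> rw [class_eq_iff]
      · exact fun hh => hcy.1 (r.symm hh)
      · exact fun hh => hcy.2 (r.symm hh)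
    · rintro ⟨⟨y, rfl, hy⟩, h1, h2⟩
      rw [class_eq_iff] at h1 h2
      have h1' : ¬ r c y := fun hh => h1 (r.symm hh)
      have h2' : ¬ r (opp c) y := fun hh => h2 (r.symm hh)
      refine ⟨y, (hset y h1' h2').symm, ?_⟩
      rw [hrel]
      tauto
  constructor
  · rw [bk₀, hz, Set.ncard_insert_of_notMem, bk₀]
    rw [mem_zeroBlocks_iff h]
    rintro ⟨y, hy, hy'⟩
    have hcy : c ∈ {x | r' x c} := r'.refl c
    rw [hy] at hcy
    exact (hnz y hy').1 hcy
  · have h1 : {x | r x c} ∈ nonzeroBlocks r :=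
      (mem_nonzeroBlocks_iff h).2 ⟨c, rfl, fun hh => hc (r.symm hh)⟩
    have h2 : {x | r x (opp c)} ∈ nonzeroBlocks r :=
      (mem_nonzeroBlocks_iff h).2 ⟨opp c, rfl, fun hh => hc (by simpa using hh)⟩
    have h3 : {x | r x c} ≠ {x | r x (opp c)} := fun hh => hc (class_eq_iff.1 hh)
    rw [nzbk, nzbk, hn, ncard_diff_pair h1 h2 h3]
    omega

end Blocks

end TypeB

namespace TypeB

/-- The lift to the universal cover `ℤ` of a non-crossing pairing, in an annulus, of `2 * n` points
on its outer boundary. -/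
structure PerNC (n : ℕ) where
  /-- The partner of a point. -/
  toFun : ℤ → ℤ
  inv' : ∀ x, toFun (toFun x) = x
  ne' : ∀ x, toFun x ≠ x
  per' : ∀ x, toFun (x + 2 * n) = toFun x + 2 * n
  nc' : ∀ a b, a < b → b < toFun a → a < toFun b ∧ toFun b < toFun a

namespace PerNC

variable {n : ℕ}

instance : CoeFun (PerNC n) (fun _ => ℤ → ℤ) := ⟨toFun⟩

theorem ext {f g : PerNC n} (h : ∀ x, f x = g x) : f = g := by
  cases f; cases g
  congr
  exact funext h

variable (f : PerNC n)

theorem inv (x : ℤ) : f (f x) = x := f.inv' x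
theorem ne (x : ℤ) : f x ≠ x := f.ne' x
theorem per (x : ℤ) : f (x + 2 * n) = f x + 2 * n := f.per' x
theorem per_sub (x : ℤ) : f (x - 2 * n) = f x - 2 * n := by
  have := f.per (x - 2 * n)
  rw [sub_add_cancel] at this
  omega

theorem per_mul (x k : ℤ) : f (x + 2 * n * k) = f x + 2 * n * k := by
  induction k using Int.induction_on with
  | zero => simp
  | succ i ih =>
    rw [mul_add, mul_one, ← add_assoc, f.per, ih]; ring
  | pred i ih =>
    rw [mul_sub, mul_one, ← add_sub_assoc, f.per_sub, ih]; ring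

theorem nc {a b : ℤ} (h : a < b) (h' : b < f a) : a < f b ∧ f b < f a := f.nc' a b h h'

theorem nc_rev {a b : ℤ} (h : f a < b) (h' : b < a) : f a < f b ∧ f b < a := by
  have := f.nc (a := f a) (b := b) h (by rwa [f.inv])
  rwa [f.inv] at this

theorem inj {a b : ℤ} (h : f a = f b) : a = b := by
  rw [← f.inv a, h, f.inv]

theorem lt_add [NeZero n] (x : ℤ) : f x < x + 2 * n := by
  have hn : 0 < n := NeZero.pos n
  by_contra h
  have h1 := f.per x
  rcases eq_or_lt_of_le (not_lt.1 h) with h2 | h2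
  · rw [h2, f.inv] at h1; omega
  · have := f.nc (a := x) (b := x + 2 * n) (by omega) h2
    omega

theorem sub_lt [NeZero n] (x : ℤ) : x - 2 * n < f x := by
  have := f.lt_add (f x)
  rw [f.inv] at this
  omega

theorem dvd_iff (a b : ℤ) : 2 * (n : ℤ) ∣ f a - f b ↔ 2 * (n : ℤ) ∣ a - b := by
  have key : ∀ a b : ℤ, 2 * (n : ℤ) ∣ a - b → 2 * (n : ℤ) ∣ f a - f b := by
    rintro a b ⟨k, hk⟩
    have : a = b + 2 * n * k := by omega
    rw [this, f.per_mul]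
    exact ⟨k, by ring⟩
  refine ⟨fun h => ?_, key a b⟩
  have := key _ _ h
  rwa [f.inv, f.inv] at this

theorem dvd_iff' (a b : ℤ) : 2 * (n : ℤ) ∣ f a - b ↔ 2 * (n : ℤ) ∣ a - f b := by
  rw [← f.dvd_iff a (f b), f.inv]

end PerNC

theorem dvd_cases {m d : ℤ} (h : m ∣ d) (h1 : -(2 * m) < d) (h2 : d < 2 * m) :
    d = -m ∨ d = 0 ∨ d = m := by
  obtain ⟨k, rfl⟩ := h
  have hm : 0 < m := by omega
  have hk1 : -2 < k := by nlinarith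
  have hk2 : k < 2 := by nlinarith
  obtain rfl | rfl | rfl : k = -1 ∨ k = 0 ∨ k = 1 := by omega
  all_goals simp

theorem dvd_zero_of_lt {m d : ℤ} (h : m ∣ d) (h1 : -m < d) (h2 : d < m) : d = 0 := by
  rcases dvd_cases h (by omega) (by omega) with h | h | h <;> omega

theorem even_card_of_involution {α : Type*} (s : Finset α) (g : α → α)
    (hg : ∀ a ∈ s, g a ∈ s) (hinv : ∀ a ∈ s, g (g a) = a) (hne : ∀ a ∈ s, g a ≠ a) :
    Even s.card := by
  have h : ∑ _a ∈ s, (1 : ZMod 2) = 0 :=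
    Finset.sum_involution (fun a _ => g a) (fun _ _ => by decide) (fun a ha _ => hne a ha)
      (fun a ha => hg a ha) (fun a ha => hinv a ha)
  rw [Finset.sum_const, nsmul_eq_mul, mul_one] at h
  exact (ZMod.natCast_eq_zero_iff_even).1 h

theorem PerNC.odd_sub {n : ℕ} (f : PerNC n) (x : ℤ) : (f x - x) % 2 = 1 := by
  have key : ∀ x, x < f x → (f x - x) % 2 = 1 := by
    intro x hx
    have := even_card_of_involution (Finset.Ioo x (f x)) f
      (fun a ha => by
        rw [Finset.mem_Ioo] at ha ⊢
        exact f.nc ha.1 ha.2)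
      (fun a _ => f.inv a) (fun a _ => f.ne a)
    rw [Int.card_Ioo, Nat.even_iff] at this
    omega
  rcases lt_or_gt_of_ne (f.ne x) with h | h
  · have := key (f x) (by rwa [f.inv])
    rw [f.inv] at this
    omega
  · exact key x h

/-- The interval between `u` and `v` is shorter than a period and closed under `f`, and `u`, `v` are
not partners. -/
structure PerNC.Cut {n : ℕ} (f : PerNC n) (u v : ℤ) : Prop where
  lt : u < v
  lt' : v < u + 2 * n
  closed : ∀ w, u < w → w < v → u < f w ∧ f w < v
  ne : f u ≠ v

namespace PerNC.Cut

variable {n : ℕ} {f : PerNC n} {u v : ℤ} (h : f.Cut u v)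
include h

theorem ne' : f v ≠ u := fun hh => h.ne (by rw [← hh, f.inv])

theorem n_pos : 0 < n := by have := h.lt; have := h.lt'; omega

theorem not_mem_fu : f u < u ∨ v < f u := by
  by_contra hh
  push Not at hh
  have h1 := f.ne u
  have h2 := h.ne
  have h3 := h.closed (f u) (by omega) (by omega)
  rw [f.inv] at h3
  omega

theorem not_mem_fv : f v < u ∨ v < f v := by
  by_contra hh
  push Not at hh
  have h1 := f.ne v
  have h2 := h.ne'
  have h3 := h.closed (f v) (by omega) (by omega)
  rw [f.inv] at h3
  omega

theorem trichotomy :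
    (f u < u ∧ v < f v) ∨ (f v < f u ∧ f u < u) ∨ (v < f v ∧ f v < f u) := by
  have hlt := h.lt
  have hu := h.not_mem_fu
  have hv := h.not_mem_fv
  rcases hu with hu | hu
  · rcases hv with hv | hv
    · right; left
      refine ⟨?_, hu⟩
      by_contra hh
      have hne : f u ≠ f v := fun hh => by have := f.inj hh; omega
      have := f.nc_rev (a := u) (b := f v) (by omega) hv
      rw [f.inv] at this
      omega
    · exact Or.inl ⟨hu, hv⟩
  · right; right
    have := f.nc (a := u) (b := v) hlt hu
    omega

theorem special_iff : f u = v - 2 * n ↔ f v = u + 2 * n := by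
  constructor
  · intro hh
    have := f.per (f u)
    rw [f.inv, hh, sub_add_cancel] at this
    exact this
  · intro hh
    have := f.per_sub (f v)
    rw [f.inv, hh, add_sub_cancel_right] at this
    exact this

theorem window (hs : f u ≠ v - 2 * n) (h1 : f u < u) (h2 : v < f v) : f v < f u + 2 * n := by
  have hlt := h.lt
  have hlt' := h.lt'
  have : NeZero n := ⟨by have := h.n_pos; omega⟩
  have hsx := f.per (f u)
  have hsy := f.per_sub (f v)
  rw [f.inv] at hsx hsy
  have b1 := f.sub_lt u
  have b2 := f.lt_add v
  have hs' : f v ≠ u + 2 * n := fun hh => hs (h.special_iff.2 hh)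
  by_contra hh
  have e1 : f v ≠ f u + 2 * n := by
    intro he
    rw [he, add_sub_cancel_right, f.inv] at hsy
    omega
  rcases lt_or_ge (f u + 2 * n) v with h3 | h3
  · have := h.closed _ (by omega) h3
    omega
  · rcases lt_or_ge u (f v - 2 * n) with h4 | h4
    · have := h.closed _ h4 (by omega)
      omega
    · have := f.nc_rev (a := u) (b := f v - 2 * n) (by omega) (by omega)
      omega

theorem not_dvd_uv : ¬ 2 * (n : ℤ) ∣ u - v := fun hh => by
  have h1 := h.lt
  have h2 := h.lt'
  have := dvd_zero_of_lt hh (by omega) (by omega)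
  omega

theorem not_dvd_ufu : ¬ 2 * (n : ℤ) ∣ f u - u := fun hh => by
  have : NeZero n := ⟨by have := h.n_pos; omega⟩
  have := f.lt_add u
  have := f.sub_lt u
  have := f.ne u
  have := dvd_zero_of_lt hh (by omega) (by omega)
  omega

theorem not_dvd_vfv : ¬ 2 * (n : ℤ) ∣ f v - v := fun hh => by
  have : NeZero n := ⟨by have := h.n_pos; omega⟩
  have := f.lt_add v
  have := f.sub_lt v
  have := f.ne v
  have := dvd_zero_of_lt hh (by omega) (by omega)
  omega

theorem special_of_dvd (hh : 2 * (n : ℤ) ∣ f u - v) : f u = v - 2 * n := by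
  have : NeZero n := ⟨by have := h.n_pos; omega⟩
  have := f.lt_add u
  have := f.sub_lt u
  have := h.lt
  have := h.lt'
  have := h.ne
  have := dvd_cases hh (by omega) (by omega)
  omega

theorem special_of_dvd' (hh : 2 * (n : ℤ) ∣ f v - u) : f u = v - 2 * n := by
  apply h.special_of_dvd
  rw [f.dvd_iff', ← neg_sub, dvd_neg]
  exact hh

theorem not_dvd_fufv : ¬ 2 * (n : ℤ) ∣ f u - f v := fun hh =>
  h.not_dvd_uv ((f.dvd_iff u v).1 hh)

end PerNC.Cut

/-- The rewiring of `f` that makes `u`, `v` partners and joins their former partners. -/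
def PerNC.rewire {n : ℕ} (f : PerNC n) (u v : ℤ) (w : ℤ) : ℤ :=
  if 2 * (n : ℤ) ∣ w - u then w + (v - u)
  else if 2 * (n : ℤ) ∣ w - v then w - (v - u)
  else if 2 * (n : ℤ) ∣ w - f u then w + (f v - f u)
  else if 2 * (n : ℤ) ∣ w - f v then w - (f v - f u)
  else f w

namespace PerNC.Cut

variable {n : ℕ} {f : PerNC n} {u v : ℤ}

theorem dvd_congr {m a b c : ℤ} (hab : m ∣ a - b) : m ∣ a - c ↔ m ∣ b - c := by
  have : a - c = (a - b) + (b - c) := by ring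
  rw [this, dvd_add_right hab]

theorem rewire_per (w : ℤ) : f.rewire u v (w + 2 * n) = f.rewire u v w + 2 * n := by
  have key : ∀ c, 2 * (n : ℤ) ∣ w + 2 * n - c ↔ 2 * (n : ℤ) ∣ w - c := fun c =>
    dvd_congr ⟨1, by ring⟩
  simp only [rewire, key, f.per]
  split_ifs <;> ring

theorem rewire_per_mul (w k : ℤ) : f.rewire u v (w + 2 * n * k) = f.rewire u v w + 2 * n * k := by
  have key : ∀ c, 2 * (n : ℤ) ∣ w + 2 * n * k - c ↔ 2 * (n : ℤ) ∣ w - c := fun c =>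
    dvd_congr ⟨k, by ring⟩
  simp only [rewire, key, f.per_mul]
  split_ifs <;> ring

theorem rewire_u {w : ℤ} (hw : 2 * (n : ℤ) ∣ w - u) : f.rewire u v w = w + (v - u) := by
  simp [rewire, hw]

theorem rewire_v (h : f.Cut u v) {w : ℤ} (hw : 2 * (n : ℤ) ∣ w - v) :
    f.rewire u v w = w - (v - u) := by
  have : ¬ 2 * (n : ℤ) ∣ w - u := by
    rw [dvd_congr hw, ← neg_sub, dvd_neg]
    exact h.not_dvd_uv
  simp [rewire, hw, this]

theorem rewire_fu (h : f.Cut u v) (hs : f u ≠ v - 2 * n) {w : ℤ} (hw : 2 * (n : ℤ) ∣ w - f u) :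
    f.rewire u v w = w + (f v - f u) := by
  have h1 : ¬ 2 * (n : ℤ) ∣ w - u := by rw [dvd_congr hw]; exact h.not_dvd_ufu
  have h2 : ¬ 2 * (n : ℤ) ∣ w - v := by rw [dvd_congr hw]; exact fun hh => hs (h.special_of_dvd hh)
  simp [rewire, hw, h1, h2]

theorem rewire_fv (h : f.Cut u v) (hs : f u ≠ v - 2 * n) {w : ℤ} (hw : 2 * (n : ℤ) ∣ w - f v) :
    f.rewire u v w = w - (f v - f u) := by
  have h1 : ¬ 2 * (n : ℤ) ∣ w - u := by rw [dvd_congr hw]; exact fun hh => hs (h.special_of_dvd' hh)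
  have h2 : ¬ 2 * (n : ℤ) ∣ w - v := by rw [dvd_congr hw]; exact h.not_dvd_vfv
  have h3 : ¬ 2 * (n : ℤ) ∣ w - f u := by
    rw [dvd_congr hw, ← neg_sub, dvd_neg]; exact h.not_dvd_fufv
  simp [rewire, hw, h1, h2, h3]

theorem rewire_of_not {w : ℤ} (h1 : ¬ 2 * (n : ℤ) ∣ w - u) (h2 : ¬ 2 * (n : ℤ) ∣ w - v)
    (h3 : ¬ 2 * (n : ℤ) ∣ w - f u) (h4 : ¬ 2 * (n : ℤ) ∣ w - f v) : f.rewire u v w = f w := by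
  simp [rewire, h1, h2, h3, h4]

/-- The possible positions of a point relative to a rewiring. -/
theorem rewire_cases (h : f.Cut u v) (w : ℤ) :
    (2 * (n : ℤ) ∣ w - u) ∨ (2 * (n : ℤ) ∣ w - v) ∨
    (f u ≠ v - 2 * n ∧ 2 * (n : ℤ) ∣ w - f u) ∨ (f u ≠ v - 2 * n ∧ 2 * (n : ℤ) ∣ w - f v) ∨
    (¬ 2 * (n : ℤ) ∣ w - u ∧ ¬ 2 * (n : ℤ) ∣ w - v ∧ ¬ 2 * (n : ℤ) ∣ w - f u ∧
      ¬ 2 * (n : ℤ) ∣ w - f v) := by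
  by_cases h1 : 2 * (n : ℤ) ∣ w - u
  · exact Or.inl h1
  by_cases h2 : 2 * (n : ℤ) ∣ w - v
  · exact Or.inr (Or.inl h2)
  by_cases hs : f u = v - 2 * n
  · have e1 : 2 * (n : ℤ) ∣ f u - v := ⟨-1, by rw [hs]; ring⟩
    have e2 : 2 * (n : ℤ) ∣ f v - u := ⟨1, by rw [h.special_iff.1 hs]; ring⟩
    have e3 : ¬ 2 * (n : ℤ) ∣ w - f u := fun hh => h2 ((dvd_congr hh).2 e1)
    have e4 : ¬ 2 * (n : ℤ) ∣ w - f v := fun hh => h1 ((dvd_congr hh).2 e2)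
    tauto
  · tauto

/-- Inside `(u, v)` nothing is rewired. -/
theorem not_dvd_of_mem (h : f.Cut u v) {w : ℤ} (h1 : u < w) (h2 : w < v) :
    ¬ 2 * (n : ℤ) ∣ w - u ∧ ¬ 2 * (n : ℤ) ∣ w - v ∧ ¬ 2 * (n : ℤ) ∣ w - f u ∧
      ¬ 2 * (n : ℤ) ∣ w - f v := by
  have hlt' := h.lt'
  have key : ∀ w, u < w → w < v → ¬ 2 * (n : ℤ) ∣ w - u ∧ ¬ 2 * (n : ℤ) ∣ w - v := by
    intro w h1 h2
    refine ⟨fun hh => ?_, fun hh => ?_⟩ <;>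
    · have := dvd_zero_of_lt hh (by omega) (by omega)
      omega
  obtain ⟨k1, k2⟩ := key w h1 h2
  obtain ⟨c1, c2⟩ := h.closed w h1 h2
  obtain ⟨k3, k4⟩ := key (f w) c1 c2
  exact ⟨k1, k2, fun hh => k3 ((f.dvd_iff' _ _).2 hh), fun hh => k4 ((f.dvd_iff' _ _).2 hh)⟩

theorem rewire_of_mem (h : f.Cut u v) {w : ℤ} (h1 : u < w) (h2 : w < v) :
    f.rewire u v w = f w := by
  obtain ⟨a, b, c, d⟩ := h.not_dvd_of_mem h1 h2
  exact rewire_of_not a b c d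

theorem rewire_inv (h : f.Cut u v) (w : ℤ) : f.rewire u v (f.rewire u v w) = w := by
  rcases h.rewire_cases w with hw | hw | ⟨hs, hw⟩ | ⟨hs, hw⟩ | ⟨h1, h2, h3, h4⟩
  · rw [rewire_u hw, h.rewire_v]
    · ring
    · convert hw using 1; ring
  · rw [h.rewire_v hw, rewire_u]
    · ring
    · convert hw using 1; ring
  · rw [h.rewire_fu hs hw, h.rewire_fv hs]
    · ring
    · convert hw using 1; ring
  · rw [h.rewire_fv hs hw, h.rewire_fu hs]
    · ring
    · convert hw using 1; ring
  · rw [rewire_of_not h1 h2 h3 h4, rewire_of_not, f.inv]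
    · rwa [f.dvd_iff']
    · rwa [f.dvd_iff']
    · rwa [f.dvd_iff]
    · rwa [f.dvd_iff]

theorem rewire_ne (h : f.Cut u v) (w : ℤ) : f.rewire u v w ≠ w := by
  have hlt := h.lt
  rcases h.rewire_cases w with hw | hw | ⟨hs, hw⟩ | ⟨hs, hw⟩ | ⟨h1, h2, h3, h4⟩
  · rw [rewire_u hw]; omega
  · rw [h.rewire_v hw]; omega
  · rw [h.rewire_fu hs hw]
    intro hh
    have := f.inj (a := u) (b := v) (by omega)
    omega
  · rw [h.rewire_fv hs hw]
    intro hh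
    have := f.inj (a := u) (b := v) (by omega)
    omega
  · rw [rewire_of_not h1 h2 h3 h4]; exact f.ne w

/-- If the interval `(lo, hi)` is shorter than a period, the points of it other than `u`, `v`, and
their partners are not rewired. -/
theorem rewire_of_window (h : f.Cut u v) {lo hi w : ℤ} (hl : hi ≤ lo + 2 * n)
    (hu : lo ≤ u ∧ u ≤ hi) (hv : lo ≤ v ∧ v ≤ hi) (hfu : lo ≤ f u ∧ f u ≤ hi)
    (hfv : lo ≤ f v ∧ f v ≤ hi) (hw : lo < w ∧ w < hi) (h1 : w ≠ u) (h2 : w ≠ v) (h3 : w ≠ f u)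
    (h4 : w ≠ f v) : f.rewire u v w = f w := by
  have := h.n_pos
  apply rewire_of_not
  all_goals
    intro hh
    have := dvd_zero_of_lt hh (by omega) (by omega)
    omega

theorem rewire_nc (h : f.Cut u v) (a b : ℤ) (hab : a < b) (hb : b < f.rewire u v a) :
    a < f.rewire u v b ∧ f.rewire u v b < f.rewire u v a := by
  have hlt := h.lt
  have hlt' := h.lt'
  have : NeZero n := ⟨by have := h.n_pos; omega⟩
  have b1 := f.lt_add u
  have b2 := f.sub_lt u
  have b3 := f.lt_add v
  have b4 := f.sub_lt v
  have hfuv : f u ≠ f v := fun hh => by have := f.inj hh; omega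
  rcases h.rewire_cases a with ha | ha | ⟨hs, ha⟩ | ⟨hs, ha⟩ | ⟨h1, h2, h3, h4⟩
  · rw [rewire_u ha] at hb ⊢
    obtain ⟨k, hk⟩ := ha
    have e : f.rewire u v b = f (b - 2 * n * k) + 2 * n * k := by
      rw [← h.rewire_of_mem (w := b - 2 * n * k) (by omega) (by omega), ← rewire_per_mul,
        sub_add_cancel]
    have := h.closed (b - 2 * n * k) (by omega) (by omega)
    omega
  · rw [h.rewire_v ha] at hb
    omega
  · rw [h.rewire_fu hs ha] at hb ⊢
    obtain ⟨k, hk⟩ := ha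
    have e : f.rewire u v b = f.rewire u v (b - 2 * n * k) + 2 * n * k := by
      rw [← rewire_per_mul, sub_add_cancel]
    suffices hmain : f u < f.rewire u v (b - 2 * n * k) ∧ f.rewire u v (b - 2 * n * k) < f v by
      omega
    generalize hc : b - 2 * n * k = c
    have c1 : f u < c := by omega
    have c2 : c < f v := by omega
    obtain ⟨t1, t2⟩ : f u < u ∧ v < f v := by
      rcases h.trichotomy with t | t | t <;> omega
    have hw := h.window hs t1 t2
    by_cases e1 : c = u
    · subst e1; rw [rewire_u (by simp)]; omega
    by_cases e2 : c = v
    · subst e2; rw [h.rewire_v (by simp)]; omega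
    rw [h.rewire_of_window (lo := f u) (hi := f v) (by omega) (by omega) (by omega) (by omega)
      (by omega) (by omega) e1 e2 (by omega) (by omega)]
    rcases lt_or_ge c u with e3 | e3
    · have := f.nc_rev (a := u) (b := c) c1 e3
      omega
    rcases lt_or_ge c v with e4 | e4
    · have := h.closed c (by omega) e4
      omega
    · have := f.nc (a := v) (b := c) (by omega) c2
      omega
  · rw [h.rewire_fv hs ha] at hb ⊢
    obtain ⟨k, hk⟩ := ha
    have e : f.rewire u v b = f.rewire u v (b - 2 * n * k) + 2 * n * k := by
      rw [← rewire_per_mul, sub_add_cancel]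
    suffices hmain : f v < f.rewire u v (b - 2 * n * k) ∧ f.rewire u v (b - 2 * n * k) < f u by
      omega
    generalize hc : b - 2 * n * k = c
    have c1 : f v < c := by omega
    have c2 : c < f u := by omega
    rcases h.trichotomy with t | t | t
    · omega
    · rw [h.rewire_of_window (lo := f v) (hi := v) (by omega) (by omega) (by omega) (by omega)
        (by omega) (by omega) (by omega) (by omega) (by omega) (by omega)]
      have k1 := f.nc_rev (a := v) (b := c) c1 (by omega)
      refine ⟨k1.1, ?_⟩
      by_contra hh
      rcases lt_or_ge u (f c) with e3 | e3
      · have := h.closed (f c) e3 k1.2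
        rw [f.inv] at this
        omega
      · rcases eq_or_ne (f c) u with e4 | e4
        · have : c = f u := by rw [← e4, f.inv]
          omega
        · rcases eq_or_ne (f c) (f u) with e5 | e5
          · have := f.inj e5; omega
          · have := f.nc_rev (a := u) (b := f c) (by omega) (by omega)
            rw [f.inv] at this
            omega
    · rw [h.rewire_of_window (lo := u) (hi := f u) (by omega) (by omega) (by omega) (by omega)
        (by omega) (by omega) (by omega) (by omega) (by omega) (by omega)]
      have k1 := f.nc (a := u) (b := c) (by omega) (by omega)
      refine ⟨?_, k1.2⟩
      by_contra hh
      rcases lt_or_ge (f c) v with e3 | e3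
      · have := h.closed (f c) k1.1 e3
        rw [f.inv] at this
        omega
      · rcases eq_or_ne (f c) v with e4 | e4
        · have : c = f v := by rw [← e4, f.inv]
          omega
        · rcases eq_or_ne (f c) (f v) with e5 | e5
          · have := f.inj e5; omega
          · have := f.nc (a := v) (b := f c) (by omega) (by omega)
            rw [f.inv] at this
            omega
  · rw [rewire_of_not h1 h2 h3 h4] at hb ⊢
    have fa1 : ¬ 2 * (n : ℤ) ∣ f a - u := by rwa [f.dvd_iff']
    have fa2 : ¬ 2 * (n : ℤ) ∣ f a - v := by rwa [f.dvd_iff']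
    have hU : ∀ k : ℤ, a < u + 2 * n * k ∧ u + 2 * n * k < f a →
        a < v + 2 * n * k ∧ v + 2 * n * k < f a := by
      rintro k ⟨k1, k2⟩
      refine ⟨by omega, ?_⟩
      by_contra hh
      have hne : f a ≠ v + 2 * n * k := fun he => fa2 ⟨k, by omega⟩
      have hp := f.per_mul (f a) (-k)
      rw [f.inv] at hp
      rw [mul_neg] at hp
      have := h.closed (f a + -(2 * n * k)) (by omega) (by omega)
      omega
    have hV : ∀ k : ℤ, a < v + 2 * n * k ∧ v + 2 * n * k < f a →
        a < u + 2 * n * k ∧ u + 2 * n * k < f a := by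
      rintro k ⟨k1, k2⟩
      refine ⟨?_, by omega⟩
      by_contra hh
      have hne : a ≠ u + 2 * n * k := fun he => h1 ⟨k, by omega⟩
      have hp := f.per_mul a (-k)
      rw [mul_neg] at hp
      have := h.closed (a + -(2 * n * k)) (by omega) (by omega)
      omega
    have hF := f.nc hab hb
    rcases h.rewire_cases b with hb' | hb' | ⟨hs, hb'⟩ | ⟨hs, hb'⟩ | ⟨g1, g2, g3, g4⟩
    · rw [rewire_u hb']
      obtain ⟨k, hk⟩ := hb'
      have := hU k (by omega)
      omega
    · rw [h.rewire_v hb']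
      obtain ⟨k, hk⟩ := hb'
      have := hV k (by omega)
      omega
    · rw [h.rewire_fu hs hb']
      obtain ⟨k, hk⟩ := hb'
      have hp := f.per_mul (f u) k
      rw [f.inv, show f u + 2 * n * k = b by omega] at hp
      have hk2 := hU k (by omega)
      have := f.nc hk2.1 hk2.2
      rw [f.per_mul] at this
      omega
    · rw [h.rewire_fv hs hb']
      obtain ⟨k, hk⟩ := hb'
      have hp := f.per_mul (f v) k
      rw [f.inv, show f v + 2 * n * k = b by omega] at hp
      have hk2 := hV k (by omega)
      have := f.nc hk2.1 hk2.2
      rw [f.per_mul] at this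
      omega
    · rw [rewire_of_not g1 g2 g3 g4]
      exact hF

/-- The rewired pairing. -/
def surgery (h : f.Cut u v) : PerNC n where
  toFun := f.rewire u v
  inv' := h.rewire_inv
  ne' := h.rewire_ne
  per' := rewire_per
  nc' := h.rewire_nc

theorem surgery_apply (h : f.Cut u v) (w : ℤ) : h.surgery w = f.rewire u v w := rfl

theorem surgery_u (h : f.Cut u v) : h.surgery u = v := by
  rw [surgery_apply, rewire_u (by simp)]; ring

theorem surgery_v (h : f.Cut u v) : h.surgery v = u := by
  rw [surgery_apply, h.rewire_v (by simp)]; ring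

theorem surgery_fu (h : f.Cut u v) (hs : f u ≠ v - 2 * n) : h.surgery (f u) = f v := by
  rw [surgery_apply, h.rewire_fu hs (by simp)]; ring

end PerNC.Cut

end TypeB

namespace TypeB

section Circle

variable {M : ℕ} [NeZero M]

/-- The point of a circle with `M` marked points below the point `x` of its universal cover. -/
def pt (M : ℕ) [NeZero M] (x : ℤ) : Fin M :=
  ⟨(x % M).toNat, by
    have h : (0 : ℤ) < M := by exact_mod_cast NeZero.pos M
    have h1 := Int.emod_nonneg x h.ne'
    have h2 := Int.emod_lt_of_pos x h
    omega⟩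

theorem val_pt (x : ℤ) : ((pt M x : ℕ) : ℤ) = x % M := by
  have h : (0 : ℤ) < M := by exact_mod_cast NeZero.pos M
  exact Int.toNat_of_nonneg (Int.emod_nonneg x h.ne')

theorem pt_eq_iff {x y : ℤ} : pt M x = pt M y ↔ (M : ℤ) ∣ x - y := by
  rw [Fin.ext_iff, ← Int.natCast_inj, val_pt, val_pt, Int.emod_eq_emod_iff_emod_sub_eq_zero,
    Int.dvd_iff_emod_eq_zero]

theorem pt_val (i : Fin M) : pt M ((i : ℕ) : ℤ) = i := by
  apply Fin.ext
  zify
  rw [val_pt]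
  exact Int.emod_eq_of_lt (by omega) (by exact_mod_cast i.isLt)

theorem pt_surjective : Function.Surjective (pt M) := fun i => ⟨_, pt_val i⟩

theorem exists_eq_val_pt (x : ℤ) : ∃ k : ℤ, x = ((pt M x : ℕ) : ℤ) + M * k :=
  ⟨x / M, by rw [val_pt, Int.emod_add_mul_ediv]⟩

theorem eq_of_pt_eq {x y : ℤ} (h : pt M x = pt M y) (h1 : x - y < M) (h2 : y - x < M) : x = y := by
  have := dvd_zero_of_lt (pt_eq_iff.1 h) (by omega) (by omega)
  omega

end Circle

theorem opp_pt {N : ℕ} [NeZero (2 * N)] (x : ℤ) : opp (pt (2 * N) x) = pt (2 * N) (x + N) := by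
  apply Fin.ext
  zify
  rw [val_pt, val_opp]
  obtain ⟨k, hk⟩ := exists_eq_val_pt (M := 2 * N) x
  have hlt := (pt (2 * N) x).isLt
  set v : ℕ := (pt (2 * N) x : ℕ)
  symm
  split_ifs with h
  · rw [hk, show ((v : ℤ) + ((2 * N : ℕ) : ℤ) * k + N) = (v + N : ℤ) + ((2 * N : ℕ) : ℤ) * k by ring,
      Int.add_mul_emod_self_left, Int.emod_eq_of_lt (by omega) (by push_cast; omega)]
    push_cast; rfl
  · rw [hk, show ((v : ℤ) + ((2 * N : ℕ) : ℤ) * k + N) =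
        (v - N : ℤ) + ((2 * N : ℕ) : ℤ) * (k + 1) by push_cast; ring,
      Int.add_mul_emod_self_left, Int.emod_eq_of_lt (by omega) (by push_cast; omega)]
    omega

namespace PerNC

variable {n : ℕ} [NeZero n]

theorem pt_congr (f : PerNC n) {x y : ℤ} (h : pt (2 * (2 * n)) x = pt (2 * (2 * n)) y) :
    pt (2 * (2 * n)) (f x) = pt (2 * (2 * n)) (f y) := by
  rw [pt_eq_iff] at h ⊢
  obtain ⟨k, hk⟩ := h
  have : x = y + 2 * n * (2 * k) := by push_cast at hk; linarith
  rw [this, f.per_mul]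
  exact ⟨k, by push_cast; ring⟩

/-- The pairing of the `4 * n` points of the double cover of the annulus. -/
def setoid (f : PerNC n) : Setoid (Fin (2 * (2 * n))) where
  r a b := b = a ∨ b = pt _ (f ((a : ℕ) : ℤ))
  iseqv :=
    { refl := fun a => Or.inl rfl
      symm := by
        rintro a b (rfl | rfl)
        · exact Or.inl rfl
        · right
          rw [f.pt_congr (pt_val _), f.inv, pt_val]
      trans := by
        rintro a b c (rfl | rfl) (rfl | rfl)
        · exact Or.inl rfl
        · exact Or.inr rfl
        · exact Or.inr rfl
        · left
          rw [f.pt_congr (pt_val _), f.inv, pt_val] }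

theorem setoid_pt (f : PerNC n) {x y : ℤ} : f.setoid (pt _ x) (pt _ y) ↔
    pt (2 * (2 * n)) y = pt _ x ∨ pt (2 * (2 * n)) y = pt _ (f x) := by
  change (_ ∨ _) ↔ _
  rw [f.pt_congr (pt_val _)]

theorem setoid_self (f : PerNC n) (x : ℤ) : f.setoid (pt _ x) (pt _ (f x)) :=
  f.setoid_pt.2 (Or.inr rfl)

theorem setoid_le (f : PerNC n) {s : Setoid (Fin (2 * (2 * n)))}
    (h : ∀ x : ℤ, s (pt _ x) (pt _ (f x))) : f.setoid ≤ s := by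
  rintro a b (rfl | rfl)
  · exact s.refl _
  · have := h ((a : ℕ) : ℤ)
    rwa [pt_val] at this

theorem oppInvariant_setoid (f : PerNC n) : OppInvariant f.setoid := by
  intro a b hab
  obtain ⟨x, rfl⟩ := pt_surjective a
  obtain ⟨y, rfl⟩ := pt_surjective b
  rw [opp_pt, opp_pt, setoid_pt]
  rw [setoid_pt] at hab
  rw [show ((x + ((2 * n : ℕ) : ℤ)) = x + 2 * n) by push_cast; ring, f.per]
  simp only [pt_eq_iff] at hab ⊢
  convert hab using 2 <;> push_cast <;> ring_nf

theorem pt_ne (f : PerNC n) (x : ℤ) : pt (2 * (2 * n)) (f x) ≠ pt _ x := by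
  intro h
  have h1 := f.lt_add x
  have h2 := f.sub_lt x
  exact f.ne x (eq_of_pt_eq h (by push_cast; omega) (by push_cast; omega))

theorem class_eq (f : PerNC n) (x : ℤ) :
    {a | f.setoid a (pt _ x)} = {pt _ x, pt _ (f x)} := by
  ext a
  simp only [Set.mem_ofPred_eq, Set.mem_insert_iff, Set.mem_singleton_iff]
  rw [f.setoid.comm']
  obtain ⟨y, rfl⟩ := pt_surjective a
  exact f.setoid_pt

theorem val_eq (f : PerNC n) {i j : Fin (2 * (2 * n))} (h : j = pt _ (f ((i : ℕ) : ℤ)))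
    (hij : i < j) : f ((i : ℕ) : ℤ) = (j : ℕ) ∨ f ((i : ℕ) : ℤ) = (j : ℕ) - 2 * (2 * n) := by
  have h1 := f.lt_add ((i : ℕ) : ℤ)
  have h2 := f.sub_lt ((i : ℕ) : ℤ)
  have hi := i.isLt
  have hj := j.isLt
  have hij' : (i : ℕ) < j := hij
  have h3 : pt (2 * (2 * n)) (f ((i : ℕ) : ℤ)) = pt _ ((j : ℕ) : ℤ) := by rw [pt_val, h]
  rw [pt_eq_iff] at h3
  push_cast at h3
  have := dvd_cases h3 (by omega) (by omega)
  omega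

theorem isNonCrossing_setoid (f : PerNC n) : IsNonCrossing f.setoid := by
  rintro i j k l ⟨hij, rij, -⟩ ⟨hkl, rkl, -⟩ ⟨h1, h2, h3⟩
  have hp : ∀ x : ℤ, f (x + 2 * (2 * n)) = f x + 2 * (2 * n) := fun x => by
    have := f.per_mul x 2
    rw [show x + 2 * (2 * (n : ℤ)) = x + 2 * n * 2 by ring, this]; ring
  have hj := f.val_eq (rij.resolve_left hij.ne') hij
  have hl := f.val_eq (rkl.resolve_left hkl.ne') hkl
  have hi4 := i.isLt
  have hl4 := l.isLt
  have hij' : (i : ℕ) < j := hij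
  have hkl' : (k : ℕ) < l := hkl
  have h1' : (i : ℕ) < k := h1
  have h2' : (k : ℕ) < j := h2
  have h3' : (j : ℕ) < l := h3
  have hl' : f (l : ℕ) = k ∨ f (l : ℕ) = (k : ℕ) + 2 * (2 * n) := by
    rcases hl with hl | hl
    · left; rw [← hl, f.inv]
    · right; have := hp (f (k : ℕ)); rw [f.inv, hl, sub_add_cancel] at this; exact this
  rcases hj with hj | hj
  · have := f.nc (a := (i : ℕ)) (b := (k : ℕ)) (by omega) (by omega)
    omega
  · have hj'' : f (j : ℕ) = (i : ℕ) + 2 * (2 * n) := by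
      have := hp (f (i : ℕ)); rw [f.inv, hj, sub_add_cancel] at this; exact this
    have := f.nc (a := (j : ℕ)) (b := (l : ℕ)) (by omega) (by omega)
    omega

theorem val_parity (x : ℤ) : ((pt (2 * (2 * n)) x : ℕ) : ℤ) % 2 = x % 2 := by
  obtain ⟨k, hk⟩ := exists_eq_val_pt (M := 2 * (2 * n)) x
  rw [show ((2 * (2 * n) : ℕ) : ℤ) * k = 2 * (2 * n * k) by push_cast; ring] at hk
  omega

theorem zeroBlocks_setoid (f : PerNC n) : zeroBlocks f.setoid = ∅ := by
  rw [Set.eq_empty_iff_forall_notMem]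
  intro K hK
  obtain ⟨y, rfl, hy⟩ := (mem_zeroBlocks_iff f.oppInvariant_setoid).1 hK
  obtain ⟨x, rfl⟩ := pt_surjective y
  rw [opp_pt, f.setoid.comm', setoid_pt] at hy
  rcases hy with hy | hy
  · rw [← opp_pt] at hy
    exact opp_ne _ hy
  · have h1 := val_parity (n := n) (x + ((2 * n : ℕ) : ℤ))
    have h2 := val_parity (n := n) (f x)
    have h3 := f.odd_sub x
    rw [hy] at h1
    omega

/-- The bipartition of type B below a periodic pairing. -/
def toNCBipart (f : PerNC n) : NCBipart n :=
  ⟨f.setoid, ⟨opp_image_mem_classes_iff.2 f.oppInvariant_setoid, by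
      rw [f.zeroBlocks_setoid]; exact Set.subsingleton_empty⟩, f.isNonCrossing_setoid, by
    rintro K ⟨y, rfl⟩
    obtain ⟨x, rfl⟩ := pt_surjective y
    rw [f.class_eq]
    exact Set.ncard_pair (f.pt_ne x).symm⟩

theorem toNCBipart_injective : Function.Injective (toNCBipart : PerNC n → NCBipart n) := by
  intro f g h
  have h' : f.setoid = g.setoid := congrArg Subtype.val h
  refine PerNC.ext fun x => ?_
  have h1 := f.setoid_self x
  rw [h', setoid_pt] at h1
  have := f.lt_add x
  have := f.sub_lt x
  have := g.lt_add x
  have := g.sub_lt x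
  exact eq_of_pt_eq (h1.resolve_left (f.pt_ne x)) (by push_cast; omega) (by push_cast; omega)

end PerNC

/-- A sign-invariant non-crossing pairing of the circle lifts to the universal cover. -/
theorem exists_perNC_of_partner {n : ℕ} [NeZero n] (p : Fin (2 * (2 * n)) → Fin (2 * (2 * n)))
    (hinv : ∀ a, p (p a) = a) (hne : ∀ a, p a ≠ a) (hopp : ∀ a, p (opp a) = opp (p a))
    (hnc : ∀ a b, a < b → b < p a → a < p b ∧ p b < p a) :
    ∃ f : PerNC n, ∀ x, pt _ (f x) = p (pt _ x) := by
  have hn : 0 < n := NeZero.pos n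
  have hpar : ∀ a, ((p a : ℕ) + (a : ℕ)) % 2 = 1 := by
    have key : ∀ a, a < p a → ((p a : ℕ) + (a : ℕ)) % 2 = 1 := by
      intro a ha
      have := even_card_of_involution (Finset.Ioo a (p a)) p
        (fun b hb => by
          rw [Finset.mem_Ioo] at hb ⊢
          exact hnc _ _ hb.1 hb.2) (fun b _ => hinv b) (fun b _ => hne b)
      rw [Fin.card_Ioo, Nat.even_iff] at this
      have ha' : (a : ℕ) < p a := ha
      omega
    intro a
    rcases lt_or_gt_of_ne (hne a) with h | h
    · have := key (p a) (by rwa [hinv])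
      rw [hinv] at this
      omega
    · exact key a h
  set g : ℤ → ℤ := fun x => x + Int.bmod (((p (pt _ x) : ℕ) : ℤ) - x) (2 * (2 * n)) with hg
  have hpos : 0 < 2 * (2 * n) := by omega
  have hpt : ∀ x, pt _ (g x) = p (pt _ x) := by
    intro x
    conv_rhs => rw [← pt_val (p (pt _ x))]
    rw [pt_eq_iff]
    have := Int.bmod_add_bdiv (((p (pt _ x) : ℕ) : ℤ) - x) (2 * (2 * n))
    refine ⟨-Int.bdiv (((p (pt _ x) : ℕ) : ℤ) - x) (2 * (2 * n)), ?_⟩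
    simp only [hg]
    linarith
  have hbd : ∀ x, x - 2 * n < g x ∧ g x < x + 2 * n := by
    intro x
    have h1 := Int.le_bmod (x := ((p (pt _ x) : ℕ) : ℤ) - x) hpos
    have h2 := Int.bmod_lt (x := ((p (pt _ x) : ℕ) : ℤ) - x) hpos
    have h3 : g x ≠ x - 2 * n := by
      intro hh
      have h4 := PerNC.val_parity (n := n) (g x)
      have h5 := PerNC.val_parity (n := n) x
      have h6 := hpar (pt _ x)
      rw [hpt] at h4
      omega
    simp only [hg] at h3 ⊢
    push_cast at h1 h2
    omega
  have huniq : ∀ x y, pt (2 * (2 * n)) x = pt _ y → x - y < 4 * n → y - x < 4 * n → x = y :=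
    fun x y h h1 h2 => eq_of_pt_eq h (by push_cast; omega) (by push_cast; omega)
  have ginv : ∀ x, g (g x) = x := fun x => by
    have h1 := hbd x
    have h2 := hbd (g x)
    exact huniq _ _ (by rw [hpt, hpt, hinv]) (by omega) (by omega)
  have gne : ∀ x, g x ≠ x := fun x hh => hne (pt _ x) (by rw [← hpt, hh])
  have gper : ∀ x, g (x + 2 * n) = g x + 2 * n := fun x => by
    have h1 := hbd x
    have h2 := hbd (x + 2 * n)
    refine huniq _ _ ?_ (by omega) (by omega)
    have e : ∀ y : ℤ, y + 2 * n = y + ((2 * n : ℕ) : ℤ) := fun y => by push_cast; ring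
    rw [hpt, e, e, ← opp_pt, ← opp_pt, hopp, hpt]
  have hcyc : ∀ a b c d : ℤ, a < b → b < c → c < d → d < a + 4 * n →
      pt _ c = p (pt _ a) → pt _ d = p (pt _ b) → False := by
    intro a b c d h1 h2 h3 h4 hac hbd
    have hca : pt _ a = p (pt _ c) := by rw [hac, hinv]
    have hdb : pt _ b = p (pt _ d) := by rw [hbd, hinv]
    obtain ⟨k, hk⟩ := exists_eq_val_pt (M := 2 * (2 * n)) a
    push_cast at hk
    have hval : ∀ x : ℤ, a ≤ x → x < a + 4 * n →
        ((pt (2 * (2 * n)) x : ℕ) : ℤ) = x - 2 * (2 * n) * k ∧ x - 2 * (2 * n) * k < 4 * n ∨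
        ((pt (2 * (2 * n)) x : ℕ) : ℤ) = x - 2 * (2 * n) * k - 4 * n ∧
          4 * n ≤ x - 2 * (2 * n) * k := by
      intro x hx1 hx2
      have hlt := (pt (2 * (2 * n)) a).isLt
      rcases lt_or_ge (x - 2 * (2 * n) * k) (4 * n) with h | h
      · left
        refine ⟨?_, h⟩
        have h0 : 0 ≤ x - 2 * (2 * n) * k := by omega
        have := pt_val (M := 2 * (2 * n)) ⟨(x - 2 * (2 * n) * k).toNat, by omega⟩
        have e : pt (2 * (2 * n)) x = pt _ (((x - 2 * (2 * n) * k).toNat : ℕ) : ℤ) := by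
          rw [pt_eq_iff, Int.toNat_of_nonneg h0]
          exact ⟨k, by push_cast; ring⟩
        rw [e, this]
        exact Int.toNat_of_nonneg h0
      · right
        refine ⟨?_, h⟩
        have h0 : 0 ≤ x - 2 * (2 * n) * k - 4 * n := by omega
        have := pt_val (M := 2 * (2 * n)) ⟨(x - 2 * (2 * n) * k - 4 * n).toNat, by omega⟩
        have e : pt (2 * (2 * n)) x = pt _ (((x - 2 * (2 * n) * k - 4 * n).toNat : ℕ) : ℤ) := by
          rw [pt_eq_iff, Int.toNat_of_nonneg h0]
          exact ⟨k + 1, by push_cast; ring⟩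
        rw [e, this]
        exact Int.toNat_of_nonneg h0
    have va := hval a le_rfl (by omega)
    have vb := hval b (by omega) (by omega)
    have vc := hval c (by omega) (by omega)
    have vd := hval d (by omega) (by omega)
    have hncN : ∀ x y z w : ℤ, pt _ z = p (pt _ x) → pt _ w = p (pt _ y) →
        ((pt (2 * (2 * n)) x : ℕ) : ℤ) < (pt (2 * (2 * n)) y : ℕ) →
        ((pt (2 * (2 * n)) y : ℕ) : ℤ) < (pt (2 * (2 * n)) z : ℕ) →
        ((pt (2 * (2 * n)) w : ℕ) : ℤ) < (pt (2 * (2 * n)) z : ℕ) := by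
      intro x y z w h1 h2 h3 h4
      have := (hnc (pt _ x) (pt _ y) (by rw [Fin.lt_def]; exact_mod_cast h3)
        (by rw [← h1, Fin.lt_def]; exact_mod_cast h4)).2
      rw [← h1, ← h2, Fin.lt_def] at this
      exact_mod_cast this
    have e1 := hncN a b c d hac hbd
    have e2 := hncN b c d a hbd hca
    have e3 := hncN c d a b hca hdb
    have e4 := hncN d a b c hdb hac
    omega
  have gnc : ∀ a b, a < b → b < g a → a < g b ∧ g b < g a := by
    intro a b h1 h2
    have ba := hbd a
    have bb := hbd b
    have n1 : g b ≠ a := fun hh => by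
      have : b = g a := by rw [← hh, ginv]
      omega
    have n2 : g b ≠ g a := fun hh => by
      have : b = a := by rw [← ginv b, hh, ginv]
      omega
    constructor
    · by_contra hh
      exact hcyc (g b) a b (g a) (by omega) h1 h2 (by omega) (by rw [hpt, hinv]) (hpt a)
    · by_contra hh
      exact hcyc a b (g a) (g b) h1 h2 (by omega) (by omega) (hpt a) (hpt b)
  exact ⟨⟨g, ginv, gne, gper, gnc⟩, hpt⟩

theorem PerNC.toNCBipart_surjective {n : ℕ} [NeZero n] :
    Function.Surjective (PerNC.toNCBipart : PerNC n → NCBipart n) := by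
  rintro ⟨r, ⟨hB, -⟩, hnc, h2⟩
  have hinv := opp_image_mem_classes_iff.1 hB
  have hp : ∀ a, ∃ b, b ≠ a ∧ ∀ x, r x a ↔ x = a ∨ x = b := by
    intro a
    obtain ⟨x, y, hxy, hK⟩ := Set.ncard_eq_two.1 (h2 _ (r.mem_classes a))
    have hmem : ∀ w, r w a ↔ w = x ∨ w = y := fun w => by
      have : w ∈ {w | r w a} ↔ w ∈ ({x, y} : Set _) := by rw [hK]
      simpa using this
    rcases (hmem a).1 (r.refl a) with rfl | rfl
    · exact ⟨y, hxy.symm, hmem⟩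
    · exact ⟨x, hxy, fun w => (hmem w).trans or_comm⟩
  choose p hpne hpr using hp
  have hpa : ∀ a, r (p a) a := fun a => (hpr a _).2 (Or.inr rfl)
  have hpinv : ∀ a, p (p a) = a := fun a =>
    (((hpr (p a) a).1 (r.symm (hpa a))).resolve_left (hpne a).symm).symm
  have hch : ∀ a, a < p a → IsChord r a (p a) := fun a ha =>
    ⟨ha, r.symm (hpa a), fun k h1 h2 h3 => by
      rcases (hpr a k).1 (r.symm h3) with rfl | rfl <;> order⟩
  obtain ⟨f, hf⟩ := exists_perNC_of_partner p hpinv hpne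
    (fun a => by
      have h1 : r (opp (p a)) (opp a) := hinv _ _ (hpa a)
      exact (((hpr _ _).1 h1).resolve_left fun hh => hpne a (opp_injective hh)).symm)
    (fun a b hab hba => by
      have n1 : p b ≠ a := fun hh => by rw [← hh, hpinv] at hba; exact lt_irrefl _ hba
      have n2 : p b ≠ p a := fun hh => by
        have := congrArg p hh
        rw [hpinv, hpinv] at this
        exact hab.ne' this
      constructor
      · by_contra hh
        have hlt : p b < a := lt_of_le_of_ne (not_lt.1 hh) n1
        have hc := hch (p b) (by rw [hpinv]; exact hlt.trans hab)
        rw [hpinv] at hc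
        exact hnc _ _ _ _ hc (hch a (hab.trans hba)) ⟨hlt, hab, hba⟩
      · by_contra hh
        have hlt : p a < p b := lt_of_le_of_ne (not_lt.1 hh) n2.symm
        exact hnc _ _ _ _ (hch a (hab.trans hba)) (hch b (hba.trans hlt)) ⟨hab, hba, hlt⟩)
  refine ⟨f, Subtype.ext (Setoid.ext fun a b => ?_)⟩
  obtain ⟨x, rfl⟩ := pt_surjective a
  obtain ⟨y, rfl⟩ := pt_surjective b
  change f.setoid _ _ ↔ _
  rw [f.setoid_pt, hf, r.comm', hpr]

/-- Periodic pairings and bipartitions of type B are the same. -/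
noncomputable def PerNC.equiv (n : ℕ) [NeZero n] : PerNC n ≃ NCBipart n :=
  Equiv.ofBijective _ ⟨PerNC.toNCBipart_injective, PerNC.toNCBipart_surjective⟩

end TypeB

namespace TypeB

namespace PerNC

variable {n : ℕ}

/-- The pairing of `2 * i` with `2 * i + 1`. -/
def evenPairing (n : ℕ) : PerNC n where
  toFun x := if x % 2 = 0 then x + 1 else x - 1
  inv' x := by split_ifs <;> omega
  ne' x := by split_ifs <;> omega
  per' x := by split_ifs <;> omega
  nc' a b h1 h2 := by split_ifs at h2 ⊢ <;> omega

/-- The pairing of `2 * i - 1` with `2 * i`. -/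
def oddPairing (n : ℕ) : PerNC n where
  toFun x := if x % 2 = 0 then x - 1 else x + 1
  inv' x := by split_ifs <;> omega
  ne' x := by split_ifs <;> omega
  per' x := by split_ifs <;> omega
  nc' a b h1 h2 := by split_ifs at h2 ⊢ <;> omega

theorem evenPairing_apply (x : ℤ) :
    evenPairing n x = if x % 2 = 0 then x + 1 else x - 1 := rfl

theorem oddPairing_apply (x : ℤ) :
    oddPairing n x = if x % 2 = 0 then x - 1 else x + 1 := rfl

/-- Any two periodic pairings are connected by surgeries along arcs of the second one whose interior
is already common to both. -/
theorem surgery_induction [NeZero n] {P : PerNC n → PerNC n → Prop} (base : ∀ f, P f f)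
    (step : ∀ (f g : PerNC n) (u v : ℤ) (h : f.Cut u v), g u = v →
      (∀ w, u < w → w < v → f w = g w) → P h.surgery g → P f g) (f g : PerNC n) : P f g := by
  classical
  have hn : 0 < n := NeZero.pos n
  obtain ⟨N, hN⟩ : ∃ N, ((Finset.Ico (0 : ℤ) (2 * n)).filter fun x => f x ≠ g x).card = N :=
    ⟨_, rfl⟩
  induction N using Nat.strong_induction_on generalizing f with
  | _ N ih =>
  by_cases hfg : f = g
  · subst hfg; exact base f
  have hex : ∃ k : ℕ, ∃ u, f u ≠ g u ∧ u < g u ∧ g u - u = k := by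
    obtain ⟨x, hx⟩ : ∃ x, f x ≠ g x := by
      by_contra hh
      push Not at hh
      exact hfg (PerNC.ext hh)
    rcases lt_or_gt_of_ne (g.ne x) with h | h
    · refine ⟨(x - g x).toNat, g x, fun hh => hx ?_, by rwa [g.inv], by rw [g.inv]; omega⟩
      rw [g.inv] at hh
      rw [← hh, f.inv, hh]
    · exact ⟨(g x - x).toNat, x, hx, h, by omega⟩
  obtain ⟨u, hu1, hu2, hu3⟩ := Nat.find_spec hex
  have hmin := fun k => Nat.find_min (m := k) hex
  obtain ⟨v, hv⟩ : ∃ v, v = g u := ⟨_, rfl⟩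
  rw [← hv] at hu1 hu2 hu3
  have hagree : ∀ w, u < w → w < v → f w = g w := by
    intro w h1 h2
    rw [hv] at h2
    have h3 := g.nc h1 h2
    by_contra hne
    rcases lt_or_gt_of_ne (g.ne w) with h | h
    · refine hmin (w - g w).toNat (by omega) ⟨g w, fun hh => hne ?_, by rwa [g.inv], by
        rw [g.inv]; omega⟩
      rw [g.inv] at hh
      rw [← hh, f.inv, hh]
    · exact hmin (g w - w).toNat (by omega) ⟨w, hne, h, by omega⟩
  have hcut : f.Cut u v := by
    refine ⟨hu2, by rw [hv]; exact g.lt_add u, fun w h1 h2 => ?_, hu1⟩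
    rw [hagree w h1 h2]
    rw [hv] at h2 ⊢
    exact g.nc h1 h2
  refine step f g u v hcut hv.symm hagree (ih _ ?_ _ rfl)
  rw [← hN]
  apply Finset.card_lt_card
  have gvu : g v = u := by rw [hv, g.inv]
  have hsub : ∀ w, f w = g w → hcut.surgery w = g w := by
    intro w hw
    rw [Cut.surgery_apply]
    rcases hcut.rewire_cases w with h1 | h1 | ⟨hs, k, h1⟩ | ⟨hs, k, h1⟩ | ⟨h1, h2, h3, h4⟩
    · rw [Cut.rewire_u h1]
      obtain ⟨k, hk⟩ := h1
      rw [show w = u + 2 * n * k by omega, g.per_mul]; omega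
    · rw [hcut.rewire_v h1]
      obtain ⟨k, hk⟩ := h1
      rw [show w = v + 2 * n * k by omega, g.per_mul]; omega
    · exfalso
      have hw1 : w = f u + 2 * n * k := by omega
      rw [hw1, f.per_mul, f.inv, g.per_mul] at hw
      have h5 : g (f u) = u := by omega
      have : f u = g u := by rw [← h5, g.inv, h5]
      omega
    · exfalso
      have hw1 : w = f v + 2 * n * k := by omega
      rw [hw1, f.per_mul, f.inv, g.per_mul] at hw
      have h5 : g (f v) = v := by omega
      have h6 : f v = g v := by rw [← h5, g.inv, h5]
      have : f u = v := by rw [← gvu, ← h6, f.inv]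
      omega
    · rw [Cut.rewire_of_not h1 h2 h3 h4, hw]
  rw [Finset.ssubset_iff_of_subset]
  · have h2n : (0 : ℤ) < 2 * n := by omega
    refine ⟨u % (2 * n), ?_, ?_⟩
    · have hm : u % (2 * n) = u + 2 * n * (-(u / (2 * n))) := by
        have := Int.emod_add_mul_ediv u (2 * n)
        linarith
      rw [Finset.mem_filter, Finset.mem_Ico]
      refine ⟨⟨Int.emod_nonneg _ h2n.ne', Int.emod_lt_of_pos _ h2n⟩, ?_⟩
      rw [hm, f.per_mul, g.per_mul]
      omega
    · have hm : u % (2 * n) = u + 2 * n * (-(u / (2 * n))) := by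
        have := Int.emod_add_mul_ediv u (2 * n)
        linarith
      rw [Finset.mem_filter, not_and_not_right]
      intro _
      rw [hm, PerNC.per_mul, PerNC.per_mul, hcut.surgery_u, hv]
  · intro w hw
    rw [Finset.mem_filter] at hw ⊢
    exact ⟨hw.1, fun hh => hw.2 (hsub w hh)⟩

end PerNC

section Arc

variable {n : ℕ} [NeZero n]

/-- The points of an interval against all others. -/
def arc (n : ℕ) [NeZero n] (lo hi : ℤ) : Setoid (Fin (2 * (2 * n))) :=
  Setoid.ker fun a => ∃ x, lo ≤ x ∧ x ≤ hi ∧ pt _ x = a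

theorem PerNC.setoid_le_arc (f : PerNC n) {lo hi : ℤ}
    (h : ∀ x, lo ≤ x → x ≤ hi → lo ≤ f x ∧ f x ≤ hi) : f.setoid ≤ arc n lo hi := by
  have key : ∀ w, (∃ x, lo ≤ x ∧ x ≤ hi ∧ pt (2 * (2 * n)) x = pt _ w) →
      ∃ x, lo ≤ x ∧ x ≤ hi ∧ pt (2 * (2 * n)) x = pt _ (f w) := by
    rintro w ⟨x, h1, h2, h3⟩
    exact ⟨f x, (h x h1 h2).1, (h x h1 h2).2, f.pt_congr h3⟩
  refine f.setoid_le fun w => ?_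
  rw [arc, Setoid.ker_def]
  refine propext ⟨key w, fun hh => ?_⟩
  have := key _ hh
  rwa [f.inv] at this

theorem not_rel_of_le_arc {s : Setoid (Fin (2 * (2 * n)))} {lo hi u w : ℤ} (hs : s ≤ arc n lo hi)
    (h1 : lo ≤ u) (h2 : u ≤ hi)
    (hw : ∀ x, lo ≤ x → x ≤ hi → ¬ ((2 * (2 * n) : ℕ) : ℤ) ∣ x - w) : ¬ s (pt _ u) (pt _ w) := by
  intro h
  have h3 := hs h
  rw [arc, Setoid.ker_def, eq_iff_iff] at h3
  obtain ⟨x, hx1, hx2, hx3⟩ := h3.1 ⟨u, h1, h2, rfl⟩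
  exact hw x hx1 hx2 (pt_eq_iff.1 hx3)

theorem OppInvariant.pt_shift {s : Setoid (Fin (2 * (2 * n)))} (hs : OppInvariant s) {a b : ℤ}
    (h : s (pt _ a) (pt _ b)) (k : ℤ) : s (pt _ (a + 2 * n * k)) (pt _ (b + 2 * n * k)) := by
  have e : ∀ y k : ℤ, y + 2 * n * (k + 1) = (y + 2 * n * k) + ((2 * n : ℕ) : ℤ) := fun y k => by
    push_cast; ring
  induction k using Int.induction_on with
  | zero => simpa using h
  | succ i ih =>
    rw [e, e, ← opp_pt, ← opp_pt]
    exact hs _ _ ih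
  | pred i ih =>
    have e1 := e a (-(i : ℤ) - 1)
    have e2 := e b (-(i : ℤ) - 1)
    rw [sub_add_cancel] at e1 e2
    rw [e1, e2, ← opp_pt, ← opp_pt] at ih
    exact hs.iff.1 ih

end Arc

namespace PerNC.Cut

variable {n : ℕ} [NeZero n] {f : PerNC n} {u v : ℤ}

theorem setoid_le_of_surgery_le (h : f.Cut u v) {s : Setoid (Fin (2 * (2 * n)))}
    (hs : OppInvariant s) (hle : h.surgery.setoid ≤ s) (hu : s (pt _ u) (pt _ (f u))) :
    f.setoid ≤ s := by
  have huv : s (pt _ u) (pt _ v) := by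
    have := hle (h.surgery.setoid_self u)
    rwa [h.surgery_u] at this
  have hv : s (pt _ v) (pt _ (f v)) := by
    by_cases hsp : f u = v - 2 * n
    · have h1 := hs.pt_shift hu 1
      rw [hsp, mul_one, sub_add_cancel] at h1
      rw [h.special_iff.1 hsp]
      exact s.symm h1
    · have := hle (h.surgery.setoid_self (f u))
      rw [h.surgery_fu hsp] at this
      exact s.trans (s.symm huv) (s.trans hu this)
  refine f.setoid_le fun w => ?_
  rcases h.rewire_cases w with ⟨k, h1⟩ | ⟨k, h1⟩ | ⟨-, k, h1⟩ | ⟨-, k, h1⟩ | ⟨h1, h2, h3, h4⟩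
  · rw [show w = u + 2 * n * k by omega, f.per_mul]
    exact hs.pt_shift hu k
  · rw [show w = v + 2 * n * k by omega, f.per_mul]
    exact hs.pt_shift hv k
  · rw [show w = f u + 2 * n * k by omega, f.per_mul, f.inv]
    exact hs.pt_shift (s.symm hu) k
  · rw [show w = f v + 2 * n * k by omega, f.per_mul, f.inv]
    exact hs.pt_shift (s.symm hv) k
  · have := hle (h.surgery.setoid_self w)
    rwa [surgery_apply, rewire_of_not h1 h2 h3 h4] at this

theorem surgery_le_of_setoid_le (h : f.Cut u v) {s : Setoid (Fin (2 * (2 * n)))}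
    (hs : OppInvariant s) (hle : f.setoid ≤ s) (huv : s (pt _ u) (pt _ v)) :
    h.surgery.setoid ≤ s := by
  have hu : s (pt _ u) (pt _ (f u)) := hle (f.setoid_self u)
  have hv : s (pt _ v) (pt _ (f v)) := hle (f.setoid_self v)
  have hfuv : s (pt _ (f u)) (pt _ (f v)) := s.trans (s.symm hu) (s.trans huv hv)
  refine h.surgery.setoid_le fun w => ?_
  rw [surgery_apply]
  rcases h.rewire_cases w with h1 | h1 | ⟨hsp, h1⟩ | ⟨hsp, h1⟩ | ⟨h1, h2, h3, h4⟩
  · rw [rewire_u h1]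
    obtain ⟨k, hk⟩ := h1
    convert hs.pt_shift huv k using 2 <;> omega
  · rw [h.rewire_v h1]
    obtain ⟨k, hk⟩ := h1
    convert hs.pt_shift (s.symm huv) k using 2 <;> omega
  · rw [h.rewire_fu hsp h1]
    obtain ⟨k, hk⟩ := h1
    convert hs.pt_shift hfuv k using 2 <;> omega
  · rw [h.rewire_fv hsp h1]
    obtain ⟨k, hk⟩ := h1
    convert hs.pt_shift (s.symm hfuv) k using 2 <;> omega
  · rw [rewire_of_not h1 h2 h3 h4]
    exact hle (f.setoid_self w)

end PerNC.Cut

theorem IsMerge.of_invariant {N : ℕ} {r r' : Setoid (Fin (2 * N))} {c d : Fin (2 * N)}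
    (hr : OppInvariant r) (hr' : OppInvariant r') (le : r ≤ r') (rel : r' c d)
    (min : ∀ s : Setoid (Fin (2 * N)), OppInvariant s → r ≤ s → s c d → r' ≤ s) :
    IsMerge r r' c d := by
  refine ⟨le, rel, hr', fun s h1 h2 h3 => ?_⟩
  have : r' ≤ s ⊓ s.comap opp := by
    apply min
    · intro a b hab
      exact ⟨hab.2, by simpa [Setoid.comap_rel] using hab.1⟩
    · exact le_inf h1 fun a b hab => h1 (hr _ _ hab)
    · exact ⟨h2, h3⟩
  exact this.trans inf_le_left

theorem IsMerge.symm {N : ℕ} {r r' : Setoid (Fin (2 * N))} {c d : Fin (2 * N)}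
    (h : IsMerge r r' c d) : IsMerge r r' d c :=
  ⟨h.le, r'.symm h.rel, h.inv, fun s h1 h2 h3 => h.min s h1 (s.symm h2) (s.symm h3)⟩

namespace PerNC.Cut

variable {n : ℕ} [NeZero n] {f : PerNC n} {u v : ℤ}

theorem isMerge_surgery_sup (h : f.Cut u v) {S : Setoid (Fin (2 * (2 * n)))} (hS : OppInvariant S)
    (huv : (f.setoid ⊔ S) (pt _ u) (pt _ v)) :
    IsMerge (h.surgery.setoid ⊔ S) (f.setoid ⊔ S) (pt _ u) (pt _ (f u)) := by
  have i1 := f.oppInvariant_setoid.sup hS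
  refine IsMerge.of_invariant (h.surgery.oppInvariant_setoid.sup hS) i1
    (sup_le (h.surgery_le_of_setoid_le i1 le_sup_left huv) le_sup_right)
    ((le_sup_left : f.setoid ≤ f.setoid ⊔ S) (f.setoid_self u)) fun s hs hle hu => ?_
  exact sup_le (h.setoid_le_of_surgery_le hs (le_sup_left.trans hle) hu) (le_sup_right.trans hle)

theorem isMerge_sup_surgery (h : f.Cut u v) {S : Setoid (Fin (2 * (2 * n)))} (hS : OppInvariant S)
    (hu : (h.surgery.setoid ⊔ S) (pt _ u) (pt _ (f u))) :
    IsMerge (f.setoid ⊔ S) (h.surgery.setoid ⊔ S) (pt _ u) (pt _ v) := by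
  have i1 := h.surgery.oppInvariant_setoid.sup hS
  refine IsMerge.of_invariant (f.oppInvariant_setoid.sup hS) i1
    (sup_le (h.setoid_le_of_surgery_le i1 le_sup_left hu) le_sup_right)
    ?_ fun s hs hle huv => ?_
  · have := (le_sup_left : _ ≤ h.surgery.setoid ⊔ S) (h.surgery.setoid_self u)
    rwa [h.surgery_u] at this
  · exact sup_le (h.surgery_le_of_setoid_le hs (le_sup_left.trans hle) huv)
      (le_sup_right.trans hle)

theorem not_dvd_fu_of_mem (h : f.Cut u v) (hs : f u ≠ v - 2 * n) {x : ℤ} (h1 : u ≤ x)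
    (h2 : x ≤ v) : ¬ 2 * (n : ℤ) ∣ x - f u := by
  rcases eq_or_lt_of_le h1 with rfl | h1
  · rw [← neg_sub, dvd_neg]; exact h.not_dvd_ufu
  rcases eq_or_lt_of_le h2 with rfl | h2
  · rw [← neg_sub, dvd_neg]; exact fun hh => hs (h.special_of_dvd hh)
  exact (h.not_dvd_of_mem h1 h2).2.2.1

theorem dvd_of_dvd_shift {x y k : ℤ} (h : ((2 * (2 * n) : ℕ) : ℤ) ∣ x - (y + 2 * n * k)) :
    2 * (n : ℤ) ∣ x - y := by
  obtain ⟨j, hj⟩ := h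
  exact ⟨2 * j + k, by push_cast at hj; linarith⟩

theorem not_dvd_half {x y : ℤ} (h1 : y - x < 2 * n) (h2 : x - y < 2 * n) :
    ¬ ((2 * (2 * n) : ℕ) : ℤ) ∣ x - (y + 2 * n) := by
  intro h
  have hn : 0 < n := NeZero.pos n
  push_cast at h
  have := dvd_zero_of_lt h (by omega) (by omega)
  omega

theorem opp_pt' (x : ℤ) : opp (pt (2 * (2 * n)) x) = pt (2 * (2 * n)) (x + 2 * n) := by
  rw [opp_pt]; push_cast; rfl

theorem counts_surgery_sup (h : f.Cut u v) {S : Setoid (Fin (2 * (2 * n)))} (hS : OppInvariant S)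
    (hSle : S ≤ arc n u v) (huv : (f.setoid ⊔ S) (pt _ u) (pt _ v)) :
    bk₀ (f.setoid ⊔ S) = bk₀ (h.surgery.setoid ⊔ S) + (if f u = v - 2 * n then 1 else 0) ∧
    nzbk (h.surgery.setoid ⊔ S) = nzbk (f.setoid ⊔ S) + 1 := by
  have hlt := h.lt
  have hlt' := h.lt'
  have hm := h.isMerge_surgery_sup hS huv
  have inv := h.surgery.oppInvariant_setoid.sup hS
  have hle : h.surgery.setoid ⊔ S ≤ arc n u v := by
    refine sup_le (h.surgery.setoid_le_arc fun x h1 h2 => ?_) hSle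
    rcases eq_or_lt_of_le h1 with rfl | h1
    · rw [h.surgery_u]; omega
    rcases eq_or_lt_of_le h2 with rfl | h2
    · rw [h.surgery_v]; omega
    rw [surgery_apply, h.rewire_of_mem h1 h2]
    have := h.closed x h1 h2
    omega
  have hc : ¬ (h.surgery.setoid ⊔ S) (pt _ u) (opp (pt _ u)) := by
    rw [opp_pt']
    exact not_rel_of_le_arc hle le_rfl (by omega) fun x h1 h2 => not_dvd_half (by omega) (by omega)
  split_ifs with hs
  · refine hm.counts_opp inv hc ?_
    rw [opp_pt', hs, sub_add_cancel]
    have := (le_sup_left : _ ≤ h.surgery.setoid ⊔ S) (h.surgery.setoid_self u)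
    rwa [h.surgery_u] at this
  · refine hm.counts inv hc ?_ ?_
    · refine not_rel_of_le_arc hle le_rfl (by omega) fun x h1 h2 hh => ?_
      exact h.not_dvd_fu_of_mem hs h1 h2 (dvd_of_dvd_shift (k := 0) (by simpa using hh))
    · rw [opp_pt']
      refine not_rel_of_le_arc hle le_rfl (by omega) fun x h1 h2 hh => ?_
      exact h.not_dvd_fu_of_mem hs h1 h2 (dvd_of_dvd_shift (k := 1) (by simpa using hh))

end PerNC.Cut

/-- The two ends of an arc starting at an even point are connected through its interior. -/
theorem PerNC.rel_of_even {n : ℕ} [NeZero n] (g : PerNC n) {s : Setoid (Fin (2 * (2 * n)))}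
    (hs : (evenPairing n).setoid ≤ s) {a : ℤ} (ha : a % 2 = 0) (hab : a < g a)
    (hin : ∀ w, a < w → w < g a → s (pt _ w) (pt _ (g w))) : s (pt _ a) (pt _ (g a)) := by
  have hodd := g.odd_sub a
  have hτ : ∀ x : ℤ, x % 2 = 0 → s (pt _ x) (pt _ (x + 1)) := fun x hx => by
    have := hs ((evenPairing n).setoid_self x)
    rwa [evenPairing_apply, if_pos hx] at this
  have key : ∀ (k : ℕ) (e : ℤ), g a - e = k → e % 2 = 1 → a < e →
      (∀ w, a < w → w < e → a < g w ∧ g w < e) → s (pt _ e) (pt _ (g a)) := by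
    intro k
    induction k using Nat.strong_induction_on with
    | _ k ih =>
    intro e hk he hae hcl
    rcases eq_or_lt_of_le (show e ≤ g a by omega) with rfl | hlt
    · exact s.refl _
    have h1 := g.nc hae hlt
    have h2 : e < g e := by
      by_contra hh
      have hne := g.ne e
      have := hcl (g e) h1.1 (by omega)
      rw [g.inv] at this
      omega
    have h3 := g.odd_sub e
    have h4 := ih (g a - (g e + 1)).toNat (by omega) (g e + 1) (by omega) (by omega) (by omega)
      (fun w hw1 hw2 => by
        rcases lt_trichotomy w e with hw | rfl | hw
        · have := hcl w hw1 hw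
          omega
        · omega
        · rcases eq_or_lt_of_le (show w ≤ g e by omega) with rfl | hw'
          · rw [g.inv]; omega
          · have := g.nc hw hw'
            omega)
    exact s.trans (hin e hae hlt) (s.trans (hτ (g e) (by omega)) h4)
  exact s.trans (hτ a ha) (key (g a - (a + 1)).toNat (a + 1) (by omega) (by omega) (by omega)
    (fun w h1 h2 => by omega))

namespace PerNC.Cut

variable {n : ℕ} [NeZero n] {f : PerNC n} {u v : ℤ}

theorem not_dvd_v_of_mem (h : f.Cut u v) {w : ℤ} (h1 : f u < w) (h2 : w < u) :
    ¬ 2 * (n : ℤ) ∣ w - v := by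
  intro hh
  have hlt := h.lt
  have hlt' := h.lt'
  have b2 := f.sub_lt u
  have b3 := f.lt_add v
  have b4 := f.sub_lt v
  have hw : w = v - 2 * n := by
    have := dvd_cases hh (by omega) (by omega)
    omega
  have h3 := f.nc_rev h1 h2
  have h4 := f.per_sub v
  rw [← hw] at h4
  rcases h.trichotomy with t | t | t
  · have := h.window (by omega) t.1 t.2
    omega
  · omega
  · omega

theorem rewire_of_mem_left (h : f.Cut u v) {w : ℤ} (h1 : f u < w) (h2 : w < u) :
    f.rewire u v w = f w := by
  have b2 := f.sub_lt u
  have h3 := f.nc_rev h1 h2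
  refine rewire_of_not (fun hh => ?_) (h.not_dvd_v_of_mem h1 h2) (fun hh => ?_)
    fun hh => h.not_dvd_v_of_mem h3.1 h3.2 ((f.dvd_iff' _ _).2 hh)
  all_goals
    have := dvd_zero_of_lt hh (by omega) (by omega)
    omega

theorem rewire_of_mem_right (h : f.Cut u v) (h0 : u < f u) {w : ℤ} (h1 : v < w) (h2 : w < f v) :
    f.rewire u v w = f w := by
  have hlt := h.lt
  have b1 := f.lt_add u
  have t : v < f v ∧ f v < f u := by rcases h.trichotomy with t | t | t <;> omega
  refine rewire_of_not (fun hh => ?_) (fun hh => ?_) (fun hh => ?_) (fun hh => ?_)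
  all_goals
    have := dvd_zero_of_lt hh (by omega) (by omega)
    omega

theorem rel_surgery_even (h : f.Cut u v) (hu : u % 2 = 1) (hv : v % 2 = 0) :
    (h.surgery.setoid ⊔ (evenPairing n).setoid) (pt _ u) (pt _ (f u)) := by
  set s := h.surgery.setoid ⊔ (evenPairing n).setoid
  have hle : h.surgery.setoid ≤ s := le_sup_left
  have hs : (evenPairing n).setoid ≤ s := le_sup_right
  have o1 := f.odd_sub u
  have hself := fun w => hle (h.surgery.setoid_self w)
  rcases lt_or_gt_of_ne (f.ne u) with h0 | h0
  · have := f.rel_of_even hs (a := f u) (by omega) (by rwa [f.inv]) (fun w h1 h2 => by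
      rw [f.inv] at h2
      have := hself w
      rwa [surgery_apply, h.rewire_of_mem_left h1 h2] at this)
    rw [f.inv] at this
    exact s.symm this
  · have hlt := h.lt
    have t : v < f v ∧ f v < f u := by rcases h.trichotomy with t | t | t <;> omega
    have h1 := f.rel_of_even hs (a := v) hv t.1 (fun w h1 h2 => by
      have := hself w
      rwa [surgery_apply, h.rewire_of_mem_right h0 h1 h2] at this)
    have h2 := hself u
    have h3 := hself (f u)
    rw [h.surgery_u] at h2
    rw [h.surgery_fu (by omega)] at h3
    exact s.trans h2 (s.trans h1 (s.symm h3))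

theorem counts_sup_surgery_even (h : f.Cut u v) (hu : u % 2 = 1) (hv : v % 2 = 0) :
    bk₀ (h.surgery.setoid ⊔ (evenPairing n).setoid) =
      bk₀ (f.setoid ⊔ (evenPairing n).setoid) + (if f u = v - 2 * n then 1 else 0) ∧
    nzbk (f.setoid ⊔ (evenPairing n).setoid) =
      nzbk (h.surgery.setoid ⊔ (evenPairing n).setoid) + 1 := by
  have hlt := h.lt
  have hlt' := h.lt'
  have hS := (evenPairing n).oppInvariant_setoid
  have inv := f.oppInvariant_setoid.sup hS
  have hm := h.isMerge_sup_surgery hS (h.rel_surgery_even hu hv)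
  have o1 := f.odd_sub u
  have o2 := f.odd_sub v
  have b1 := f.lt_add u
  have b2 := f.sub_lt u
  rcases lt_or_gt_of_ne (f.ne u) with h0 | h0
  · have hle : f.setoid ⊔ (evenPairing n).setoid ≤ arc n (f u) u := by
      refine sup_le (f.setoid_le_arc fun x h1 h2 => ?_)
        ((evenPairing n).setoid_le_arc fun x h1 h2 => ?_)
      · rcases eq_or_lt_of_le h1 with rfl | h1
        · rw [f.inv]; omega
        rcases eq_or_lt_of_le h2 with rfl | h2
        · omega
        have := f.nc_rev h1 h2
        omega
      · rw [evenPairing_apply]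
        split_ifs <;> omega
    have hc : ¬ (f.setoid ⊔ (evenPairing n).setoid) (pt _ u) (opp (pt _ u)) := by
      rw [opp_pt']
      exact not_rel_of_le_arc hle (by omega) le_rfl
        fun x h1 h2 => not_dvd_half (by omega) (by omega)
    split_ifs with hs
    · refine hm.counts_opp inv hc ?_
      have e : opp (pt (2 * (2 * n)) v) = pt _ (f u) := by
        rw [opp_pt', hs, pt_eq_iff]
        exact ⟨1, by push_cast; ring⟩
      rw [e]
      exact (le_sup_left : _ ≤ f.setoid ⊔ _) (f.setoid_self u)
    · have hno : ∀ x, f u ≤ x → x ≤ u → ¬ 2 * (n : ℤ) ∣ x - v := by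
        intro x h1 h2
        rcases eq_or_lt_of_le h1 with rfl | h1
        · exact fun hh => hs (h.special_of_dvd hh)
        rcases eq_or_lt_of_le h2 with rfl | h2
        · exact h.not_dvd_uv
        exact h.not_dvd_v_of_mem h1 h2
      refine hm.counts inv hc ?_ ?_
      · refine not_rel_of_le_arc hle (by omega) le_rfl fun x h1 h2 hh => ?_
        exact hno x h1 h2 (dvd_of_dvd_shift (k := 0) (by simpa using hh))
      · rw [opp_pt']
        refine not_rel_of_le_arc hle (by omega) le_rfl fun x h1 h2 hh => ?_
        exact hno x h1 h2 (dvd_of_dvd_shift (k := 1) (by simpa using hh))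
  · have t : v < f v ∧ f v < f u := by rcases h.trichotomy with t | t | t <;> omega
    have hle : f.setoid ⊔ (evenPairing n).setoid ≤ arc n v (f v) := by
      refine sup_le (f.setoid_le_arc fun x h1 h2 => ?_)
        ((evenPairing n).setoid_le_arc fun x h1 h2 => ?_)
      · rcases eq_or_lt_of_le h1 with rfl | h1
        · omega
        rcases eq_or_lt_of_le h2 with rfl | h2
        · rw [f.inv]; omega
        have := f.nc h1 h2
        omega
      · rw [evenPairing_apply]
        split_ifs <;> omega
    have hc : ¬ (f.setoid ⊔ (evenPairing n).setoid) (pt _ v) (opp (pt _ v)) := by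
      rw [opp_pt']
      exact not_rel_of_le_arc hle le_rfl (by omega)
        fun x h1 h2 => not_dvd_half (by omega) (by omega)
    rw [if_neg (by omega)]
    have hno : ∀ x, v ≤ x → x ≤ f v → ¬ 2 * (n : ℤ) ∣ x - u := by
      intro x h1 h2 hh
      have := dvd_zero_of_lt hh (by omega) (by omega)
      omega
    refine hm.symm.counts inv hc ?_ ?_
    · refine not_rel_of_le_arc hle le_rfl (by omega) fun x h1 h2 hh => ?_
      exact hno x h1 h2 (dvd_of_dvd_shift (k := 0) (by simpa using hh))
    · rw [opp_pt']
      refine not_rel_of_le_arc hle le_rfl (by omega) fun x h1 h2 hh => ?_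
      exact hno x h1 h2 (dvd_of_dvd_shift (k := 1) (by simpa using hh))

end PerNC.Cut

namespace PerNC

variable {n : ℕ} [NeZero n]

theorem bk₀_setoid (f : PerNC n) : bk₀ f.setoid = 0 := by
  rw [bk₀, f.zeroBlocks_setoid, Set.ncard_empty]

theorem nzbk_setoid (f : PerNC n) : nzbk f.setoid = n := by
  set F : Fin (2 * n) → Set (Fin (2 * (2 * n))) :=
    fun i => {a | f.setoid a (pt _ (2 * ((i : ℕ) : ℤ)))} with hF
  have hrange : nonzeroBlocks f.setoid = Set.range F := by
    ext K
    constructor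
    · rintro ⟨⟨y, rfl⟩, -⟩
      have key : ∀ w : ℤ, w % 2 = 0 → ∃ i : Fin (2 * n),
          pt (2 * (2 * n)) (2 * ((i : ℕ) : ℤ)) = pt _ w := by
        intro w hw
        have hv := val_parity (n := n) w
        refine ⟨⟨(pt (2 * (2 * n)) w : ℕ) / 2, by have := (pt (2 * (2 * n)) w).isLt; omega⟩, ?_⟩
        have : 2 * (((pt (2 * (2 * n)) w : ℕ) / 2 : ℕ) : ℤ) = ((pt (2 * (2 * n)) w : ℕ) : ℤ) := by
          omega
        rw [this, pt_val]
      obtain ⟨x, rfl⟩ := pt_surjective y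
      have hodd := f.odd_sub x
      rcases Int.emod_two_eq_zero_or_one x with hx | hx
      · obtain ⟨i, hi⟩ := key x hx
        exact ⟨i, by simp only [hF, hi]⟩
      · obtain ⟨i, hi⟩ := key (f x) (by omega)
        refine ⟨i, ?_⟩
        simp only [hF, hi]
        rw [class_eq_iff]
        exact f.setoid.symm (f.setoid_self x)
    · rintro ⟨i, rfl⟩
      refine ⟨f.setoid.mem_classes _, fun hh => ?_⟩
      have : F i ∈ zeroBlocks f.setoid := ⟨f.setoid.mem_classes _, hh⟩
      rw [f.zeroBlocks_setoid] at this
      exact this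
  have hinj : Function.Injective F := by
    intro i j hij
    have h1 : f.setoid (pt _ (2 * ((i : ℕ) : ℤ))) (pt _ (2 * ((j : ℕ) : ℤ))) := class_eq_iff.1 hij
    have hi := i.isLt
    have hj := j.isLt
    rw [setoid_pt] at h1
    rcases h1 with h1 | h1
    · have := eq_of_pt_eq h1 (by push_cast; omega) (by push_cast; omega)
      exact Fin.ext (by omega)
    · exfalso
      have h2 := val_parity (n := n) (2 * ((j : ℕ) : ℤ))
      have h3 := val_parity (n := n) (f (2 * ((i : ℕ) : ℤ)))
      have h4 := f.odd_sub (2 * ((i : ℕ) : ℤ))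
      rw [h1] at h2
      omega
  rw [nzbk, hrange, ← Set.image_univ, Set.ncard_image_of_injective _ hinj, Set.ncard_univ,
    Nat.card_eq_fintype_card, Fintype.card_fin]
  omega

/-- Euler's formula for two periodic pairings: the blocks, the circles, and their sign symmetry. -/
theorem euler (f g : PerNC n) :
    2 * bk₀ (f.setoid ⊔ (g.setoid ⊔ (evenPairing n).setoid)) =
      bk₀ (f.setoid ⊔ (evenPairing n).setoid) + bk₀ (g.setoid ⊔ (evenPairing n).setoid) +
        bk₀ (f.setoid ⊔ g.setoid) ∧
    2 * nzbk (f.setoid ⊔ (g.setoid ⊔ (evenPairing n).setoid)) + n =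
      nzbk (f.setoid ⊔ (evenPairing n).setoid) + nzbk (g.setoid ⊔ (evenPairing n).setoid) +
        nzbk (f.setoid ⊔ g.setoid) := by
  refine surgery_induction (P := fun f g : PerNC n =>
    2 * bk₀ (f.setoid ⊔ (g.setoid ⊔ (evenPairing n).setoid)) =
      bk₀ (f.setoid ⊔ (evenPairing n).setoid) + bk₀ (g.setoid ⊔ (evenPairing n).setoid) +
        bk₀ (f.setoid ⊔ g.setoid) ∧
    2 * nzbk (f.setoid ⊔ (g.setoid ⊔ (evenPairing n).setoid)) + n =
      nzbk (f.setoid ⊔ (evenPairing n).setoid) + nzbk (g.setoid ⊔ (evenPairing n).setoid) +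
        nzbk (f.setoid ⊔ g.setoid)) ?_ ?_ f g
  · intro f
    rw [← sup_assoc, sup_idem, f.bk₀_setoid, f.nzbk_setoid]
    constructor <;> ring
  intro f g u v h hg hagree ih
  have hlt := h.lt
  have hτ := (evenPairing n).oppInvariant_setoid
  have og := g.odd_sub u
  have hgv : g v = u := by rw [← hg, g.inv]
  have hgarc : g.setoid ≤ arc n u v := g.setoid_le_arc fun x h1 h2 => by
    rcases eq_or_lt_of_le h1 with rfl | h1
    · omega
    rcases eq_or_lt_of_le h2 with rfl | h2
    · omega
    have := h.closed x h1 h2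
    rw [hagree x h1 h2] at this
    omega
  have hguv : g.setoid (pt _ u) (pt _ v) := by
    have := g.setoid_self u
    rwa [hg] at this
  have c1 := h.counts_surgery_sup g.oppInvariant_setoid hgarc
    ((le_sup_right : g.setoid ≤ f.setoid ⊔ g.setoid) hguv)
  rcases Int.emod_two_eq_zero_or_one u with hu | hu
  · have hτarc : (evenPairing n).setoid ≤ arc n u v :=
      (evenPairing n).setoid_le_arc fun x h1 h2 => by
        rw [evenPairing_apply]
        split_ifs <;> omega
    have c2 := h.counts_surgery_sup hτ hτarc (by
      have := g.rel_of_even (s := f.setoid ⊔ (evenPairing n).setoid) le_sup_right hu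
        (by rw [hg]; exact hlt) (fun w h1 h2 => by
          rw [hg] at h2
          rw [← hagree w h1 h2]
          exact (le_sup_left : f.setoid ≤ f.setoid ⊔ (evenPairing n).setoid) (f.setoid_self w))
      rwa [hg] at this)
    have c3 := h.counts_surgery_sup (g.oppInvariant_setoid.sup hτ) (sup_le hgarc hτarc)
      ((le_sup_left.trans le_sup_right :
        g.setoid ≤ f.setoid ⊔ (g.setoid ⊔ (evenPairing n).setoid)) hguv)
    omega
  · have c2 := h.counts_sup_surgery_even hu (by omega)
    have e : f.setoid ⊔ (g.setoid ⊔ (evenPairing n).setoid) =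
        h.surgery.setoid ⊔ (g.setoid ⊔ (evenPairing n).setoid) := by
      have i1 := f.oppInvariant_setoid.sup (g.oppInvariant_setoid.sup hτ)
      have i2 := h.surgery.oppInvariant_setoid.sup (g.oppInvariant_setoid.sup hτ)
      refine le_antisymm (sup_le (h.setoid_le_of_surgery_le i2 le_sup_left ?_) le_sup_right)
        (sup_le (h.surgery_le_of_setoid_le i1 le_sup_left ?_) le_sup_right)
      · exact (sup_le_sup_left le_sup_right _ : h.surgery.setoid ⊔ (evenPairing n).setoid ≤ _)
          (h.rel_surgery_even hu (by omega))
      · exact (le_sup_left.trans le_sup_right :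
          g.setoid ≤ f.setoid ⊔ (g.setoid ⊔ (evenPairing n).setoid)) hguv
    rw [e]
    omega

end PerNC

end TypeB

namespace TypeB

theorem comap_sup_of_surjective {α β : Type*} {φ : α → β} (hφ : Function.Surjective φ)
    (r s : Setoid β) : r.comap φ ⊔ s.comap φ = (r ⊔ s).comap φ := by
  apply le_antisymm
  · exact sup_le (fun a b h => (le_sup_left : r ≤ r ⊔ s) h) fun a b h => (le_sup_right : s ≤ r ⊔ s) h
  · set T := r.comap φ ⊔ s.comap φ
    have hsec : ∀ b, φ (Function.surjInv hφ b) = b := Function.surjInv_eq hφ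
    have h1 : r ⊔ s ≤ T.comap (Function.surjInv hφ) := by
      refine sup_le (fun a b h => ?_) fun a b h => ?_
      · exact (le_sup_left : _ ≤ T) (by rw [Setoid.comap_rel, hsec, hsec]; exact h)
      · exact (le_sup_right : _ ≤ T) (by rw [Setoid.comap_rel, hsec, hsec]; exact h)
    have h2 : ∀ a, T a (Function.surjInv hφ (φ a)) := fun a =>
      (le_sup_left : _ ≤ T) (by rw [Setoid.comap_rel, hsec])
    intro a b hab
    exact T.trans (h2 a) (T.trans (h1 hab) (T.symm (h2 b)))

theorem bk₀_top {N : ℕ} [NeZero N] : bk₀ (⊤ : Setoid (Fin (2 * N))) = 1 := by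
  have h : zeroBlocks (⊤ : Setoid (Fin (2 * N))) = {Set.univ} := by
    ext K
    rw [mem_zeroBlocks_iff (fun _ _ _ => trivial)]
    constructor
    · rintro ⟨y, rfl, -⟩
      exact Set.eq_univ_of_forall fun _ => trivial
    · rintro rfl
      exact ⟨0, (Set.eq_univ_of_forall fun _ => trivial).symm, trivial⟩
  rw [bk₀, h, Set.ncard_singleton]

theorem nzbk_top {N : ℕ} : nzbk (⊤ : Setoid (Fin (2 * N))) = 0 := by
  have h : nonzeroBlocks (⊤ : Setoid (Fin (2 * N))) = ∅ := by
    rw [Set.eq_empty_iff_forall_notMem]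
    intro K hK
    obtain ⟨y, rfl, h⟩ := (mem_nonzeroBlocks_iff (fun _ _ _ => trivial)).1 hK
    exact h trivial
  rw [nzbk, h, Set.ncard_empty]

namespace PerNC

variable {n : ℕ} [NeZero n]

theorem odd_sup_even : (oddPairing n).setoid ⊔ (evenPairing n).setoid = ⊤ := by
  rw [eq_top_iff]
  set s := (oddPairing n).setoid ⊔ (evenPairing n).setoid
  have h1 : ∀ x : ℤ, s (pt _ x) (pt _ (x + 1)) := by
    intro x
    by_cases hx : x % 2 = 0
    · have := (le_sup_right : _ ≤ s) ((evenPairing n).setoid_self x)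
      rwa [evenPairing_apply, if_pos hx] at this
    · have := (le_sup_left : _ ≤ s) ((oddPairing n).setoid_self x)
      rwa [oddPairing_apply, if_neg hx] at this
  have h2 : ∀ k : ℕ, s (pt _ 0) (pt _ (k : ℤ)) := by
    intro k
    induction k with
    | zero => exact s.refl _
    | succ k ih => push_cast; exact s.trans ih (h1 k)
  intro a b _
  have ha := h2 a
  have hb := h2 b
  rw [pt_val] at ha hb
  exact s.trans (s.symm ha) hb

/-- The blocks of a pairing and of its complement. -/
theorem euler_complement (f : PerNC n) :
    bk₀ (f.setoid ⊔ (evenPairing n).setoid) + bk₀ (f.setoid ⊔ (oddPairing n).setoid) = 1 ∧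
    nzbk (f.setoid ⊔ (evenPairing n).setoid) + nzbk (f.setoid ⊔ (oddPairing n).setoid) = n := by
  have h := euler f (oddPairing n)
  rw [odd_sup_even, sup_top_eq, bk₀_top, nzbk_top] at h
  omega

/-- The mirror image of a periodic pairing. -/
def reflect (f : PerNC n) : PerNC n where
  toFun x := -f (-x)
  inv' x := by rw [neg_neg, f.inv, neg_neg]
  ne' x := fun h => f.ne (-x) (by omega)
  per' x := by rw [neg_add, ← sub_eq_add_neg, f.per_sub]; ring
  nc' a b h1 h2 := by
    have := f.nc_rev (a := -a) (b := -b) (by omega) (by omega)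
    omega

theorem reflect_apply (f : PerNC n) (x : ℤ) : f.reflect x = -f (-x) := rfl

theorem reflect_reflect (f : PerNC n) : f.reflect.reflect = f :=
  PerNC.ext fun x => by rw [reflect_apply, reflect_apply, neg_neg, neg_neg]

theorem reflect_odd : (oddPairing n).reflect = evenPairing n :=
  PerNC.ext fun x => by
    rw [reflect_apply, oddPairing_apply, evenPairing_apply]
    split_ifs <;> omega

/-- The reflection of the circle. -/
def mirror (a : Fin (2 * (2 * n))) : Fin (2 * (2 * n)) := pt _ (-((a : ℕ) : ℤ))

theorem mirror_pt (x : ℤ) : mirror (pt (2 * (2 * n)) x) = pt _ (-x) := by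
  obtain ⟨k, hk⟩ := exists_eq_val_pt (M := 2 * (2 * n)) x
  rw [mirror, pt_eq_iff]
  exact ⟨k, by linarith⟩

theorem mirror_opp (a : Fin (2 * (2 * n))) : mirror (opp a) = opp (mirror a) := by
  obtain ⟨x, rfl⟩ := pt_surjective a
  rw [opp_pt, mirror_pt, mirror_pt, opp_pt, pt_eq_iff]
  exact ⟨-1, by push_cast; ring⟩

theorem mirror_surjective : Function.Surjective (mirror : Fin (2 * (2 * n)) → _) := fun a => by
  obtain ⟨x, rfl⟩ := pt_surjective a
  exact ⟨pt _ (-x), by rw [mirror_pt, neg_neg]⟩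

theorem comap_mirror (f : PerNC n) : f.setoid.comap mirror = f.reflect.setoid := by
  ext a b
  obtain ⟨x, rfl⟩ := pt_surjective a
  obtain ⟨y, rfl⟩ := pt_surjective b
  have key : ∀ x y : ℤ, pt (2 * (2 * n)) (-y) = pt _ x ↔ pt (2 * (2 * n)) y = pt _ (-x) := by
    intro x y
    rw [pt_eq_iff, pt_eq_iff, ← dvd_neg]
    congr! 1
    ring
  rw [Setoid.comap_rel, mirror_pt, mirror_pt, setoid_pt, setoid_pt, reflect_apply, key, key, neg_neg]

theorem counts_reflect (f : PerNC n) :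
    bk₀ (f.setoid ⊔ (evenPairing n).setoid) + bk₀ (f.reflect.setoid ⊔ (evenPairing n).setoid) = 1 ∧
    nzbk (f.setoid ⊔ (evenPairing n).setoid) + nzbk (f.reflect.setoid ⊔ (evenPairing n).setoid)
      = n := by
  have e : f.reflect.setoid ⊔ (evenPairing n).setoid =
      (f.setoid ⊔ (oddPairing n).setoid).comap mirror := by
    rw [← comap_sup_of_surjective mirror_surjective, comap_mirror, comap_mirror, reflect_odd]
  have i := f.oppInvariant_setoid.sup (oddPairing n).oppInvariant_setoid
  rw [e, bk₀_comap_of_surjective i mirror_opp mirror_surjective,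
    nzbk_comap_of_surjective i mirror_opp mirror_surjective]
  exact f.euler_complement

end PerNC

section Next

variable {M : ℕ}

/-- The number of points passed on the way from `i` to `k` anticlockwise. -/
def gap (i k : Fin M) : ℕ := if (i : ℕ) < k then k - i - 1 else k + M - i - 1

theorem isNext_iff {r : Setoid (Fin M)} {i j : Fin M} :
    IsNext r i j ↔ r i j ∧ ∀ k, r i k → gap i j ≤ gap i k := by
  have hi := i.isLt
  have hj := j.isLt
  constructor
  · rintro (⟨h1, h2, h3⟩ | ⟨h1, h2⟩)
    · refine ⟨h2, fun k hk => ?_⟩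
      have hlt : (i : ℕ) < j := h1
      have h4 : ¬ ((i : ℕ) < k ∧ (k : ℕ) < j) := fun hh => h3 k hh.1 hh.2 hk
      simp only [gap]
      split_ifs <;> omega
    · refine ⟨h1, fun k hk => ?_⟩
      have h4 : (j : ℕ) ≤ k := (h2 k hk).1
      have h5 : (k : ℕ) ≤ i := (h2 k hk).2
      have h6 : (j : ℕ) ≤ i := (h2 j h1).2
      simp only [gap]
      split_ifs <;> omega
  · rintro ⟨h1, h2⟩
    by_cases hij : i < j
    · left
      refine ⟨hij, h1, fun k h3 h4 h5 => ?_⟩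
      have h6 := h2 k h5
      have e1 : (i : ℕ) < j := hij
      have e2 : (i : ℕ) < k := h3
      have e3 : (k : ℕ) < j := h4
      simp only [gap] at h6
      split_ifs at h6 <;> omega
    · right
      refine ⟨h1, fun k h5 => ?_⟩
      have h6 := h2 k h5
      have e1 : ¬ (i : ℕ) < j := hij
      have hk := k.isLt
      rw [Fin.le_def, Fin.le_def]
      simp only [gap] at h6
      split_ifs at h6 <;> omega

theorem gap_injective (i : Fin M) : Function.Injective (gap i) := by
  intro j k h
  have hi := i.isLt
  have hj := j.isLt
  have hk := k.isLt
  apply Fin.ext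
  simp only [gap] at h
  split_ifs at h <;> omega

theorem exists_isNext (r : Setoid (Fin M)) (i : Fin M) : ∃ j, IsNext r i j := by
  classical
  obtain ⟨j, hj, hmin⟩ := Finset.exists_min_image (Finset.univ.filter fun k => r i k) (gap i)
    ⟨i, by simp only [Finset.mem_filter_univ]; exact r.refl i⟩
  rw [Finset.mem_filter_univ] at hj
  exact ⟨j, isNext_iff.2 ⟨hj, fun k hk => hmin k (by rwa [Finset.mem_filter_univ])⟩⟩

theorem IsNext.unique {r : Setoid (Fin M)} {i j k : Fin M} (h : IsNext r i j) (h' : IsNext r i k) :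
    j = k := by
  rw [isNext_iff] at h h'
  exact gap_injective i (le_antisymm (h.2 k h'.1) (h'.2 j h.1))

theorem IsNext.unique_left {r : Setoid (Fin M)} {i i' j : Fin M} (h : IsNext r i j)
    (h' : IsNext r i' j) : i = i' := by
  rw [isNext_iff] at h h'
  have h1 := h.2 i' (r.trans h.1 (r.symm h'.1))
  have h2 := h'.2 i (r.trans h'.1 (r.symm h.1))
  have hi := i.isLt
  have hi' := i'.isLt
  have hj := j.isLt
  apply Fin.ext
  simp only [gap] at h1 h2
  split_ifs at h1 h2 <;> omega

theorem exists_isNext_right (r : Setoid (Fin M)) (j : Fin M) : ∃ i, IsNext r i j := by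
  choose nx hnx using exists_isNext r
  have hinj : Function.Injective nx := fun i i' h => (hnx i).unique_left (by rw [h]; exact hnx i')
  obtain ⟨i, rfl⟩ := (Finite.injective_iff_surjective.1 hinj) j
  exact ⟨i, hnx i⟩

/-- The end point just before `i`. -/
def ev (i : Fin M) : Fin (2 * M) := ⟨2 * i, by omega⟩

/-- The end point just after `i`. -/
def od (i : Fin M) : Fin (2 * M) := ⟨2 * i + 1, by omega⟩

/-- The point at which an end point lies. -/
def half (a : Fin (2 * M)) : Fin M := ⟨a / 2, by omega⟩

theorem ev_or_od (a : Fin (2 * M)) : (∃ i, a = ev i) ∨ ∃ i, a = od i := by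
  rcases Nat.mod_two_eq_zero_or_one (a : ℕ) with h | h
  · exact Or.inl ⟨half a, Fin.ext (by simp only [ev, half]; omega)⟩
  · exact Or.inr ⟨half a, Fin.ext (by simp only [od, half]; omega)⟩

theorem ev_injective : Function.Injective (ev : Fin M → _) := fun i j h => by
  have := congrArg Fin.val h
  simp only [ev] at this
  exact Fin.ext (by omega)

theorem od_injective : Function.Injective (od : Fin M → _) := fun i j h => by
  have := congrArg Fin.val h
  simp only [od] at this
  exact Fin.ext (by omega)

theorem ev_ne_od (i j : Fin M) : ev i ≠ od j := fun h => by
  have := congrArg Fin.val h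
  simp only [od, ev] at this
  omega

@[simp] theorem half_ev (i : Fin M) : half (ev i) = i :=
  Fin.ext (by simp only [half, ev]; omega)

@[simp] theorem half_od (i : Fin M) : half (od i) = i :=
  Fin.ext (by simp only [half, od]; omega)

theorem half_surjective : Function.Surjective (half : Fin (2 * M) → Fin M) :=
  fun i => ⟨ev i, half_ev i⟩

theorem boundaryArcs_iff {r : Setoid (Fin M)} {a b : Fin (2 * M)} :
    boundaryArcs r a b ↔ a = b ∨ ∃ i j, IsNext r i j ∧
      ((a = od i ∧ b = ev j) ∨ (a = ev j ∧ b = od i)) := by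
  constructor
  · intro h
    change Relation.EqvGen _ a b at h
    induction h with
    | rel x y hxy =>
      obtain ⟨i, j, hij, hx, hy⟩ := hxy
      exact Or.inr ⟨i, j, hij, Or.inl ⟨Fin.ext hx, Fin.ext hy⟩⟩
    | refl x => exact Or.inl rfl
    | symm x y _ ih =>
      rcases ih with rfl | ⟨i, j, hij, h⟩
      · exact Or.inl rfl
      · exact Or.inr ⟨i, j, hij, by tauto⟩
    | trans x y z _ _ ih1 ih2 =>
      rcases ih1 with rfl | ⟨i, j, hij, h⟩
      · exact ih2
      rcases ih2 with rfl | ⟨i', j', hij', h'⟩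
      · exact Or.inr ⟨i, j, hij, h⟩
      left
      rcases h with ⟨rfl, rfl⟩ | ⟨rfl, rfl⟩ <;> rcases h' with ⟨h1, rfl⟩ | ⟨h1, rfl⟩
      · exact absurd h1 (ev_ne_od _ _)
      · obtain rfl := ev_injective h1
        rw [hij.unique_left hij']
      · obtain rfl := od_injective h1
        rw [hij.unique hij']
      · exact absurd h1.symm (ev_ne_od _ _)
  · rintro (rfl | ⟨i, j, hij, ⟨rfl, rfl⟩ | ⟨rfl, rfl⟩⟩)
    · exact (boundaryArcs r).refl _
    · exact Relation.EqvGen.rel _ _ ⟨i, j, hij, rfl, rfl⟩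
    · exact Relation.EqvGen.symm _ _ (Relation.EqvGen.rel _ _ ⟨i, j, hij, rfl, rfl⟩)

theorem boundaryArcs_next {r : Setoid (Fin M)} {i j : Fin M} (h : IsNext r i j) :
    boundaryArcs r (od i) (ev j) := boundaryArcs_iff.2 (Or.inr ⟨i, j, h, Or.inl ⟨rfl, rfl⟩⟩)

theorem ncard_class_boundaryArcs (r : Setoid (Fin M)) :
    ∀ K ∈ (boundaryArcs r).classes, K.ncard = 2 := by
  rintro K ⟨a, rfl⟩
  rcases ev_or_od a with ⟨j, rfl⟩ | ⟨i, rfl⟩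
  · obtain ⟨i, hij⟩ := exists_isNext_right r j
    have : {x | boundaryArcs r x (ev j)} = {od i, ev j} := by
      ext x
      simp only [Set.mem_ofPred_eq, Set.mem_insert_iff, Set.mem_singleton_iff]
      constructor
      · intro h
        rcases boundaryArcs_iff.1 h with rfl | ⟨i', j', hij', ⟨rfl, hh⟩ | ⟨-, hh⟩⟩
        · exact Or.inr rfl
        · obtain rfl := ev_injective hh
          exact Or.inl (by rw [hij.unique_left hij'])
        · exact absurd hh (ev_ne_od _ _)
      · rintro (rfl | rfl)
        · exact boundaryArcs_next hij
        · exact (boundaryArcs r).refl _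
    rw [this, Set.ncard_pair (ev_ne_od _ _).symm]
  · obtain ⟨j, hij⟩ := exists_isNext r i
    have : {x | boundaryArcs r x (od i)} = {od i, ev j} := by
      ext x
      simp only [Set.mem_ofPred_eq, Set.mem_insert_iff, Set.mem_singleton_iff]
      constructor
      · intro h
        rcases boundaryArcs_iff.1 h with rfl | ⟨i', j', hij', ⟨-, hh⟩ | ⟨rfl, hh⟩⟩
        · exact Or.inl rfl
        · exact absurd hh.symm (ev_ne_od _ _)
        · obtain rfl := od_injective hh
          exact Or.inr (by rw [hij.unique hij'])
      · rintro (rfl | rfl)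
        · exact (boundaryArcs r).refl _
        · exact (boundaryArcs r).symm (boundaryArcs_next hij)
    rw [this, Set.ncard_pair (ev_ne_od _ _).symm]

open Classical in
/-- Blocks of a non-crossing partition do not cross. -/
theorem IsNonCrossing.rel {r : Setoid (Fin M)} (h : IsNonCrossing r) {a b c d : Fin M}
    (hab : a < b) (hbc : b < c) (hcd : c < d) (hac : r a c) (hbd : r b d) : r a b := by
  by_contra hne
  have chord : ∀ p x y : Fin M, r p x → r p y → x < y → ∀ t, ¬ r p t → x < t → t < y →
      ∃ i j, IsChord r i j ∧ r p i ∧ r p j ∧ x ≤ i ∧ i < t ∧ t < j ∧ j ≤ y := by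
    intro p x y hx hy hxy t ht hxt hty
    obtain ⟨i, hi, himax⟩ := Finset.exists_max_image
      (Finset.univ.filter fun k => r p k ∧ x ≤ k ∧ k < t) id
      ⟨x, by simp only [Finset.mem_filter_univ]; exact ⟨hx, le_rfl, hxt⟩⟩
    obtain ⟨j, hj, hjmin⟩ := Finset.exists_min_image
      (Finset.univ.filter fun k => r p k ∧ t < k ∧ k ≤ y) id
      ⟨y, by simp only [Finset.mem_filter_univ]; exact ⟨hy, hty, le_rfl⟩⟩
    rw [Finset.mem_filter_univ] at hi hj
    refine ⟨i, j, ⟨hi.2.2.trans hj.2.1, r.trans (r.symm hi.1) hj.1, fun k h1 h2 h3 => ?_⟩, hi.1,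
      hj.1, hi.2.1, hi.2.2, hj.2.1, hj.2.2⟩
    have hpk : r p k := r.trans hi.1 h3
    rcases lt_trichotomy k t with hk | rfl | hk
    · have := himax k (by rw [Finset.mem_filter_univ]; exact ⟨hpk, hi.2.1.trans h1.le, hk⟩)
      exact absurd h1 (not_lt.2 this)
    · exact ht hpk
    · have := hjmin k (by rw [Finset.mem_filter_univ]; exact ⟨hpk, hk, h2.le.trans hj.2.2⟩)
      exact absurd h2 (not_lt.2 this)
  obtain ⟨i, j, hij, hai, haj, -, hib, hbj, hjc⟩ :=
    chord a a c (r.refl a) hac (hab.trans hbc) b hne hab hbc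
  obtain ⟨k, l, hkl, hbk, -, hbk', hkj, hjl, -⟩ :=
    chord b b d (r.refl b) hbd (hbc.trans hcd) j (fun hh => hne (r.trans haj (r.symm hh))) hbj
      (lt_of_le_of_lt hjc hcd)
  exact h i j k l hij hkl ⟨lt_of_lt_of_le hib hbk', hkj, hjl⟩

theorem IsNonCrossing.boundaryArcs {r : Setoid (Fin M)} (h : IsNonCrossing r) :
    IsNonCrossing (boundaryArcs r) := by
  have hr : ∀ {a b}, TypeB.boundaryArcs r a b → r (half a) (half b) := by
    intro a b hab
    rcases boundaryArcs_iff.1 hab with rfl | ⟨i, j, hij, ⟨rfl, rfl⟩ | ⟨rfl, rfl⟩⟩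
    · exact r.refl _
    · rw [half_od, half_ev]; exact (isNext_iff.1 hij).1
    · rw [half_od, half_ev]; exact r.symm (isNext_iff.1 hij).1
  rintro P1 P3 P2 P4 ⟨h13, r13, -⟩ ⟨h24, r24, -⟩ ⟨h12, h23, h34⟩
  have q24 := hr r24
  have v12 : (P1 : ℕ) < P2 := h12
  have v23 : (P2 : ℕ) < P3 := h23
  have v34 : (P3 : ℕ) < P4 := h34
  rcases boundaryArcs_iff.1 r13 with rfl | ⟨i, j, hij, ⟨rfl, rfl⟩ | ⟨rfl, rfl⟩⟩
  · exact lt_irrefl _ h13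
  · simp only [od, ev] at v12 v23 v34
    have e2 : i < half P2 := by rw [Fin.lt_def]; simp only [half]; omega
    have e3 : half P2 < j := by rw [Fin.lt_def]; simp only [half]; omega
    have e4 : j ≤ half P4 := by rw [Fin.le_def]; simp only [half]; omega
    have hc : IsChord r i j := hij.resolve_right fun hh =>
      absurd (hh.2 j hh.1).2 (not_le.2 (e2.trans e3))
    rcases eq_or_lt_of_le e4 with e4 | e4
    · rw [← e4] at q24
      exact hc.2.2 _ e2 e3 (r.trans hc.2.1 (r.symm q24))
    · exact hc.2.2 _ e2 e3 (h.rel e2 e3 e4 hc.2.1 q24)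
  · simp only [od, ev] at v12 v23 v34
    have e2 : j ≤ half P2 := by rw [Fin.le_def]; simp only [half]; omega
    have e3 : half P2 ≤ i := by rw [Fin.le_def]; simp only [half]; omega
    have e4 : i < half P4 := by rw [Fin.lt_def]; simp only [half]; omega
    have hc : r i j ∧ ∀ k, r i k → j ≤ k ∧ k ≤ i := hij.resolve_left fun hh =>
      absurd hh.1 (not_lt.2 (e2.trans e3))
    have hfin : r i (half P2) → False := fun hh =>
      absurd (hc.2 _ (r.trans hh q24)).2 (not_le.2 e4)
    rcases eq_or_lt_of_le e2 with e2 | e2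
    · rw [← e2] at hfin; exact hfin hc.1
    rcases eq_or_lt_of_le e3 with e3 | e3
    · rw [e3] at hfin; exact hfin (r.refl i)
    exact hfin (r.trans hc.1 (h.rel e2 e3 e4 (r.symm hc.1) q24))

theorem gap_lt_of_isNext {r : Setoid (Fin M)} {i j k : Fin M} (h : IsNext r i k) (hij : r i j)
    (hne : j ≠ i) (hk : k ≠ j) : gap k j < gap i j := by
  have h1 := (isNext_iff.1 h).2 j hij
  have hi := i.isLt
  have hj := j.isLt
  have hk' := k.isLt
  have hne' : (j : ℕ) ≠ i := fun hh => hne (Fin.ext hh)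
  have hk'' : (k : ℕ) ≠ j := fun hh => hk (Fin.ext hh)
  simp only [gap] at h1 ⊢
  split_ifs at h1 ⊢ <;> omega

theorem rel_ev_of_rel {r : Setoid (Fin M)} {s : Setoid (Fin (2 * M))} (h : boundaryArcs r ≤ s)
    (h' : ∀ i, s (ev i) (od i)) {i j : Fin M} (hij : r i j) : s (ev i) (ev j) := by
  obtain ⟨N, hN⟩ : ∃ N, gap i j = N := ⟨_, rfl⟩
  induction N using Nat.strong_induction_on generalizing i with
  | _ N ih =>
  by_cases hne : j = i
  · rw [hne]
  obtain ⟨k, hk⟩ := exists_isNext r i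
  have h1 : s (ev i) (ev k) := s.trans (h' i) (h (boundaryArcs_next hk))
  by_cases hkj : k = j
  · rwa [hkj] at h1
  · exact s.trans h1 (ih _ (by rw [← hN]; exact gap_lt_of_isNext hk hij hne hkj)
      (r.trans (r.symm (isNext_iff.1 hk).1) hij) rfl)

end Next

end TypeB

namespace TypeB

section

variable {n : ℕ}

theorem half_opp (a : Fin (2 * (2 * n))) : half (opp a) = opp (half a) := by
  have := a.isLt
  apply Fin.ext
  simp only [half, val_opp]
  split_ifs <;> omega

theorem ev_opp (i : Fin (2 * n)) : ev (opp i) = opp (ev i) := by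
  have := i.isLt
  apply Fin.ext
  simp only [val_opp, ev]
  split_ifs <;> omega

theorem od_opp (i : Fin (2 * n)) : od (opp i) = opp (od i) := by
  have := i.isLt
  apply Fin.ext
  simp only [val_opp, od]
  split_ifs <;> omega

theorem gap_opp (i j : Fin (2 * n)) : gap (opp i) (opp j) = gap i j := by
  have hi := i.isLt
  have hj := j.isLt
  simp only [gap, val_opp]
  split_ifs <;> omega

theorem OppInvariant.isNext {r : Setoid (Fin (2 * n))} (h : OppInvariant r) {i j : Fin (2 * n)}
    (hij : IsNext r i j) : IsNext r (opp i) (opp j) := by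
  rw [isNext_iff] at hij ⊢
  refine ⟨h _ _ hij.1, fun k hk => ?_⟩
  have := hij.2 (opp k) (h.iff'.1 hk)
  rw [gap_opp]
  rwa [← gap_opp i (opp k), opp_opp] at this

theorem OppInvariant.boundaryArcs {r : Setoid (Fin (2 * n))} (h : OppInvariant r) :
    OppInvariant (boundaryArcs r) := by
  intro a b hab
  rcases boundaryArcs_iff.1 hab with rfl | ⟨i, j, hij, ⟨rfl, rfl⟩ | ⟨rfl, rfl⟩⟩
  · exact (TypeB.boundaryArcs r).refl _
  · rw [← od_opp, ← ev_opp]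
    exact boundaryArcs_next (h.isNext hij)
  · rw [← od_opp, ← ev_opp]
    exact (TypeB.boundaryArcs r).symm (boundaryArcs_next (h.isNext hij))

theorem zeroBlocks_boundaryArcs {r : Setoid (Fin (2 * n))} (h : OppInvariant r) :
    zeroBlocks (boundaryArcs r) = ∅ := by
  rw [Set.eq_empty_iff_forall_notMem]
  intro K hK
  obtain ⟨y, rfl, hy⟩ := (mem_zeroBlocks_iff h.boundaryArcs).1 hK
  rcases boundaryArcs_iff.1 hy with hy | ⟨i, j, -, ⟨h1, rfl⟩ | ⟨h1, rfl⟩⟩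
  · exact opp_ne _ hy
  · rw [← ev_opp] at h1
    exact ev_ne_od _ _ h1
  · rw [← od_opp] at h1
    exact ev_ne_od _ _ h1.symm

theorem NCPart.oppInvariant (π : NCPart n) : OppInvariant π.1 :=
  opp_image_mem_classes_iff.1 π.2.1.1

/-- The bipartition of the boundary arcs. -/
def NCPart.toNCBipart (π : NCPart n) : NCBipart n :=
  ⟨boundaryArcs π.1, ⟨opp_image_mem_classes_iff.2 π.oppInvariant.boundaryArcs, by
    rw [zeroBlocks_boundaryArcs π.oppInvariant]; exact Set.subsingleton_empty⟩,
    π.2.2.boundaryArcs, ncard_class_boundaryArcs π.1⟩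

end

section

variable {n : ℕ} [NeZero n]

theorem pt_ev (i : Fin (2 * n)) : pt (2 * (2 * n)) (2 * ((i : ℕ) : ℤ)) = ev i := by
  rw [← pt_val (ev i)]
  simp only [ev]
  push_cast
  rfl

theorem pt_od (i : Fin (2 * n)) : pt (2 * (2 * n)) (2 * ((i : ℕ) : ℤ) + 1) = od i := by
  rw [← pt_val (od i)]
  simp only [od]
  push_cast
  rfl

theorem even_ev_od (i : Fin (2 * n)) : (PerNC.evenPairing n).setoid (ev i) (od i) := by
  have := (PerNC.evenPairing n).setoid_self (2 * ((i : ℕ) : ℤ))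
  rwa [PerNC.evenPairing_apply, if_pos (by omega), pt_ev, pt_od] at this

theorem even_le_comap_half (r : Setoid (Fin (2 * n))) :
    (PerNC.evenPairing n).setoid ≤ r.comap half := by
  have key : ∀ a : Fin (2 * (2 * n)), (PerNC.evenPairing n).setoid a (ev (half a)) := by
    intro a
    rcases ev_or_od a with ⟨i, rfl⟩ | ⟨i, rfl⟩
    · rw [half_ev]
    · rw [half_od]; exact (PerNC.evenPairing n).setoid.symm (even_ev_od i)
  intro a b hab
  have h : (PerNC.evenPairing n).setoid (ev (half a)) (ev (half b)) :=
    Setoid.trans' _ (Setoid.symm' _ (key a)) (Setoid.trans' _ hab (key b))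
  have e : half a = half b := by
    rw [← pt_ev, ← pt_ev, PerNC.setoid_pt] at h
    have h1 := (half a).isLt
    have h2 := (half b).isLt
    rcases h with h | h
    · have := eq_of_pt_eq h (by push_cast; omega) (by push_cast; omega)
      exact Fin.ext (by omega)
    · rw [PerNC.evenPairing_apply, if_pos (by omega), pt_ev, pt_od] at h
      exact absurd h (ev_ne_od _ _)
  rw [Setoid.comap_rel, e]

theorem boundaryArcs_sup_even (r : Setoid (Fin (2 * n))) :
    boundaryArcs r ⊔ (PerNC.evenPairing n).setoid = r.comap half := by
  apply le_antisymm
  · refine sup_le (fun a b hab => ?_) (even_le_comap_half r)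
    rcases boundaryArcs_iff.1 hab with rfl | ⟨i, j, hij, ⟨rfl, rfl⟩ | ⟨rfl, rfl⟩⟩
    · exact Setoid.refl' _ _
    · rw [Setoid.comap_rel, half_od, half_ev]; exact (isNext_iff.1 hij).1
    · rw [Setoid.comap_rel, half_od, half_ev]; exact r.symm (isNext_iff.1 hij).1
  · set s := boundaryArcs r ⊔ (PerNC.evenPairing n).setoid
    have hs : ∀ i, s (ev i) (od i) := fun i => (le_sup_right : _ ≤ s) (even_ev_od i)
    have key : ∀ a : Fin (2 * (2 * n)), s a (ev (half a)) := by
      intro a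
      rcases ev_or_od a with ⟨i, rfl⟩ | ⟨i, rfl⟩
      · rw [half_ev]
      · rw [half_od]; exact s.symm (hs i)
    intro a b hab
    exact s.trans (key a) (s.trans (rel_ev_of_rel le_sup_left hs hab) (s.symm (key b)))

theorem comap_half_injective :
    Function.Injective fun r : Setoid (Fin (2 * n)) => r.comap half := by
  intro r s h
  ext i j
  have : r.comap half (ev i) (ev j) ↔ s.comap half (ev i) (ev j) := by
    rw [show r.comap half = s.comap half from h]
  simpa [Setoid.comap_rel] using this

theorem NCPart.toNCBipart_injective :
    Function.Injective (NCPart.toNCBipart : NCPart n → NCBipart n) := by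
  intro π π' h
  apply Subtype.ext
  apply comap_half_injective
  have : boundaryArcs π.1 = boundaryArcs π'.1 := congrArg Subtype.val h
  change π.1.comap half = π'.1.comap half
  rw [← boundaryArcs_sup_even, ← boundaryArcs_sup_even, this]

/-- The cyclic successor in the partition below a periodic pairing. -/
theorem PerNC.isNext (f : PerNC n) (i : Fin (2 * n)) :
    IsNext ((f.setoid ⊔ (evenPairing n).setoid).comap ev) i
      (half (pt _ (f (2 * ((i : ℕ) : ℤ) + 1)))) := by
  set s := f.setoid ⊔ (evenPairing n).setoid with hs
  have hev : ∀ i, s (ev i) (od i) := fun i => (le_sup_right : _ ≤ s) (even_ev_od i)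
  set x : ℤ := 2 * ((i : ℕ) : ℤ) + 1 with hx
  have hodd := f.odd_sub x
  have b1 := f.lt_add x
  have b2 := f.sub_lt x
  have hi := i.isLt
  set j := half (pt (2 * (2 * n)) (f x)) with hj
  obtain ⟨J, hJ⟩ : ∃ J, f x = 2 * J := ⟨f x / 2, by omega⟩
  have hptj : pt (2 * (2 * n)) (f x) = ev j := by
    rcases ev_or_od (pt (2 * (2 * n)) (f x)) with ⟨k, hk⟩ | ⟨k, hk⟩
    · rw [hj, hk, half_ev]
    · exfalso
      have h1 := val_parity (n := n) (f x)
      rw [hk] at h1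
      simp only [od] at h1
      push_cast at h1
      omega
  have hjlt := j.isLt
  have hjJ : ((j : ℕ) : ℤ) = J ∨ ((j : ℕ) : ℤ) = J - 2 * n ∨ ((j : ℕ) : ℤ) = J + 2 * n := by
    have h1 := hptj
    rw [← pt_ev, pt_eq_iff] at h1
    push_cast at h1
    have := dvd_cases h1 (by omega) (by omega)
    omega
  rw [isNext_iff]
  constructor
  · rw [Setoid.comap_rel]
    have h1 := (le_sup_left : _ ≤ s) (f.setoid_self x)
    rw [hptj, pt_od] at h1
    exact s.trans (hev i) h1
  intro k hk
  rw [Setoid.comap_rel] at hk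
  have hklt := k.isLt
  rcases lt_or_gt_of_ne (f.ne x) with h0 | h0
  · have hle : s ≤ arc n (f x) x := by
      refine sup_le (f.setoid_le_arc fun w h1 h2 => ?_)
        ((evenPairing n).setoid_le_arc fun w h1 h2 => ?_)
      · rcases eq_or_lt_of_le h1 with rfl | h1
        · rw [f.inv]; omega
        rcases eq_or_lt_of_le h2 with rfl | h2
        · omega
        have := f.nc_rev h1 h2
        omega
      · rw [evenPairing_apply]
        split_ifs <;> omega
    by_contra hlt
    refine not_rel_of_le_arc (w := 2 * ((k : ℕ) : ℤ)) hle (by omega) le_rfl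
      (fun z h1 h2 hd => hlt ?_) (show s (pt _ x) (pt _ (2 * ((k : ℕ) : ℤ))) by
        rw [pt_ev, pt_od]; exact s.trans (s.symm (hev i)) hk)
    push_cast at hd
    have := dvd_cases hd (by omega) (by omega)
    simp only [gap]
    split_ifs <;> omega
  · have hle : s ≤ arc n (x + 1) (f x - 1) := by
      refine sup_le (f.setoid_le_arc fun w h1 h2 => ?_)
        ((evenPairing n).setoid_le_arc fun w h1 h2 => ?_)
      · have := f.nc (a := x) (b := w) (by omega) (by omega)
        omega
      · rw [evenPairing_apply]
        split_ifs <;> omega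
    by_contra hlt
    have hgk : (gap i k : ℤ) < J - i - 1 := by
      have : (gap i j : ℤ) = J - i - 1 := by
        simp only [gap]
        split_ifs <;> omega
      omega
    have hpk : pt (2 * (2 * n)) (2 * ((i : ℕ) + 1 + (gap i k : ℤ))) = ev k := by
      rw [← pt_ev, pt_eq_iff]
      simp only [gap]
      split_ifs
      · exact ⟨0, by push_cast; omega⟩
      · exact ⟨1, by push_cast; omega⟩
    refine not_rel_of_le_arc (u := 2 * ((i : ℕ) + 1 + (gap i k : ℤ))) (w := 2 * ((i : ℕ) : ℤ)) hle
      (by omega) (by omega) (fun z h1 h2 hd => ?_) ?_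
    · push_cast at hd
      have := dvd_cases hd (by omega) (by omega)
      omega
    · rw [hpk, pt_ev]
      exact s.symm hk

theorem PerNC.boundaryArcs_comap (f : PerNC n) :
    boundaryArcs ((f.setoid ⊔ (evenPairing n).setoid).comap ev) = f.setoid := by
  set r := (f.setoid ⊔ (evenPairing n).setoid).comap ev
  have key : ∀ i : Fin (2 * n), ev (half (pt _ (f (2 * ((i : ℕ) : ℤ) + 1)))) =
      pt (2 * (2 * n)) (f (2 * ((i : ℕ) : ℤ) + 1)) := by
    intro i
    rcases ev_or_od (pt (2 * (2 * n)) (f (2 * ((i : ℕ) : ℤ) + 1))) with ⟨k, hk⟩ | ⟨k, hk⟩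
    · rw [hk, half_ev]
    · exfalso
      have h1 := val_parity (n := n) (f (2 * ((i : ℕ) : ℤ) + 1))
      have h2 := f.odd_sub (2 * ((i : ℕ) : ℤ) + 1)
      rw [hk] at h1
      simp only [od] at h1
      push_cast at h1
      omega
  have key2 : ∀ i : Fin (2 * n), f.setoid (od i) (ev (half (pt _ (f (2 * ((i : ℕ) : ℤ) + 1))))) := by
    intro i
    rw [key, ← pt_od]
    exact f.setoid_self _
  apply le_antisymm
  · intro a b hab
    rcases boundaryArcs_iff.1 hab with rfl | ⟨i, j, hij, ⟨rfl, rfl⟩ | ⟨rfl, rfl⟩⟩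
    · exact Setoid.refl' _ _
    · rw [hij.unique (f.isNext i)]; exact key2 i
    · rw [hij.unique (f.isNext i)]; exact f.setoid.symm (key2 i)
  · have hodd : ∀ x : ℤ, x % 2 = 1 → boundaryArcs r (pt _ x) (pt _ (f x)) := by
      intro x hx
      have h1 := val_parity (n := n) x
      rcases ev_or_od (pt (2 * (2 * n)) x) with ⟨k, hk⟩ | ⟨k, hk⟩
      · rw [hk] at h1
        simp only [ev] at h1
        push_cast at h1
        omega
      · have h2 := boundaryArcs_next (f.isNext k)
        rw [key, ← pt_od] at h2
        rw [← pt_od] at hk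
        rw [f.pt_congr hk, hk]
        exact h2
    refine f.setoid_le fun x => ?_
    rcases Int.emod_two_eq_zero_or_one x with hx | hx
    · have h1 := f.odd_sub x
      have h2 := hodd (f x) (by omega)
      rw [f.inv] at h2
      exact (boundaryArcs r).symm h2
    · exact hodd x hx

theorem comap_half_comap_ev {s : Setoid (Fin (2 * (2 * n)))}
    (h : (PerNC.evenPairing n).setoid ≤ s) : (s.comap ev).comap half = s := by
  have key : ∀ a : Fin (2 * (2 * n)), s a (ev (half a)) := by
    intro a
    rcases ev_or_od a with ⟨i, rfl⟩ | ⟨i, rfl⟩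
    · rw [half_ev]
    · rw [half_od]; exact s.symm (h (even_ev_od i))
  ext a b
  rw [Setoid.comap_rel, Setoid.comap_rel]
  exact ⟨fun hh => s.trans (key a) (s.trans hh (s.symm (key b))),
    fun hh => s.trans (s.symm (key a)) (s.trans hh (key b))⟩

theorem NCPart.toNCBipart_surjective :
    Function.Surjective (NCPart.toNCBipart : NCPart n → NCBipart n) := by
  intro b
  obtain ⟨f, rfl⟩ := PerNC.toNCBipart_surjective b
  set s := f.setoid ⊔ (PerNC.evenPairing n).setoid with hs
  have hsi : OppInvariant s := f.oppInvariant_setoid.sup (PerNC.evenPairing n).oppInvariant_setoid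
  have hri : OppInvariant (s.comap ev) := hsi.comap ev_opp
  have hbk : bk₀ (s.comap ev) ≤ 1 := by
    have h1 := bk₀_comap_of_surjective hri half_opp half_surjective
    rw [comap_half_comap_ev le_sup_right] at h1
    have := f.euler_complement.1
    omega
  have hnc : IsNonCrossing (s.comap ev) := by
    intro i j k l hij hkl hc
    have hf := f.isNonCrossing_setoid
    have key : ∀ i j, IsChord (s.comap ev) i j → IsChord f.setoid (od i) (ev j) := by
      intro i j hij
      have h1 := boundaryArcs_next (r := s.comap ev) (Or.inl hij)
      rw [f.boundaryArcs_comap] at h1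
      have hlt : (i : ℕ) < j := hij.1
      refine ⟨by rw [Fin.lt_def]; simp only [od, ev]; omega, h1, fun m h2 h3 h4 => ?_⟩
      rw [← f.boundaryArcs_comap] at h1 h4
      rcases boundaryArcs_iff.1 h4 with rfl | ⟨i', j', hij', ⟨h5, rfl⟩ | ⟨h5, h6⟩⟩
      · exact lt_irrefl _ h2
      · obtain rfl := od_injective h5
        rw [hij'.unique (Or.inl hij)] at h3
        exact lt_irrefl _ h3
      · exact ev_ne_od _ _ h5.symm
    refine hf _ _ _ _ (key i j hij) (key k l hkl) ?_
    simp only [Fin.lt_def, od, ev] at hc ⊢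
    omega
  refine ⟨⟨s.comap ev, ⟨opp_image_mem_classes_iff.2 hri, ?_⟩, hnc⟩, ?_⟩
  · exact Set.ncard_le_one_iff_subsingleton.1 hbk
  · exact Subtype.ext f.boundaryArcs_comap

/-- The boundary-arc bijection. -/
noncomputable def NCPart.equiv (n : ℕ) [NeZero n] : NCPart n ≃ NCBipart n :=
  Equiv.ofBijective _ ⟨NCPart.toNCBipart_injective, NCPart.toNCBipart_surjective⟩

theorem NCPart.equiv_val (π : NCPart n) : (NCPart.equiv n π).1 = boundaryArcs π.1 := rfl

/-- The periodic pairing of the boundary arcs. -/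
noncomputable def NCPart.lift (π : NCPart n) : PerNC n :=
  (PerNC.equiv n).symm (NCPart.equiv n π)

theorem NCPart.setoid_lift (π : NCPart n) : π.lift.setoid = boundaryArcs π.1 := by
  have : (PerNC.equiv n π.lift).1 = boundaryArcs π.1 := by
    rw [NCPart.lift, Equiv.apply_symm_apply]; rfl
  exact this

theorem NCPart.lift_sup_even (π : NCPart n) :
    π.lift.setoid ⊔ (PerNC.evenPairing n).setoid = π.1.comap half := by
  rw [π.setoid_lift, boundaryArcs_sup_even]

theorem NCPart.bk₀_eq (π : NCPart n) :
    bk₀ π.1 = bk₀ (π.lift.setoid ⊔ (PerNC.evenPairing n).setoid) := by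
  rw [π.lift_sup_even, bk₀_comap_of_surjective π.oppInvariant half_opp half_surjective]

theorem NCPart.nzbk_eq (π : NCPart n) :
    nzbk π.1 = nzbk (π.lift.setoid ⊔ (PerNC.evenPairing n).setoid) := by
  rw [π.lift_sup_even, nzbk_comap_of_surjective π.oppInvariant half_opp half_surjective]

/-- Blocks of the join of two partitions and circles of the join of their boundary arcs. -/
theorem NCPart.counts_join (π π' : NCPart n) :
    2 * bk₀ (π.1 ⊔ π'.1) = bk₀ π.1 + bk₀ π'.1 +
      bk₀ ((NCPart.equiv n π).1 ⊔ (NCPart.equiv n π').1) ∧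
    2 * nzbk (π.1 ⊔ π'.1) + n = nzbk π.1 + nzbk π'.1 +
      nzbk ((NCPart.equiv n π).1 ⊔ (NCPart.equiv n π').1) := by
  have h := PerNC.euler π.lift π'.lift
  have e : π.lift.setoid ⊔ (π'.lift.setoid ⊔ (PerNC.evenPairing n).setoid) =
      (π.1 ⊔ π'.1).comap half := by
    rw [← comap_sup_of_surjective half_surjective, ← π.lift_sup_even, ← π'.lift_sup_even,
      ← sup_sup_distrib_right, sup_assoc]
  have i := π.oppInvariant.sup π'.oppInvariant
  rw [e, bk₀_comap_of_surjective i half_opp half_surjective,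
    nzbk_comap_of_surjective i half_opp half_surjective, ← π.bk₀_eq, ← π'.bk₀_eq, ← π.nzbk_eq,
    ← π'.nzbk_eq, π.setoid_lift, π'.setoid_lift] at h
  exact h

/-- The complement of a partition, with the opposite orientation. -/
noncomputable def NCPart.complement (π : NCPart n) : NCPart n :=
  (NCPart.equiv n).symm (PerNC.equiv n π.lift.reflect)

theorem NCPart.lift_complement (π : NCPart n) : π.complement.lift = π.lift.reflect := by
  rw [NCPart.lift, NCPart.complement, Equiv.apply_symm_apply, Equiv.symm_apply_apply]

theorem NCPart.complement_involutive :
    Function.Involutive (NCPart.complement : NCPart n → NCPart n) := by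
  intro π
  rw [NCPart.complement, NCPart.lift_complement, PerNC.reflect_reflect, NCPart.lift,
    Equiv.apply_symm_apply, Equiv.symm_apply_apply]

theorem NCPart.counts_complement (π : NCPart n) :
    bk₀ π.1 + bk₀ π.complement.1 = 1 ∧ nzbk π.1 + nzbk π.complement.1 = n := by
  rw [π.bk₀_eq, π.nzbk_eq, π.complement.bk₀_eq, π.complement.nzbk_eq, π.lift_complement]
  exact π.lift.counts_reflect

theorem NCPart.complement_ne (π : NCPart n) : π.complement ≠ π := by
  intro h
  have := π.counts_complement.1
  rw [h] at this
  omega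

end

section Scaling

variable {n : ℕ} [NeZero n] {R : Type*} [CommRing R]

theorem chromaticJoins_eq (α δ : R) (s : Rˣ) (hs : (s : R) ^ 2 = δ) :
    chromaticJoins n (α ^ 2) (δ ^ 2) =
      scaling n α s * (gram n α δ).submatrix (NCPart.equiv n) (NCPart.equiv n) * scaling n α s := by
  ext π π'
  rw [scaling, Matrix.mul_diagonal, Matrix.diagonal_mul]
  simp only [chromaticJoins, gram, Matrix.submatrix_apply, Matrix.of_apply]
  obtain ⟨h1, h2⟩ := NCPart.counts_join π π'
  set c0 := bk₀ ((NCPart.equiv n π).1 ⊔ (NCPart.equiv n π').1)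
  set cd := nzbk ((NCPart.equiv n π).1 ⊔ (NCPart.equiv n π').1)
  have e1 : (α ^ 2) ^ bk₀ (π.1 ⊔ π'.1) = α ^ bk₀ π.1 * α ^ bk₀ π'.1 * α ^ c0 := by
    rw [← pow_mul, h1, pow_add, pow_add]
  have e2 : (δ ^ 2) ^ nzbk (π.1 ⊔ π'.1) =
      ((s ^ (2 * (nzbk π.1 : ℤ) - (n : ℤ)) : Rˣ) : R) *
        ((s ^ (2 * (nzbk π'.1 : ℤ) - (n : ℤ)) : Rˣ) : R) * δ ^ cd := by
    rw [← hs, ← Units.val_pow_eq_pow_val, ← Units.val_pow_eq_pow_val, ← Units.val_pow_eq_pow_val,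
      ← Units.val_pow_eq_pow_val, ← Units.val_mul, ← Units.val_mul]
    congr 1
    rw [← zpow_natCast, ← zpow_natCast, ← zpow_natCast, ← zpow_natCast, ← zpow_mul, ← zpow_mul,
      ← zpow_mul, ← zpow_add, ← zpow_add]
    congr 1
    push_cast
    have : (2 * nzbk (π.1 ⊔ π'.1) + n : ℤ) = nzbk π.1 + nzbk π'.1 + cd := by exact_mod_cast h2
    linarith
  rw [e1, e2]
  ring

end Scaling

end TypeB

namespace TypeB

namespace PerNC

variable {n : ℕ} [NeZero n]

/-- The points at which the arcs start, read anticlockwise. -/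
def word (f : PerNC n) (a : Fin (2 * n)) : Bool := decide (((a : ℕ) : ℤ) < f ((a : ℕ) : ℤ))

theorem pt_two_congr (f : PerNC n) {x y : ℤ} (h : pt (2 * n) x = pt _ y) :
    f x - x = f y - y := by
  rw [pt_eq_iff] at h
  obtain ⟨k, hk⟩ := h
  have : x = y + 2 * n * k := by push_cast at hk; linarith
  rw [this, f.per_mul]
  ring

theorem word_pt (f : PerNC n) (x : ℤ) : f.word (pt _ x) = decide (x < f x) := by
  have := f.pt_two_congr (pt_val (pt (2 * n) x))
  rw [word, decide_eq_decide]
  omega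

theorem card_word (f : PerNC n) : (Finset.univ.filter fun a => f.word a = true).card = n := by
  have hp : ∀ a : Fin (2 * n), f.word (pt _ (f ((a : ℕ) : ℤ))) = !f.word a := by
    intro a
    rw [word_pt, f.inv, word]
    have := f.ne ((a : ℕ) : ℤ)
    rcases lt_or_gt_of_ne this with h | h
    · simp [h, h.le]
    · simp [h, h.le]
  have hinv : ∀ a : Fin (2 * n), pt _ (f ((pt (2 * n) (f ((a : ℕ) : ℤ)) : ℕ) : ℤ)) = a := by
    intro a
    have h1 := f.pt_two_congr (pt_val (pt (2 * n) (f ((a : ℕ) : ℤ))))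
    rw [f.inv] at h1
    obtain ⟨k, hk⟩ := exists_eq_val_pt (M := 2 * n) (f ((a : ℕ) : ℤ))
    conv_rhs => rw [← pt_val a]
    rw [pt_eq_iff]
    exact ⟨-k, by linarith⟩
  have h1 : (Finset.univ.filter fun a => f.word a = true).card =
      (Finset.univ.filter fun a => ¬ f.word a = true).card := by
    refine Finset.card_nbij' (fun a => pt _ (f ((a : ℕ) : ℤ))) (fun a => pt _ (f ((a : ℕ) : ℤ)))
      ?_ ?_ (fun a _ => hinv a) (fun a _ => hinv a)
    all_goals
      intro a ha
      simp only [Finset.coe_filter, Finset.mem_univ, true_and, Set.mem_ofPred_eq] at ha ⊢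
      rw [hp]
      simpa using ha
  have h2 := Finset.card_filter_add_card_filter_not (s := Finset.univ)
    (fun a : Fin (2 * n) => f.word a = true)
  rw [Finset.card_univ, Fintype.card_fin] at h2
  omega

theorem word_injective : Function.Injective (word : PerNC n → Fin (2 * n) → Bool) := by
  intro f g h
  have hw : ∀ x, x < f x ↔ x < g x := by
    intro x
    have := congrFun h (pt _ x)
    rwa [word_pt, word_pt, decide_eq_decide] at this
  have key : ∀ (N : ℕ) (x : ℤ), x < f x → f x - x = N → f x = g x := by
    intro N
    induction N using Nat.strong_induction_on with
    | _ N ih =>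
    intro x hx hN
    have hgx := (hw x).1 hx
    rcases lt_trichotomy (f x) (g x) with hlt | heq | hgt
    · exfalso
      have h1 := g.nc hx hlt
      have h2 : g (f x) < f x := by
        have h3 : ¬ f x < g (f x) := by
          rw [← hw, f.inv]; omega
        have := g.ne (f x)
        omega
      have h4 : g (f x) < f (g (f x)) := by
        rw [hw, g.inv]; exact h2
      have h5 := f.nc h1.1 h2
      have h6 := ih (f (g (f x)) - g (f x)).toNat (by omega) (g (f x)) h4 (by omega)
      rw [g.inv] at h6
      have := f.inj h6
      omega
    · exact heq
    · exfalso
      have h1 := f.nc hgx hgt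
      have h2 : f (g x) < g x := by
        have h3 : ¬ g x < f (g x) := by
          rw [hw, g.inv]; omega
        have := f.ne (g x)
        omega
      have h6 := ih (g x - f (g x)).toNat (by omega) (f (g x)) (by rw [f.inv]; exact h2)
        (by rw [f.inv]; omega)
      rw [f.inv] at h6
      have := g.inj h6
      omega
  refine PerNC.ext fun x => ?_
  rcases lt_or_gt_of_ne (f.ne x) with h1 | h1
  · have h2 := key (x - f x).toNat (f x) (by rwa [f.inv]) (by rw [f.inv]; omega)
    rw [f.inv] at h2
    rw [h2, g.inv, ← h2]
  · exact key (f x - x).toNat x h1 (by omega)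

/-- The pairing all of whose arcs are nested around a cut of the annulus. -/
def nested (n : ℕ) [NeZero n] : PerNC n :=
  have hn : (0 : ℤ) < 2 * n := by have := NeZero.pos n; omega
  have key : ∀ x d : ℤ, 0 ≤ (x + n) % (2 * n) + d → (x + n) % (2 * n) + d < 2 * n →
      (x + d + n) % (2 * n) = (x + n) % (2 * n) + d := by
    intro x d h1 h2
    have h3 := Int.emod_add_mul_ediv (x + n) (2 * n)
    rw [show x + d + n = ((x + n) % (2 * n) + d) + 2 * n * ((x + n) / (2 * n)) by linarith,
      Int.add_mul_emod_self_left, Int.emod_eq_of_lt h1 h2]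
  have hr : ∀ x : ℤ, 0 ≤ (x + n) % (2 * n) ∧ (x + n) % (2 * n) < 2 * n := fun x =>
    ⟨Int.emod_nonneg _ hn.ne', Int.emod_lt_of_pos _ hn⟩
  { toFun := fun x => x + (2 * n - 1 - 2 * ((x + n) % (2 * n)))
    inv' := fun x => by
      have := hr x
      rw [key x (2 * n - 1 - 2 * ((x + n) % (2 * n))) (by omega) (by omega)]
      ring
    ne' := fun x => by omega
    per' := fun x => by
      rw [show x + 2 * (n : ℤ) + n = (x + n) + 2 * n * 1 by ring, Int.add_mul_emod_self_left]
      ring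
    nc' := fun a b h1 h2 => by
      have := hr a
      have h3 := key a (b - a) (by omega) (by omega)
      rw [add_sub_cancel] at h3
      rw [h3]
      omega }

theorem nested_apply (x : ℤ) :
    nested n x = x + (2 * n - 1 - 2 * ((x + n) % (2 * n))) := rfl

theorem word_nested (a : Fin (2 * n)) : (nested n).word a = true ↔ n ≤ (a : ℕ) := by
  have ha := a.isLt
  rw [word, decide_eq_true_iff, nested_apply]
  rcases lt_or_ge (a : ℕ) n with h | h
  · rw [Int.emod_eq_of_lt (by omega) (by omega)]
    omega
  · rw [show (((a : ℕ) : ℤ) + n) = (((a : ℕ) : ℤ) - n) + 2 * n * 1 by ring,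
      Int.add_mul_emod_self_left, Int.emod_eq_of_lt (by omega) (by omega)]
    omega

omit [NeZero n] in
theorem Cut.lt_surgery_iff {f : PerNC n} {u v : ℤ} (h : f.Cut u v) (h1 : f u < u) (h2 : v < f v)
    (w : ℤ) : w < h.surgery w ↔
      2 * (n : ℤ) ∣ w - u ∨ (¬ 2 * (n : ℤ) ∣ w - v ∧ w < f w) := by
  have hlt := h.lt
  have hnu : ∀ w, 2 * (n : ℤ) ∣ w - v → ¬ 2 * (n : ℤ) ∣ w - u := fun w hw => by
    rw [Cut.dvd_congr hw, ← neg_sub, dvd_neg]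
    exact h.not_dvd_uv
  rw [Cut.surgery_apply]
  rcases h.rewire_cases w with hw | hw | ⟨hs, hw⟩ | ⟨hs, hw⟩ | ⟨h1, h2, h3, h4⟩
  · rw [Cut.rewire_u hw]
    simp only [hw, true_or, iff_true]
    omega
  · rw [h.rewire_v hw]
    simp only [hw, hnu w hw, not_true_eq_false, false_and, or_false, iff_false]
    omega
  · have e1 : ¬ 2 * (n : ℤ) ∣ w - u := by rw [Cut.dvd_congr hw]; exact h.not_dvd_ufu
    have e2 : ¬ 2 * (n : ℤ) ∣ w - v := by
      rw [Cut.dvd_congr hw]; exact fun hh => hs (h.special_of_dvd hh)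
    rw [h.rewire_fu hs hw]
    obtain ⟨k, hk⟩ := hw
    have : f w = u + 2 * n * k := by rw [show w = f u + 2 * n * k by omega, f.per_mul, f.inv]
    simp only [e1, e2, not_false_eq_true, true_and, false_or]
    omega
  · have e1 : ¬ 2 * (n : ℤ) ∣ w - u := by
      rw [Cut.dvd_congr hw]; exact fun hh => hs (h.special_of_dvd' hh)
    have e2 : ¬ 2 * (n : ℤ) ∣ w - v := by rw [Cut.dvd_congr hw]; exact h.not_dvd_vfv
    rw [h.rewire_fv hs hw]
    obtain ⟨k, hk⟩ := hw
    have : f w = v + 2 * n * k := by rw [show w = f v + 2 * n * k by omega, f.per_mul, f.inv]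
    simp only [e1, e2, not_false_eq_true, true_and, false_or]
    omega
  · rw [Cut.rewire_of_not h1 h2 h3 h4]
    simp only [h1, h2, not_false_eq_true, true_and, false_or]

theorem exists_word (w : Fin (2 * n) → Bool)
    (hw : (Finset.univ.filter fun a => w a = true).card = n) : ∃ f : PerNC n, f.word = w := by
  have hn : 0 < n := NeZero.pos n
  obtain ⟨N, hN⟩ : ∃ N : ℕ, 2 * n * (2 * n) - ∑ a : Fin (2 * n), (if w a then (a : ℕ) else 0) = N :=
    ⟨_, rfl⟩
  induction N using Nat.strong_induction_on generalizing w with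
  | _ N ih =>
  by_cases hd : ∃ a b : Fin (2 * n), (b : ℕ) = a + 1 ∧ w a = true ∧ w b = false
  · obtain ⟨a, b, hab, ha, hb⟩ := hd
    have hne : a ≠ b := fun hh => by rw [hh] at hab; omega
    set w' := w ∘ Equiv.swap a b with hw'
    have hw'a : w' a = false := by simp [hw', hb]
    have hw'b : w' b = true := by simp [hw', ha]
    have hw'o : ∀ c, c ≠ a → c ≠ b → w' c = w c := fun c h1 h2 => by
      simp [hw', Equiv.swap_apply_of_ne_of_ne h1 h2]
    have hcard : (Finset.univ.filter fun c => w' c = true).card = n := by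
      refine Eq.trans ?_ hw
      refine Finset.card_equiv (Equiv.swap a b) fun c => ?_
      simp [hw']
    have hsum : ∑ c : Fin (2 * n), (if w' c then (c : ℕ) else 0) =
        ∑ c : Fin (2 * n), (if w c then (c : ℕ) else 0) + 1 := by
      have split : ∀ F : Fin (2 * n) → ℕ, ∑ c, F c =
          F a + F b + ∑ c ∈ (Finset.univ.erase a).erase b, F c := fun F => by
        rw [add_assoc, Finset.add_sum_erase _ _ (by simp [hne.symm]),
          Finset.add_sum_erase _ _ (Finset.mem_univ a)]
      have e : ∑ c ∈ (Finset.univ.erase a).erase b, (if w' c then (c : ℕ) else 0) =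
          ∑ c ∈ (Finset.univ.erase a).erase b, (if w c then (c : ℕ) else 0) :=
        Finset.sum_congr rfl fun c hc => by
          rw [Finset.mem_erase, Finset.mem_erase] at hc
          rw [hw'o c hc.2.1 hc.1]
      rw [split, split fun c => if w c then (c : ℕ) else 0, e, hw'a, hw'b, ha, hb]
      simp [hab]
      ring
    have hbound : ∑ c : Fin (2 * n), (if w' c then (c : ℕ) else 0) ≤ 2 * n * (2 * n) := by
      calc _ ≤ ∑ _c : Fin (2 * n), 2 * n := Finset.sum_le_sum fun c _ => by
            have := c.isLt
            split_ifs <;> omega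
        _ = _ := by rw [Finset.sum_const, Finset.card_univ, Fintype.card_fin, smul_eq_mul]
    obtain ⟨f, hf⟩ := ih _ (by omega) w' hcard rfl
    have hfa : ¬ ((a : ℕ) : ℤ) < f ((a : ℕ) : ℤ) := by
      have := congrFun hf a
      rw [hw'a, word, decide_eq_false_iff_not] at this
      exact this
    have hfb : ((b : ℕ) : ℤ) < f ((b : ℕ) : ℤ) := by
      have := congrFun hf b
      rw [hw'b, word, decide_eq_true_iff] at this
      exact this
    have hfa' : f ((a : ℕ) : ℤ) < ((a : ℕ) : ℤ) := by
      have := f.ne ((a : ℕ) : ℤ)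
      omega
    have hcut : f.Cut ((a : ℕ) : ℤ) ((b : ℕ) : ℤ) :=
      ⟨by omega, by omega, fun x h1 h2 => by omega, by omega⟩
    have hdvd : ∀ c d : Fin (2 * n), 2 * (n : ℤ) ∣ ((c : ℕ) : ℤ) - ((d : ℕ) : ℤ) ↔ c = d := by
      intro c d
      have := pt_eq_iff (M := 2 * n) (x := ((c : ℕ) : ℤ)) (y := ((d : ℕ) : ℤ))
      rw [pt_val, pt_val] at this
      rw [this]
      push_cast
      rfl
    refine ⟨hcut.surgery, funext fun c => ?_⟩
    rw [Bool.eq_iff_iff, word, decide_eq_true_iff, hcut.lt_surgery_iff hfa' hfb, hdvd, hdvd]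
    have hfc : ((c : ℕ) : ℤ) < f ((c : ℕ) : ℤ) ↔ w' c = true := by
      rw [← hf, word, decide_eq_true_iff]
    rw [hfc]
    by_cases h1 : c = a
    · simp [h1, ha]
    by_cases h2 : c = b
    · simp [h2, hne.symm, hb]
    · simp [h1, h2, hw'o c h1 h2]
  · push Not at hd
    have hmono : ∀ (k : ℕ) (a b : Fin (2 * n)), (b : ℕ) = a + k → w a = true → w b = true := by
      intro k
      induction k with
      | zero => intro a b hab ha; rwa [show b = a from Fin.ext (by omega)]
      | succ k ihk =>
        intro a b hab ha
        have h1 := ihk a ⟨a + k, by omega⟩ rfl ha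
        have h2 := hd ⟨a + k, by omega⟩ b (by rw [hab]; simp; omega) h1
        simpa using h2
    have hsub : (Finset.univ.filter fun a => w a = true) ⊆
        Finset.univ.filter fun a : Fin (2 * n) => n ≤ (a : ℕ) := by
      intro a ha
      rw [Finset.mem_filter_univ] at ha ⊢
      have h1 : Finset.Ici a ⊆ Finset.univ.filter fun a => w a = true := fun b hb => by
        rw [Finset.mem_Ici, Fin.le_def] at hb
        rw [Finset.mem_filter_univ]
        exact hmono (b - a) a b (by omega) ha
      have h2 := Finset.card_le_card h1
      rw [Fin.card_Ici, hw] at h2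
      omega
    have hcn : (Finset.univ.filter fun a : Fin (2 * n) => n ≤ (a : ℕ)).card = n := by
      refine Eq.trans ?_ (nested n).card_word
      congr 1
      ext a
      rw [Finset.mem_filter_univ, Finset.mem_filter_univ, word_nested]
    have heq := Finset.eq_of_subset_of_card_le hsub (by rw [hw, hcn])
    refine ⟨nested n, funext fun a => ?_⟩
    rw [Bool.eq_iff_iff, word_nested]
    have := Finset.ext_iff.1 heq a
    rw [Finset.mem_filter_univ, Finset.mem_filter_univ] at this
    exact this.symm

/-- Periodic pairings are given by their words. -/
noncomputable def wordEquiv (n : ℕ) [NeZero n] :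
    PerNC n ≃ {w : Fin (2 * n) → Bool // (Finset.univ.filter fun a => w a = true).card = n} :=
  Equiv.ofBijective (fun f => ⟨f.word, f.card_word⟩)
    ⟨fun _ _ h => word_injective (congrArg Subtype.val h), fun w => by
      obtain ⟨f, hf⟩ := exists_word w.1 w.2
      exact ⟨f, Subtype.ext hf⟩⟩

theorem card_balanced (m p : ℕ) :
    Fintype.card {w : Fin m → Bool // (Finset.univ.filter fun a => w a = true).card = p} =
      m.choose p := by
  have e : {w : Fin m → Bool // (Finset.univ.filter fun a => w a = true).card = p} ≃
      {s : Finset (Fin m) // s.card = p} :=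
    { toFun := fun w => ⟨_, w.2⟩
      invFun := fun s => ⟨fun a => decide (a ∈ s.1), by simpa using s.2⟩
      left_inv := fun w => Subtype.ext (funext fun a => by simp)
      right_inv := fun s => Subtype.ext (by ext a; simp) }
  rw [Fintype.card_congr e, Fintype.card_finset_len, Fintype.card_fin]

noncomputable instance : Fintype (PerNC n) := Fintype.ofEquiv _ (wordEquiv n).symm

noncomputable instance : DecidableEq (PerNC n) := Classical.decEq _

theorem card_eq : Fintype.card (PerNC n) = (2 * n).choose n := by
  rw [Fintype.card_congr (wordEquiv n), card_balanced]

end PerNC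

section

variable {n : ℕ} [NeZero n]

theorem card_NCBipart : Fintype.card (NCBipart n) = (2 * n).choose n := by
  rw [← Fintype.card_congr (PerNC.equiv n), PerNC.card_eq]

theorem card_NCPart : Fintype.card (NCPart n) = (2 * n).choose n := by
  rw [Fintype.card_congr (NCPart.equiv n), card_NCBipart]

/-- The complement, as a permutation. -/
noncomputable def NCPart.complementEquiv (n : ℕ) [NeZero n] : NCPart n ≃ NCPart n :=
  NCPart.complement_involutive.toPerm

theorem two_mul_sum_bk₀ : 2 * ∑ π : NCPart n, bk₀ π.1 = (2 * n).choose n := by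
  have h : ∑ π : NCPart n, bk₀ π.complement.1 = ∑ π : NCPart n, bk₀ π.1 :=
    Equiv.sum_comp (NCPart.complementEquiv n) fun π : NCPart n => bk₀ π.1
  calc 2 * ∑ π : NCPart n, bk₀ π.1
      = ∑ π : NCPart n, (bk₀ π.1 + bk₀ π.complement.1) := by
        rw [Finset.sum_add_distrib, h, two_mul]
    _ = ∑ _π : NCPart n, 1 := Finset.sum_congr rfl fun π _ => π.counts_complement.1
    _ = (2 * n).choose n := by rw [Finset.sum_const, Finset.card_univ, card_NCPart, smul_eq_mul, mul_one]

theorem two_mul_sum_nzbk : 2 * ∑ π : NCPart n, nzbk π.1 = n * (2 * n).choose n := by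
  have h : ∑ π : NCPart n, nzbk π.complement.1 = ∑ π : NCPart n, nzbk π.1 :=
    Equiv.sum_comp (NCPart.complementEquiv n) fun π : NCPart n => nzbk π.1
  calc 2 * ∑ π : NCPart n, nzbk π.1
      = ∑ π : NCPart n, (nzbk π.1 + nzbk π.complement.1) := by
        rw [Finset.sum_add_distrib, h, two_mul]
    _ = ∑ _π : NCPart n, n := Finset.sum_congr rfl fun π _ => π.counts_complement.2
    _ = n * (2 * n).choose n := by
        rw [Finset.sum_const, Finset.card_univ, card_NCPart, smul_eq_mul, mul_comm]

theorem prod_zpow_eq_zpow_sum {ι G : Type*} [CommGroup G] (t : Finset ι) (g : ι → ℤ) (a : G) :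
    ∏ i ∈ t, a ^ g i = a ^ ∑ i ∈ t, g i := by
  classical
  induction t using Finset.induction_on with
  | empty => simp
  | insert i t hi ih => rw [Finset.prod_insert hi, Finset.sum_insert hi, zpow_add, ih]

theorem det_scaling {R : Type*} [CommRing R] (α : R) (s : Rˣ) :
    (scaling n α s).det = α ^ ((2 * n).choose n / 2) := by
  rw [scaling, Matrix.det_diagonal, Finset.prod_mul_distrib, Finset.prod_pow_eq_pow_sum]
  have h1 : ∑ π : NCPart n, bk₀ π.1 = (2 * n).choose n / 2 := by
    have := two_mul_sum_bk₀ (n := n)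
    omega
  have h2 : ∑ π : NCPart n, (2 * (nzbk π.1 : ℤ) - (n : ℤ)) = 0 := by
    rw [Finset.sum_sub_distrib, ← Finset.mul_sum, Finset.sum_const, Finset.card_univ, card_NCPart,
      nsmul_eq_mul]
    have : (2 * ∑ π : NCPart n, (nzbk π.1 : ℤ)) = n * (2 * n).choose n := by
      exact_mod_cast two_mul_sum_nzbk (n := n)
    rw [this]
    ring
  have h3 : ∏ π : NCPart n, ((s ^ (2 * (nzbk π.1 : ℤ) - (n : ℤ)) : Rˣ) : R) = 1 := by
    rw [← Units.coe_prod, prod_zpow_eq_zpow_sum, h2, zpow_zero, Units.val_one]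
  rw [h1, h3, mul_one]

/-- The factorization, without square roots or inverses. -/
theorem pow_mul_det_chromaticJoins {R : Type*} [CommRing R] (α δ : R) :
    δ ^ (n * (2 * n).choose n) * (chromaticJoins n (α ^ 2) (δ ^ 2)).det =
      δ ^ (n * (2 * n).choose n) * (α ^ (2 * n).choose n * (gram n α δ).det) := by
  have h : δ ^ n • chromaticJoins n (α ^ 2) (δ ^ 2) =
      Matrix.diagonal (fun π : NCPart n => α ^ bk₀ π.1 * δ ^ nzbk π.1) *
        (gram n α δ).submatrix (NCPart.equiv n) (NCPart.equiv n) *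
        Matrix.diagonal (fun π : NCPart n => α ^ bk₀ π.1 * δ ^ nzbk π.1) := by
    ext π π'
    rw [Matrix.mul_diagonal, Matrix.diagonal_mul]
    simp only [chromaticJoins, gram, Matrix.submatrix_apply, Matrix.of_apply, Matrix.smul_apply,
      smul_eq_mul]
    obtain ⟨h1, h2⟩ := NCPart.counts_join π π'
    rw [← pow_mul, ← pow_mul, h1]
    have e : δ ^ n * δ ^ (2 * nzbk (π.1 ⊔ π'.1)) = δ ^ nzbk π.1 * δ ^ nzbk π'.1 *
        δ ^ nzbk ((NCPart.equiv n π).1 ⊔ (NCPart.equiv n π').1) := by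
      rw [← pow_add, add_comm, h2, pow_add, pow_add]
    rw [pow_add, pow_add]
    linear_combination (α ^ bk₀ π.1 * α ^ bk₀ π'.1 *
      α ^ bk₀ ((NCPart.equiv n π).1 ⊔ (NCPart.equiv n π').1)) * e
  have h' := congrArg Matrix.det h
  rw [Matrix.det_smul, Matrix.det_mul, Matrix.det_mul, Matrix.det_submatrix_equiv_self,
    Matrix.det_diagonal, Finset.prod_mul_distrib, Finset.prod_pow_eq_pow_sum,
    Finset.prod_pow_eq_pow_sum, card_NCPart, ← pow_mul] at h'
  rw [h', ← two_mul_sum_nzbk, ← two_mul_sum_bk₀]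
  ring

end

end TypeB

namespace TypeB

section SpinSums

variable {K : Type*} [Field K]

/-- The weight of an arc of winding `k` with the spins `s`, `t` at its ends. -/
def wt (q z : K) (s t : Bool) (k : ℤ) : K :=
  if s = true ∧ t = false then z ^ k else if s = false ∧ t = true then q⁻¹ * z ^ (-k) else 0

theorem wt_zigzag {q z : K} (hz : z ≠ 0) (s t : Bool) (k₁ k₂ k₃ : ℤ) :
    ∑ a, ∑ b, wt q z s a k₁ * wt q z b t k₃ * wt q z⁻¹ a b k₂ =
      q⁻¹ * wt q z s t (k₁ + k₂ + k₃) := by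
  cases s <;> cases t <;> simp [wt, zpow_add₀ hz]
  all_goals ring

theorem wt_zigzag_left {q z : K} (hz : z ≠ 0) (s t : Bool) (k₁ k₂ k₃ : ℤ) :
    ∑ a, ∑ b, wt q z s a k₁ * wt q z t b k₃ * wt q z⁻¹ a b k₂ =
      q⁻¹ * wt q z t s (k₃ - k₂ - k₁) := by
  cases s <;> cases t <;> simp [wt, sub_eq_add_neg, zpow_add₀ hz]
  all_goals ring

theorem wt_zigzag_right {q z : K} (hz : z ≠ 0) (s t : Bool) (k₁ k₂ k₃ : ℤ) :
    ∑ a, ∑ b, wt q z a s k₁ * wt q z b t k₃ * wt q z⁻¹ a b k₂ =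
      q⁻¹ * wt q z t s (k₁ - k₂ - k₃) := by
  cases s <;> cases t <;> simp [wt, sub_eq_add_neg, zpow_add₀ hz]
  all_goals ring

theorem wt_circle {q z : K} (hz : z ≠ 0) (k : ℤ) :
    ∑ a, ∑ b, wt q z a b k * wt q z⁻¹ a b k = 1 + (q⁻¹) ^ 2 := by
  simp only [wt, Fintype.sum_bool]
  simp
  field_simp

theorem wt_essential {q z : K} (k l : ℤ) (hkl : k + l = 1) (hz : z ≠ 0) :
    ∑ a, ∑ b, wt q z b a k * wt q z⁻¹ a b l = q⁻¹ * (z + z⁻¹) := by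
  obtain rfl : l = 1 - k := by omega
  simp only [wt, Fintype.sum_bool]
  simp [sub_eq_add_neg, zpow_add₀ hz]
  field_simp
  ring

variable {ι : Type*} [Fintype ι] [DecidableEq ι]

theorem sum_update (F : (ι → Bool) → K) (u : ι) :
    ∑ σ : ι → Bool, ∑ a, F (Function.update σ u a) = 2 * ∑ σ, F σ := by
  have h : ∀ σ : ι → Bool, ∑ a, F (Function.update σ u a) =
      F σ + F (Function.update σ u (!σ u)) := by
    intro σ
    rw [Fintype.sum_bool]
    cases hσ : σ u
    · rw [add_comm, ← hσ, Function.update_eq_self, hσ]; rfl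
    · rw [← hσ, Function.update_eq_self, hσ]; rfl
  have hinv : Function.Involutive fun σ : ι → Bool => Function.update σ u (!σ u) := by
    intro σ
    simp
  have h2 : ∑ σ : ι → Bool, F (Function.update σ u (!σ u)) = ∑ σ, F σ :=
    Equiv.sum_comp hinv.toPerm F
  simp only [h]
  rw [Finset.sum_add_distrib, h2, two_mul]

theorem sum_update_update (F : (ι → Bool) → K) (u v : ι) :
    ∑ σ : ι → Bool, ∑ a, ∑ b, F (Function.update (Function.update σ u a) v b) =
      4 * ∑ σ, F σ := by
  have h := sum_update (fun σ => ∑ b, F (Function.update σ v b)) u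
  rw [h, sum_update]
  ring

theorem sum_mul_of_indep (G H : (ι → Bool) → K) (u v : ι)
    (hH : ∀ σ a b, H (Function.update (Function.update σ u a) v b) = H σ) :
    4 * ∑ σ, G σ * H σ =
      ∑ σ, (∑ a, ∑ b, G (Function.update (Function.update σ u a) v b)) * H σ := by
  rw [← sum_update_update _ u v]
  refine Finset.sum_congr rfl fun σ _ => ?_
  simp only [hH, Finset.sum_mul]

end SpinSums

namespace PerNC

variable {n : ℕ} [NeZero n] {K : Type*} [Field K]

theorem pt_two_f (f : PerNC n) {x y : ℤ} (h : pt (2 * n) x = pt _ y) :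
    pt (2 * n) (f x) = pt _ (f y) := by
  have h1 := f.pt_two_congr h
  rw [pt_eq_iff] at h ⊢
  rwa [show f x - f y = x - y by omega]

theorem pt_two_f_iff (f : PerNC n) {x y : ℤ} :
    pt (2 * n) (f x) = pt _ y ↔ pt (2 * n) x = pt _ (f y) :=
  ⟨fun h => by have := f.pt_two_f h; rwa [f.inv] at this,
   fun h => by have := f.pt_two_f h; rwa [f.inv] at this⟩

theorem pt_two_ne (f : PerNC n) (x : ℤ) : pt (2 * n) (f x) ≠ pt _ x := by
  intro h
  have h1 := f.lt_add x
  have h2 := f.sub_lt x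
  exact f.ne x (eq_of_pt_eq h (by push_cast; omega) (by push_cast; omega))

/-- The weight of the arc starting at `x`, if there is one. -/
def ptW (q z : K) (f : PerNC n) (σ : Fin (2 * n) → Bool) (x : ℤ) : K :=
  if x < f x then wt q z (σ (pt _ x)) (σ (pt _ (f x))) (f x / (2 * n) - x / (2 * n)) else 1

/-- The weight of a state on a pairing. -/
def stateW (q z : K) (f : PerNC n) (σ : Fin (2 * n) → Bool) : K :=
  ∏ a : Fin (2 * n), ptW q z f σ ((a : ℕ) : ℤ)

theorem ptW_congr (q z : K) (f : PerNC n) (σ : Fin (2 * n) → Bool) {x y : ℤ}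
    (h : pt (2 * n) x = pt _ y) : ptW q z f σ x = ptW q z f σ y := by
  have hn : (2 * (n : ℤ)) ≠ 0 := by have := NeZero.pos n; omega
  have h1 := f.pt_two_congr h
  have h2 := f.pt_two_f h
  have h3 : f x / (2 * n) - x / (2 * n) = f y / (2 * n) - y / (2 * n) := by
    rw [pt_eq_iff] at h
    obtain ⟨k, hk⟩ := h
    push_cast at hk
    rw [show x = y + 2 * n * k by omega, f.per_mul, Int.add_mul_ediv_left _ _ hn,
      Int.add_mul_ediv_left _ _ hn]
    ring
  simp only [ptW, h, h2, h3]
  congr 1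
  exact propext ⟨fun _ => by omega, fun _ => by omega⟩

theorem ptW_of_eq (q z : K) {f g : PerNC n} (σ : Fin (2 * n) → Bool) {x : ℤ} (h : f x = g x) :
    ptW q z f σ x = ptW q z g σ x := by
  simp only [ptW, h]

theorem ptW_update (q z : K) (f : PerNC n) (σ : Fin (2 * n) → Bool) {x : ℤ} {u : Fin (2 * n)}
    (h1 : pt _ x ≠ u) (h2 : pt _ (f x) ≠ u) (a : Bool) :
    ptW q z f (Function.update σ u a) x = ptW q z f σ x := by
  simp only [ptW, Function.update_of_ne h1, Function.update_of_ne h2]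

/-- The weight of the arc joining `x` and `y`. -/
def arcW (q z : K) (σ : Fin (2 * n) → Bool) (x y : ℤ) : K :=
  if x < y then wt q z (σ (pt _ x)) (σ (pt _ y)) (y / (2 * n) - x / (2 * n))
  else wt q z (σ (pt _ y)) (σ (pt _ x)) (x / (2 * n) - y / (2 * n))

theorem ptW_mul_ptW (q z : K) (f : PerNC n) (σ : Fin (2 * n) → Bool) (x : ℤ) :
    ptW q z f σ x * ptW q z f σ (f x) = arcW q z σ x (f x) := by
  have := f.ne x
  simp only [ptW, arcW, f.inv]
  rcases lt_or_gt_of_ne this with h | h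
  · rw [if_neg (by omega), if_pos h, if_neg (by omega), one_mul]
  · rw [if_pos h, if_neg (by omega), if_pos h, mul_one]

/-- The part of the weight of a state away from some points. -/
def restW (q z : K) (f : PerNC n) (T : Finset (Fin (2 * n))) (σ : Fin (2 * n) → Bool) : K :=
  ∏ a ∈ Finset.univ \ T, ptW q z f σ ((a : ℕ) : ℤ)

theorem restW_update (q z : K) (f : PerNC n) {T : Finset (Fin (2 * n))} {u : ℤ}
    (h1 : pt _ u ∈ T) (h2 : pt _ (f u) ∈ T) (σ : Fin (2 * n) → Bool) (a : Bool) :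
    restW q z f T (Function.update σ (pt _ u) a) = restW q z f T σ := by
  refine Finset.prod_congr rfl fun b hb => ?_
  rw [Finset.mem_sdiff] at hb
  apply ptW_update
  · rw [pt_val]; rintro rfl; exact hb.2 h1
  · intro hh
    rw [f.pt_two_f_iff, pt_val] at hh
    rw [hh] at hb
    exact hb.2 h2

theorem stateW_eq_rest_pair (q z : K) (f : PerNC n) (σ : Fin (2 * n) → Bool) {u v : ℤ}
    (huv : pt (2 * n) u ≠ pt _ v) :
    stateW q z f σ = ptW q z f σ u * ptW q z f σ v * restW q z f {pt _ u, pt _ v} σ := by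
  rw [stateW, restW, ← Finset.prod_sdiff (Finset.subset_univ {pt (2 * n) u, pt _ v}), mul_comm,
    Finset.prod_pair huv, ptW_congr q z f σ (pt_val _), ptW_congr q z f σ (pt_val _)]

/-- The sum over all states of the product of the weights on two pairings. -/
def pairing (q z : K) (f g : PerNC n) : K := ∑ σ, stateW q z f σ * stateW q z⁻¹ g σ

theorem pairing_self [CharZero K] {q z : K} (hz : z ≠ 0) (f : PerNC n) :
    pairing q z f f = (1 + (q⁻¹) ^ 2) ^ n := by
  set E : Fin (2 * n) → (Fin (2 * n) → Bool) → K := fun a σ =>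
    ptW q z f σ ((a : ℕ) : ℤ) * ptW q z⁻¹ f σ ((a : ℕ) : ℤ) with hE
  have key : ∀ B : Finset (Fin (2 * n)), (∀ a ∈ B, f.word a = true) →
      4 ^ B.card * ∑ σ, ∏ a ∈ B, E a σ = 4 ^ n * (1 + (q⁻¹) ^ 2) ^ B.card := by
    intro B
    induction B using Finset.induction_on with
    | empty =>
      intro _
      simp only [Finset.card_empty, pow_zero, one_mul, Finset.prod_empty, mul_one]
      rw [Finset.sum_const, Finset.card_univ, Fintype.card_fun, Fintype.card_bool,
        Fintype.card_fin, pow_mul]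
      norm_num
    | insert a B ha ih =>
      intro hB
      have hwa : ((a : ℕ) : ℤ) < f ((a : ℕ) : ℤ) := by
        have := hB a (Finset.mem_insert_self _ _)
        rwa [word, decide_eq_true_iff] at this
      have ih' := ih fun b hb => hB b (Finset.mem_insert_of_mem hb)
      have hne := f.pt_two_ne ((a : ℕ) : ℤ)
      rw [pt_val] at hne
      have hindep : ∀ σ s t, (∏ b ∈ B, E b (Function.update (Function.update σ a s)
          (pt (2 * n) (f ((a : ℕ) : ℤ))) t)) = ∏ b ∈ B, E b σ := by
        intro σ s t
        refine Finset.prod_congr rfl fun b hb => ?_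
        have hba : b ≠ a := by rintro rfl; exact ha hb
        have hwb : f.word b = true := hB b (Finset.mem_insert_of_mem hb)
        have e1 : pt (2 * n) ((b : ℕ) : ℤ) ≠ a := by rwa [pt_val]
        have e2 : pt (2 * n) ((b : ℕ) : ℤ) ≠ pt _ (f ((a : ℕ) : ℤ)) := by
          intro hh
          have h1 := f.word_pt (f ((a : ℕ) : ℤ))
          rw [← hh, pt_val, hwb, f.inv] at h1
          have := of_decide_eq_true h1.symm
          omega
        have e3 : pt (2 * n) (f ((b : ℕ) : ℤ)) ≠ a := by
          intro hh
          rw [← pt_val a, f.pt_two_f_iff] at hh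
          exact e2 hh
        have e4 : pt (2 * n) (f ((b : ℕ) : ℤ)) ≠ pt _ (f ((a : ℕ) : ℤ)) := by
          rw [Ne, f.pt_two_f_iff, f.inv, pt_val, pt_val]
          exact hba
        simp only [hE, ptW_update q z f _ e2 e4, ptW_update q z f _ e1 e3,
          ptW_update q z⁻¹ f _ e2 e4, ptW_update q z⁻¹ f _ e1 e3]
      have hfac := sum_mul_of_indep (E a) (fun σ => ∏ b ∈ B, E b σ) a (pt _ (f ((a : ℕ) : ℤ)))
        hindep
      have hcirc : ∀ σ, (∑ s, ∑ t, E a (Function.update (Function.update σ a s)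
          (pt _ (f ((a : ℕ) : ℤ))) t)) = 1 + (q⁻¹) ^ 2 := by
        intro σ
        simp only [hE, ptW, if_pos hwa, pt_val, Function.update_self, Function.update_of_ne hne.symm]
        exact wt_circle hz _
      simp only [hcirc] at hfac
      rw [← Finset.mul_sum] at hfac
      simp only [Finset.prod_insert ha]
      rw [Finset.card_insert_of_notMem ha, pow_succ, mul_assoc, hfac, pow_succ]
      linear_combination (1 + (q⁻¹) ^ 2) * ih'
  have h := key (Finset.univ.filter fun a => f.word a = true) fun a ha => by simpa using ha
  rw [f.card_word] at h
  have h4 : (4 : K) ^ n ≠ 0 := pow_ne_zero _ (by norm_num)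
  rw [← mul_left_cancel₀ h4 h, pairing]
  refine Finset.sum_congr rfl fun σ _ => ?_
  rw [stateW, stateW, ← Finset.prod_mul_distrib, Finset.prod_filter]
  refine Finset.prod_congr rfl fun a _ => ?_
  split_ifs with hw
  · rfl
  · rw [word, decide_eq_true_iff] at hw
    simp [ptW, hw]

namespace Cut

variable {f : PerNC n} {u v : ℤ}

theorem pt_uv (h : f.Cut u v) : pt (2 * n) u ≠ pt _ v := by
  rw [Ne, pt_eq_iff]; push_cast; exact h.not_dvd_uv

theorem sum_arcW_self (h : f.Cut u v) {q z : K} (hz : z ≠ 0) (σ : Fin (2 * n) → Bool) :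
    ∑ a, ∑ b, arcW q z (Function.update (Function.update σ (pt _ u) a) (pt _ v) b) u v *
      arcW q z⁻¹ (Function.update (Function.update σ (pt _ u) a) (pt _ v) b) u v =
      1 + (q⁻¹) ^ 2 := by
  simp only [arcW, if_pos h.lt, Function.update_self, Function.update_of_ne h.pt_uv]
  exact wt_circle hz _

theorem stateW_arc {g : PerNC n} (h : f.Cut u v) (hg : g u = v) (q z : K)
    (σ : Fin (2 * n) → Bool) :
    stateW q z g σ = arcW q z σ u v * restW q z g {pt _ u, pt _ v} σ := by
  rw [stateW_eq_rest_pair q z g σ h.pt_uv]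
  congr 1
  have := ptW_mul_ptW q z g σ u
  rwa [hg] at this

theorem restW_pair_update {g : PerNC n} (hg : g u = v) (q z : K) (σ : Fin (2 * n) → Bool)
    (a b : Bool) : restW q z g {pt _ u, pt _ v}
      (Function.update (Function.update σ (pt _ u) a) (pt _ v) b) =
      restW q z g {pt _ u, pt _ v} σ := by
  have hgv : g v = u := by rw [← hg, g.inv]
  rw [restW_update q z g (by simp) (by rw [hgv]; simp), restW_update q z g (by simp)
    (by rw [hg]; simp)]

theorem pairing_surgery_special [CharZero K] {g : PerNC n} (h : f.Cut u v) (hg : g u = v)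
    {q z : K} (hq : q ≠ 0) (hz : z ≠ 0) (hs : f u = v - 2 * n) :
    (z + z⁻¹) * pairing q z h.surgery g = (q + q⁻¹) * pairing q z f g := by
  have hlt := h.lt
  have hlt' := h.lt'
  have hfv := h.special_iff.1 hs
  have hn : (2 * (n : ℤ)) ≠ 0 := by have := NeZero.pos n; omega
  set H : (Fin (2 * n) → Bool) → K := fun σ =>
    restW q z h.surgery {pt _ u, pt _ v} σ * restW q z⁻¹ g {pt _ u, pt _ v} σ with hH
  have hHu : ∀ σ a b, H (Function.update (Function.update σ (pt _ u) a) (pt _ v) b) = H σ := by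
    intro σ a b
    simp only [hH, restW_pair_update hg, restW_pair_update h.surgery_u]
  have hrest : ∀ σ, restW q z f {pt _ u, pt _ v} σ = restW q z h.surgery {pt _ u, pt _ v} σ := by
    intro σ
    refine Finset.prod_congr rfl fun a ha => ?_
    simp only [Finset.mem_sdiff, Finset.mem_univ, Finset.mem_insert, Finset.mem_singleton, true_and,
      not_or] at ha
    rw [← pt_val a] at ha
    simp only [pt_eq_iff] at ha
    push_cast at ha
    apply ptW_of_eq
    rw [surgery_apply]
    rcases h.rewire_cases ((a : ℕ) : ℤ) with h1 | h1 | ⟨h1, -⟩ | ⟨h1, -⟩ | ⟨h1, h2, h3, h4⟩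
    · exact absurd h1 ha.1
    · exact absurd h1 ha.2
    · exact absurd hs h1
    · exact absurd hs h1
    · rw [rewire_of_not h1 h2 h3 h4]
  have e1 : ∀ σ, stateW q z f σ * stateW q z⁻¹ g σ =
      (wt q z (σ (pt _ v)) (σ (pt _ u)) ((u + 2 * n) / (2 * n) - v / (2 * n)) *
        arcW q z⁻¹ σ u v) * H σ := by
    intro σ
    have hpu : pt (2 * n) (u + 2 * n) = pt _ u := by
      rw [pt_eq_iff]; exact ⟨1, by push_cast; ring⟩
    rw [stateW_eq_rest_pair q z f σ h.pt_uv, h.stateW_arc hg, hrest]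
    have e2 : ptW q z f σ u = 1 := by rw [ptW, if_neg (by omega)]
    have e3 : ptW q z f σ v =
        wt q z (σ (pt _ v)) (σ (pt _ u)) ((u + 2 * n) / (2 * n) - v / (2 * n)) := by
      rw [ptW, if_pos (by omega), hfv, hpu]
    rw [e2, e3, hH]
    ring
  have e2 : ∀ σ, stateW q z h.surgery σ * stateW q z⁻¹ g σ =
      (arcW q z σ u v * arcW q z⁻¹ σ u v) * H σ := by
    intro σ
    rw [h.stateW_arc h.surgery_u, h.stateW_arc hg, hH]
    ring
  have s1 := sum_mul_of_indep (fun σ => wt q z (σ (pt _ v)) (σ (pt _ u))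
    ((u + 2 * n) / (2 * n) - v / (2 * n)) * arcW q z⁻¹ σ u v) H _ _ hHu
  have s2 := sum_mul_of_indep (fun σ => arcW q z σ u v * arcW q z⁻¹ σ u v) H _ _ hHu
  simp only [h.sum_arcW_self hz] at s2
  have ess : ∀ σ : Fin (2 * n) → Bool, (∑ a, ∑ b,
      (wt q z (Function.update (Function.update σ (pt _ u) a) (pt _ v) b (pt _ v))
        (Function.update (Function.update σ (pt _ u) a) (pt _ v) b (pt _ u))
        ((u + 2 * n) / (2 * n) - v / (2 * n)) *
      arcW q z⁻¹ (Function.update (Function.update σ (pt _ u) a) (pt _ v) b) u v)) =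
      q⁻¹ * (z + z⁻¹) := by
    intro σ
    simp only [arcW, if_pos hlt, Function.update_self, Function.update_of_ne h.pt_uv]
    refine wt_essential _ _ ?_ hz
    have := Int.add_mul_ediv_left u 1 hn
    rw [mul_one] at this
    omega
  simp only [ess] at s1
  rw [← Finset.mul_sum] at s1 s2
  have p1 : pairing q z f g = ∑ σ, (wt q z (σ (pt _ v)) (σ (pt _ u))
      ((u + 2 * n) / (2 * n) - v / (2 * n)) * arcW q z⁻¹ σ u v) * H σ :=
    Finset.sum_congr rfl fun σ _ => e1 σ
  have p2 : pairing q z h.surgery g = ∑ σ, (arcW q z σ u v * arcW q z⁻¹ σ u v) * H σ :=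
    Finset.sum_congr rfl fun σ _ => e2 σ
  rw [← p1] at s1
  rw [← p2] at s2
  have h4 : (4 : K) ≠ 0 := by norm_num
  apply mul_left_cancel₀ h4
  rw [mul_left_comm, s2, mul_left_comm 4, s1]
  field_simp

theorem pairing_surgery [CharZero K] {g : PerNC n} (h : f.Cut u v) (hg : g u = v)
    {q z : K} (hq : q ≠ 0) (hz : z ≠ 0) (hs : f u ≠ v - 2 * n) :
    pairing q z h.surgery g = (q + q⁻¹) * pairing q z f g := by
  have hlt := h.lt
  have hlt' := h.lt'
  have hdv : ∀ x y : ℤ, ¬ 2 * (n : ℤ) ∣ x - y → pt (2 * n) x ≠ pt _ y := fun x y hh => by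
    rw [Ne, pt_eq_iff]; push_cast; exact hh
  have d1 := h.pt_uv
  have d2 : pt (2 * n) (f u) ≠ pt _ u := hdv _ _ h.not_dvd_ufu
  have d3 : pt (2 * n) (f u) ≠ pt _ v := hdv _ _ fun hh => hs (h.special_of_dvd hh)
  have d4 : pt (2 * n) (f v) ≠ pt _ u := hdv _ _ fun hh => hs (h.special_of_dvd' hh)
  have d5 : pt (2 * n) (f v) ≠ pt _ v := hdv _ _ h.not_dvd_vfv
  have d6 : pt (2 * n) (f u) ≠ pt _ (f v) := hdv _ _ h.not_dvd_fufv
  set T : Finset (Fin (2 * n)) := {pt _ u, pt _ v, pt _ (f u), pt _ (f v)} with hT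
  have split : ∀ (k : PerNC n) (σ : Fin (2 * n) → Bool), stateW q z k σ =
      (ptW q z k σ u * ptW q z k σ v * (ptW q z k σ (f u) * ptW q z k σ (f v))) *
        restW q z k T σ := by
    intro k σ
    rw [stateW, restW, ← Finset.prod_sdiff (Finset.subset_univ T), mul_comm, hT,
      Finset.prod_insert (by simp [d1, d2.symm, d4.symm]), Finset.prod_insert
      (by simp [d3.symm, d5.symm]), Finset.prod_pair d6, ptW_congr q z k σ (pt_val _),
      ptW_congr q z k σ (pt_val _), ptW_congr q z k σ (pt_val _), ptW_congr q z k σ (pt_val _)]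
    ring
  have hrest : ∀ σ, restW q z h.surgery T σ = restW q z f T σ := by
    intro σ
    refine Finset.prod_congr rfl fun a ha => ?_
    simp only [hT, Finset.mem_sdiff, Finset.mem_univ, Finset.mem_insert, Finset.mem_singleton,
      true_and, not_or] at ha
    rw [← pt_val a] at ha
    simp only [pt_eq_iff] at ha
    push_cast at ha
    apply ptW_of_eq
    rw [surgery_apply, rewire_of_not ha.1 ha.2.1 ha.2.2.1 ha.2.2.2]
  set H : (Fin (2 * n) → Bool) → K := fun σ =>
    restW q z f T σ * restW q z⁻¹ g {pt _ u, pt _ v} σ with hH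
  have hHu : ∀ σ a b, H (Function.update (Function.update σ (pt _ u) a) (pt _ v) b) = H σ := by
    intro σ a b
    simp only [hH, restW_pair_update hg]
    rw [restW_update q z f (by simp [hT]) (by simp [hT]),
      restW_update q z f (by simp [hT]) (by simp [hT])]
  have e1 : ∀ σ, stateW q z f σ * stateW q z⁻¹ g σ =
      (arcW q z σ u (f u) * arcW q z σ v (f v) * arcW q z⁻¹ σ u v) * H σ := by
    intro σ
    rw [split, h.stateW_arc hg, ← ptW_mul_ptW, ← ptW_mul_ptW, hH]
    ring
  have e2 : ∀ σ, stateW q z h.surgery σ * stateW q z⁻¹ g σ =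
      (arcW q z σ u v * arcW q z⁻¹ σ u v) * (arcW q z σ (f u) (f v) * H σ) := by
    intro σ
    have a1 := ptW_mul_ptW q z h.surgery σ u
    have a2 := ptW_mul_ptW q z h.surgery σ (f u)
    rw [h.surgery_u] at a1
    rw [h.surgery_fu hs] at a2
    rw [split, h.stateW_arc hg, a1, a2, hrest, hH]
    ring
  have hH2 : ∀ σ a b, arcW q z (Function.update (Function.update σ (pt _ u) a) (pt _ v) b)
      (f u) (f v) * H (Function.update (Function.update σ (pt _ u) a) (pt _ v) b) =
      arcW q z σ (f u) (f v) * H σ := by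
    intro σ a b
    rw [hHu]
    simp only [arcW, Function.update_of_ne d2, Function.update_of_ne d3, Function.update_of_ne d4,
      Function.update_of_ne d5]
  have s1 := sum_mul_of_indep (fun σ => arcW q z σ u (f u) * arcW q z σ v (f v) *
    arcW q z⁻¹ σ u v) H _ _ hHu
  have s2 := sum_mul_of_indep (fun σ => arcW q z σ u v * arcW q z⁻¹ σ u v)
    (fun σ => arcW q z σ (f u) (f v) * H σ) _ _ hH2
  simp only [h.sum_arcW_self hz] at s2
  have zig : ∀ σ : Fin (2 * n) → Bool, (∑ a, ∑ b,
      (arcW q z (Function.update (Function.update σ (pt _ u) a) (pt _ v) b) u (f u) *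
      arcW q z (Function.update (Function.update σ (pt _ u) a) (pt _ v) b) v (f v) *
      arcW q z⁻¹ (Function.update (Function.update σ (pt _ u) a) (pt _ v) b) u v)) =
      q⁻¹ * arcW q z σ (f u) (f v) := by
    intro σ
    simp only [arcW, if_pos hlt, Function.update_self, Function.update_of_ne d1,
      Function.update_of_ne d2, Function.update_of_ne d3, Function.update_of_ne d4,
      Function.update_of_ne d5]
    rcases h.trichotomy with t | t | t
    · simp only [if_neg (show ¬ u < f u by omega), if_pos (show v < f v by omega),
        if_pos (show f u < f v by omega)]
      rw [wt_zigzag hz]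
      congr 2
      ring
    · simp only [if_neg (show ¬ u < f u by omega), if_neg (show ¬ v < f v by omega),
        if_neg (show ¬ f u < f v by omega)]
      rw [wt_zigzag_left hz]
      congr 2
      ring
    · simp only [if_pos (show u < f u by omega), if_pos (show v < f v by omega),
        if_neg (show ¬ f u < f v by omega)]
      rw [wt_zigzag_right hz]
      congr 2
      ring
  simp only [zig] at s1
  simp only [mul_assoc q⁻¹] at s1
  rw [← Finset.mul_sum] at s1 s2
  have p1 : pairing q z f g = ∑ σ, (arcW q z σ u (f u) * arcW q z σ v (f v) *
      arcW q z⁻¹ σ u v) * H σ := Finset.sum_congr rfl fun σ _ => e1 σ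
  have p2 : pairing q z h.surgery g = ∑ σ, (arcW q z σ u v * arcW q z⁻¹ σ u v) *
      (arcW q z σ (f u) (f v) * H σ) := Finset.sum_congr rfl fun σ _ => e2 σ
  rw [← p1] at s1
  rw [← p2] at s2
  have h4 : (4 : K) ≠ 0 := by norm_num
  apply mul_left_cancel₀ h4
  rw [s2, mul_left_comm 4, s1]
  field_simp

end Cut

/-- The pairing of two states counts the circles. -/
theorem pairing_eq [CharZero K] {q z : K} (hq : q ≠ 0) (hz : z ≠ 0) (hδ : q + q⁻¹ ≠ 0)
    (f g : PerNC n) : q ^ n * pairing q z f g =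
      (z + z⁻¹) ^ bk₀ (f.setoid ⊔ g.setoid) * (q + q⁻¹) ^ nzbk (f.setoid ⊔ g.setoid) := by
  refine surgery_induction (P := fun f g : PerNC n => q ^ n * pairing q z f g =
      (z + z⁻¹) ^ bk₀ (f.setoid ⊔ g.setoid) * (q + q⁻¹) ^ nzbk (f.setoid ⊔ g.setoid)) ?_ ?_ f g
  · intro f
    rw [pairing_self hz, sup_idem, f.bk₀_setoid, f.nzbk_setoid, pow_zero, one_mul, ← mul_pow]
    congr 1
    field_simp
  · intro f g u v h hg hagree ih
    have hgv : g v = u := by rw [← hg, g.inv]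
    have hlt := h.lt
    have hgarc : g.setoid ≤ arc n u v := g.setoid_le_arc fun x h1 h2 => by
      rcases eq_or_lt_of_le h1 with rfl | h1
      · omega
      rcases eq_or_lt_of_le h2 with rfl | h2
      · omega
      have := h.closed x h1 h2
      rw [hagree x h1 h2] at this
      omega
    have hguv : g.setoid (pt _ u) (pt _ v) := by
      have := g.setoid_self u
      rwa [hg] at this
    obtain ⟨c1, c2⟩ := h.counts_surgery_sup g.oppInvariant_setoid hgarc
      ((le_sup_right : g.setoid ≤ f.setoid ⊔ g.setoid) hguv)
    rw [c2] at ih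
    apply mul_left_cancel₀ hδ
    split_ifs at c1 with hs
    · have := h.pairing_surgery_special hg hq hz hs
      rw [c1]
      linear_combination (z + z⁻¹) * ih - q ^ n * this
    · have := h.pairing_surgery hg hq hz hs
      rw [c1, add_zero]
      linear_combination ih - q ^ n * this

end PerNC

end TypeB

namespace TypeB

section Links

variable {M : ℕ}

/-- A non-crossing partial pairing of the points of a line, none of whose unpaired points lies below
an arc; the unpaired points are the fixed points. -/
structure IsLink (g : Fin M → Fin M) : Prop where
  inv : ∀ x, g (g x) = x
  nc : ∀ i j, i < j → j < g i → i < g j ∧ g j < g i ∧ g j ≠ j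

/-- A word of spins that is `+` at the left and `-` at the right end of each arc. -/
structure IsSpin (g : Fin M → Fin M) (ε : Fin M → Bool) : Prop extends IsLink g where
  arc : ∀ i, i < g i → ε i = true ∧ ε (g i) = false

/-- Among the unpaired points, the spins `-` come first. -/
def IsSorted (g : Fin M → Fin M) (ε : Fin M → Bool) : Prop :=
  ∀ a b, a < b → g a = a → g b = b → ε a = true → ε b = true

/-- The unpaired points. -/
def defects (g : Fin M → Fin M) : Finset (Fin M) := Finset.univ.filter fun x => g x = x

/-- The points of spin `+`. -/
def plus (ε : Fin M → Bool) : Finset (Fin M) := Finset.univ.filter fun x => ε x = true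

/-- The number of unpaired points before a point. -/
def rank (g : Fin M → Fin M) (x : Fin M) : ℕ := ((defects g).filter fun d => d < x).card

@[simp] theorem mem_defects {g : Fin M → Fin M} {x : Fin M} : x ∈ defects g ↔ g x = x := by
  simp [defects]

@[simp] theorem mem_plus {ε : Fin M → Bool} {x : Fin M} : x ∈ plus ε ↔ ε x = true := by
  simp [plus]

variable {g g' : Fin M → Fin M} {ε ε' : Fin M → Bool}

theorem IsLink.nc' (h : IsLink g) {i j : Fin M} (h1 : g i < j) (h2 : j < i) :
    g i < g j ∧ g j < i ∧ g j ≠ j := by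
  have := h.nc (g i) j h1 (by rwa [h.inv])
  rwa [h.inv] at this

theorem IsSpin.opener (h : IsSpin g ε) {x : Fin M} (hx : ε x = true) (hg : g x ≠ x) : x < g x := by
  rcases lt_or_gt_of_ne hg with h1 | h1
  · have := (h.arc (g x) (by rwa [h.inv])).2
    rw [h.inv, hx] at this
    cases this
  · exact h1

theorem IsSpin.closer (h : IsSpin g ε) {x : Fin M} (hx : ε x = false) (hg : g x ≠ x) : g x < x := by
  rcases lt_or_gt_of_ne hg with h1 | h1
  · exact h1
  · rw [(h.arc x h1).1] at hx
    cases hx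

theorem IsSpin.eq_of_opener (h : IsSpin g ε) (h' : IsSpin g' ε) (hs' : IsSorted g' ε) :
    ∀ (N : ℕ) (x : Fin M), x < g x → ((g x : ℕ) - x) ≤ N → g' x = g x := by
  intro N
  induction N with
  | zero => intro x hx hN; rw [Fin.lt_def] at hx; omega
  | succ N ih =>
    intro x hx hN
    obtain ⟨e1, e2⟩ := h.arc x hx
    have hin : ∀ y, x < y → y < g x → g' y = g y ∧ x < g y ∧ g y < g x := by
      intro y h1 h2
      obtain ⟨h3, h4, h5⟩ := h.nc x y h1 h2
      refine ⟨?_, h3, h4⟩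
      rcases lt_or_gt_of_ne h5 with h6 | h6
      · have := ih (g y) (by rwa [h.inv]) (by
          rw [h.inv]; rw [Fin.lt_def] at *; omega)
        rw [h.inv] at this
        rw [← this, h'.inv, this]
      · exact ih y h6 (by rw [Fin.lt_def] at *; omega)
    have hout : ∀ y, g' y = x ∨ g' y = g x → ¬ (x < y ∧ y < g x) := by
      rintro y hy ⟨h1, h2⟩
      obtain ⟨h3, h4, h5⟩ := hin y h1 h2
      rw [h3] at hy
      rcases hy with hy | hy
      · rw [hy] at h4; exact absurd h4 (lt_irrefl _)
      · rw [hy] at h5; exact absurd h5 (lt_irrefl _)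
    have hx' := hout (g' x) (Or.inl (h'.inv x))
    have hy' := hout (g' (g x)) (Or.inr (h'.inv _))
    by_cases hd : g' x = x
    · exfalso
      by_cases hd' : g' (g x) = g x
      · have := hs' x (g x) hx hd hd' e1
        rw [e2] at this; cases this
      · have h1 := h'.closer e2 hd'
        rcases lt_trichotomy (g' (g x)) x with h2 | h2 | h2
        · exact (h'.nc' h2 hx).2.2 hd
        · have := congrArg g' h2
          rw [h'.inv, hd] at this
          exact hx.ne this.symm
        · exact hy' ⟨h2, h1⟩
    · have h1 := h'.opener e1 hd
      rcases lt_trichotomy (g' x) (g x) with h2 | h2 | h2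
      · exact absurd ⟨h1, h2⟩ hx'
      · exact h2
      · obtain ⟨h3, h4, h5⟩ := h'.nc x (g x) hx h2
        exact absurd ⟨h3, h'.closer e2 h5⟩ hy'

theorem IsSpin.eq_of_not_defect (h : IsSpin g ε) (h' : IsSpin g' ε) (hs' : IsSorted g' ε)
    {x : Fin M} (hx : g x ≠ x) : g' x = g x := by
  rcases lt_or_gt_of_ne hx with h1 | h1
  · have := h.eq_of_opener h' hs' _ (g x) (by rwa [h.inv]) le_rfl
    rw [h.inv] at this
    rw [← this, h'.inv, this]
  · exact h.eq_of_opener h' hs' _ x h1 le_rfl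

/-- A sorted word determines the pairing. -/
theorem IsSpin.link_unique (h : IsSpin g ε) (hs : IsSorted g ε) (h' : IsSpin g' ε)
    (hs' : IsSorted g' ε) : g = g' := by
  funext x
  by_cases hx : g x = x
  · by_cases hx' : g' x = x
    · rw [hx, hx']
    · exact h'.eq_of_not_defect h hs hx'
  · exact (h.eq_of_not_defect h' hs' hx).symm

theorem IsSpin.card_plus (h : IsSpin g ε) :
    2 * (plus ε).card + (defects g).card = M + 2 * (plus ε ∩ defects g).card := by
  set A := Finset.univ.filter fun x => x < g x with hA
  set B := Finset.univ.filter fun x => g x < x with hB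
  have hAB : A.card = B.card := by
    apply Finset.card_bij' (fun x _ => g x) (fun x _ => g x)
    all_goals simp [hA, hB, h.inv]
  have h1 : A.card + (plus ε ∩ defects g).card = (plus ε).card := by
    rw [← Finset.card_union_of_disjoint]
    · congr 1
      ext x
      simp only [hA, Finset.mem_union, Finset.mem_filter, Finset.mem_univ, true_and,
        Finset.mem_inter, mem_plus, mem_defects]
      constructor
      · rintro (h1 | h1)
        · exact (h.arc x h1).1
        · exact h1.1
      · intro hx
        by_cases hd : g x = x
        · exact Or.inr ⟨hx, hd⟩
        · exact Or.inl (h.opener hx hd)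
    · rw [Finset.disjoint_left]
      intro x hx hx'
      simp only [hA, Finset.mem_filter, Finset.mem_inter, mem_defects] at hx hx'
      exact hx.2.ne hx'.2.symm
  have h2 : A.card + B.card + (defects g).card = M := by
    rw [← Finset.card_union_of_disjoint, ← Finset.card_union_of_disjoint]
    · conv_rhs => rw [← Fintype.card_fin M, ← Finset.card_univ]
      congr 1
      ext x
      simp only [hA, hB, Finset.mem_union, Finset.mem_filter, Finset.mem_univ, true_and,
        mem_defects, iff_true]
      rcases lt_trichotomy x (g x) with h1 | h1 | h1
      · exact Or.inl (Or.inl h1)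
      · exact Or.inr h1.symm
      · exact Or.inl (Or.inr h1)
    · rw [Finset.disjoint_left]
      intro x hx hx'
      simp only [hA, hB, Finset.mem_filter, Finset.mem_univ, true_and, Finset.mem_union,
        mem_defects] at hx hx'
      rw [hx'] at hx
      simp at hx
    · rw [Finset.disjoint_left]
      intro x hx hx'
      simp only [hA, hB, Finset.mem_filter, Finset.mem_univ, true_and] at hx hx'
      exact lt_asymm hx hx'
  omega

theorem IsSpin.eq_of_not_mem (h : IsSpin g ε) (h' : IsSpin g ε') {x : Fin M} (hx : g x ≠ x) :
    ε x = ε' x := by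
  rcases lt_or_gt_of_ne hx with h1 | h1
  · have a1 := (h.arc (g x) (by rwa [h.inv])).2
    have a2 := (h'.arc (g x) (by rwa [h.inv])).2
    rw [h.inv] at a1 a2
    rw [a1, a2]
  · rw [(h.arc x h1).1, (h'.arc x h1).1]

/-- The pairing and the number of spins `+` determine the sorted word. -/
theorem IsSpin.spin_unique (h : IsSpin g ε) (hs : IsSorted g ε) (h' : IsSpin g ε')
    (hs' : IsSorted g ε') (hc : (plus ε).card = (plus ε').card) : ε = ε' := by
  have c1 := h.card_plus
  have c2 := h'.card_plus
  have hc' : (plus ε ∩ defects g).card = (plus ε' ∩ defects g).card := by omega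
  have key : plus ε ∩ defects g = plus ε' ∩ defects g := by
    by_cases hsub : plus ε ∩ defects g ⊆ plus ε' ∩ defects g
    · exact Finset.eq_of_subset_of_card_le hsub hc'.ge
    · symm
      apply Finset.eq_of_subset_of_card_le _ hc'.le
      obtain ⟨a, ha, ha'⟩ := Finset.not_subset.1 hsub
      simp only [Finset.mem_inter, mem_plus, mem_defects] at ha ha'
      intro b hb
      simp only [Finset.mem_inter, mem_plus, mem_defects] at hb ⊢
      refine ⟨?_, hb.2⟩
      rcases lt_trichotomy a b with h1 | h1 | h1
      · exact hs a b h1 ha.2 hb.2 ha.1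
      · rw [← h1]; exact ha.1
      · exact absurd ⟨hs' b a h1 hb.2 ha.2 hb.1, ha.2⟩ ha'
  funext x
  by_cases hx : g x = x
  · have := Finset.ext_iff.1 key x
    simp only [Finset.mem_inter, mem_plus, mem_defects, hx, and_true] at this
    exact Bool.eq_iff_iff.2 this
  · exact h.eq_of_not_mem h' hx

/-- Join two unpaired points by an arc. -/
def addArc (g : Fin M → Fin M) (a b : Fin M) (x : Fin M) : Fin M :=
  if x = a then b else if x = b then a else g x

/-- Two consecutive unpaired points with spins `+`, `-`. -/
structure IsDescent (g : Fin M → Fin M) (ε : Fin M → Bool) (a b : Fin M) : Prop where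
  lt : a < b
  left : g a = a
  right : g b = b
  plus : ε a = true
  minus : ε b = false
  between : ∀ d, a < d → d < b → g d ≠ d

theorem exists_isDescent (h : ¬ IsSorted g ε) : ∃ a b, IsDescent g ε a b := by
  have hex : ∃ N : ℕ, ∃ a b : Fin M, (b : ℕ) - a = N ∧ a < b ∧ g a = a ∧ g b = b ∧ ε a = true ∧
      ε b = false := by
    simp only [IsSorted, not_forall, Bool.not_eq_true] at h
    obtain ⟨a, b, h1, h2, h3, h4, h5⟩ := h
    exact ⟨_, a, b, rfl, h1, h2, h3, h4, h5⟩
  classical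
  obtain ⟨a, b, h0, h1, h2, h3, h4, h5⟩ := Nat.find_spec hex
  refine ⟨a, b, h1, h2, h3, h4, h5, fun d hd hd' hdd => ?_⟩
  rw [Fin.lt_def] at hd hd'
  cases hε : ε d
  · exact Nat.find_min hex (m := (d : ℕ) - a) (by omega) ⟨a, d, rfl, hd, h2, hdd, h4, hε⟩
  · exact Nat.find_min hex (m := (b : ℕ) - d) (by omega) ⟨d, b, rfl, hd', hdd, h3, hε, h5⟩

namespace IsDescent

variable {a b : Fin M}

theorem addArc_left (_d : IsDescent g ε a b) : addArc g a b a = b := if_pos rfl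

theorem addArc_right (d : IsDescent g ε a b) : addArc g a b b = a := by
  rw [addArc, if_neg d.lt.ne', if_pos rfl]

theorem addArc_of_ne {x : Fin M} (h1 : x ≠ a) (h2 : x ≠ b) : addArc g a b x = g x := by
  rw [addArc, if_neg h1, if_neg h2]

theorem isSpin (d : IsDescent g ε a b) (h : IsSpin g ε) : IsSpin (addArc g a b) ε := by
  have hne : ∀ c x, g c = c → x ≠ c → g x ≠ c := fun c x hc hx hg => hx (by
    rw [← h.inv x, hg, hc])
  have hab := d.lt
  refine ⟨⟨fun x => ?_, fun i j hij hj => ?_⟩, fun i hi => ?_⟩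
  · by_cases h1 : x = a
    · rw [h1, d.addArc_left, d.addArc_right]
    · by_cases h2 : x = b
      · rw [h2, d.addArc_right, d.addArc_left]
      · rw [addArc_of_ne h1 h2, addArc_of_ne (hne a x d.left h1) (hne b x d.right h2), h.inv]
  · by_cases h1 : i = a
    · subst h1
      rw [d.addArc_left] at hj ⊢
      have hja := hij.ne'
      have hjb := hj.ne
      have hjd := d.between j hij hj
      rw [addArc_of_ne hja hjb]
      refine ⟨?_, ?_, hjd⟩
      · rcases lt_trichotomy (g j) i with h2 | h2 | h2
        · exact absurd d.left (h.nc' h2 hij).2.2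
        · exact absurd h2 (hne _ _ d.left hja)
        · exact h2
      · rcases lt_trichotomy (g j) b with h2 | h2 | h2
        · exact h2
        · exact absurd h2 (hne _ _ d.right hjb)
        · exact absurd d.right (h.nc j b hj h2).2.2
    · by_cases h2 : i = b
      · subst h2
        rw [d.addArc_right] at hj
        exact absurd (hij.trans hj) hab.asymm
      · rw [addArc_of_ne h1 h2] at hj ⊢
        have := h.nc i j hij hj
        have hja : j ≠ a := by rintro rfl; exact this.2.2 d.left
        have hjb : j ≠ b := by rintro rfl; exact this.2.2 d.right
        rwa [addArc_of_ne hja hjb]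
  · by_cases h1 : i = a
    · subst h1
      rw [d.addArc_left]
      exact ⟨d.plus, d.minus⟩
    · by_cases h2 : i = b
      · subst h2
        rw [d.addArc_right] at hi
        exact absurd hi hab.asymm
      · rw [addArc_of_ne h1 h2] at hi ⊢
        exact h.arc i hi

theorem defects_ssubset (d : IsDescent g ε a b) : defects (addArc g a b) ⊂ defects g := by
  rw [Finset.ssubset_iff_of_subset]
  · refine ⟨a, mem_defects.2 d.left, ?_⟩
    rw [mem_defects, d.addArc_left]
    exact d.lt.ne'
  · intro x hx
    rw [mem_defects] at hx ⊢
    by_cases h1 : x = a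
    · rw [h1]; exact d.left
    · by_cases h2 : x = b
      · rw [h2]; exact d.right
      · rwa [addArc_of_ne h1 h2] at hx

theorem card_defects_lt (d : IsDescent g ε a b) :
    (defects (addArc g a b)).card < (defects g).card := Finset.card_lt_card d.defects_ssubset

theorem isSpin_swap (d : IsDescent g ε a b) (h : IsSpin g ε) :
    IsSpin g (ε ∘ Equiv.swap a b) := by
  refine ⟨h.toIsLink, fun i hi => ?_⟩
  have hia : i ≠ a := by rintro rfl; rw [d.left] at hi; exact lt_irrefl _ hi
  have hib : i ≠ b := by rintro rfl; rw [d.right] at hi; exact lt_irrefl _ hi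
  have hga : g i ≠ a := fun hh => hia (by rw [← h.inv i, hh, d.left])
  have hgb : g i ≠ b := fun hh => hib (by rw [← h.inv i, hh, d.right])
  simp only [Function.comp, Equiv.swap_apply_of_ne_of_ne hia hib,
    Equiv.swap_apply_of_ne_of_ne hga hgb]
  exact h.arc i hi

theorem rank_right (d : IsDescent g ε a b) : rank g b = rank g a + 1 := by
  rw [rank, rank, ← Finset.card_insert_of_notMem (a := a) (by simp)]
  congr 1
  ext x
  simp only [Finset.mem_filter, mem_defects, Finset.mem_insert]
  constructor
  · rintro ⟨h1, h2⟩
    rcases lt_trichotomy x a with h3 | h3 | h3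
    · exact Or.inr ⟨h1, h3⟩
    · exact Or.inl h3
    · exact absurd h1 (d.between x h3 h2)
  · rintro (rfl | ⟨h1, h2⟩)
    · exact ⟨d.left, d.lt⟩
    · exact ⟨h1, h2.trans d.lt⟩

end IsDescent

theorem card_plus_comp (ε : Fin M → Bool) (e : Fin M ≃ Fin M) :
    (plus (ε ∘ e)).card = (plus ε).card := by
  apply Finset.card_bij' (fun x _ => e x) (fun x _ => e.symm x)
  all_goals simp

/-- Every word is the sorted word of a pairing. -/
theorem exists_isSorted (ε : Fin M → Bool) : ∃ g : Fin M → Fin M, IsSpin g ε ∧ IsSorted g ε := by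
  have key : ∀ (N : ℕ) (g : Fin M → Fin M), IsSpin g ε → (defects g).card ≤ N →
      ∃ g : Fin M → Fin M, IsSpin g ε ∧ IsSorted g ε := by
    intro N
    induction N with
    | zero =>
      intro g hg hN
      refine ⟨g, hg, fun a b _ ha => ?_⟩
      have : a ∈ defects g := mem_defects.2 ha
      rw [Finset.card_eq_zero.1 (Nat.le_zero.1 hN)] at this
      simp at this
    | succ N ih =>
      intro g hg hN
      by_cases hs : IsSorted g ε
      · exact ⟨g, hg, hs⟩
      · obtain ⟨a, b, d⟩ := exists_isDescent hs
        exact ih _ (d.isSpin hg) (by have := d.card_defects_lt; omega)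
  refine key _ id ⟨⟨fun x => rfl, fun i j h1 h2 => ?_⟩, fun i hi => ?_⟩ le_rfl
  · exact absurd h1 h2.asymm
  · exact absurd hi (lt_irrefl _)

/-- The values of the rank on a set of points. -/
theorem prod_rank {R : Type*} [CommMonoid R] {ι : Type*} [LinearOrder ι] (s : Finset ι)
    (F : ℕ → R) : ∏ x ∈ s, F (s.filter fun d => d < x).card = ∏ r ∈ Finset.range s.card, F r := by
  induction s using Finset.induction_on_max with
  | empty => simp
  | insert a s ha ih =>
    have hna : a ∉ s := fun h => lt_irrefl _ (ha a h)
    rw [Finset.prod_insert hna, Finset.card_insert_of_notMem hna, Finset.prod_range_succ, mul_comm,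
      ← ih]
    congr 1
    · refine Finset.prod_congr rfl fun x hx => ?_
      rw [Finset.filter_insert, if_neg (ha x hx).asymm]
    · rw [Finset.filter_insert, if_neg (lt_irrefl _), Finset.filter_true_of_mem ha]

/-- The sorted word with `j` unpaired points of spin `+`. -/
def sortedSpin (g : Fin M → Fin M) (j : ℕ) (x : Fin M) : Bool :=
  if g x = x then decide ((defects g).card ≤ rank g x + j) else decide (x < g x)

theorem rank_mono (g : Fin M → Fin M) {x y : Fin M} (h : x ≤ y) : rank g x ≤ rank g y := by
  apply Finset.card_le_card
  intro d hd
  rw [Finset.mem_filter] at hd ⊢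
  exact ⟨hd.1, hd.2.trans_le h⟩

theorem IsLink.isSpin_sortedSpin (h : IsLink g) (j : ℕ) : IsSpin g (sortedSpin g j) := by
  refine ⟨h, fun i hi => ?_⟩
  have : g (g i) ≠ g i := by rw [h.inv]; exact hi.ne
  rw [sortedSpin, if_neg hi.ne', sortedSpin, if_neg this, h.inv]
  simp [hi, hi.le]

theorem isSorted_sortedSpin (g : Fin M → Fin M) (j : ℕ) : IsSorted g (sortedSpin g j) := by
  intro a b hab ha hb hs
  rw [sortedSpin, if_pos ha, decide_eq_true_eq] at hs
  rw [sortedSpin, if_pos hb, decide_eq_true_eq]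
  exact hs.trans (Nat.add_le_add_right (rank_mono g hab.le) j)

theorem card_plus_sortedSpin (g : Fin M → Fin M) {j : ℕ} (hj : j ≤ (defects g).card) :
    (plus (sortedSpin g j) ∩ defects g).card = j := by
  have h1 : plus (sortedSpin g j) ∩ defects g =
      (defects g).filter fun x => (defects g).card ≤ rank g x + j := by
    ext x
    simp only [Finset.mem_inter, mem_plus, mem_defects, Finset.mem_filter, sortedSpin]
    constructor
    · rintro ⟨h1, h2⟩
      rw [if_pos h2, decide_eq_true_eq] at h1
      exact ⟨h2, h1⟩
    · rintro ⟨h1, h2⟩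
      rw [if_pos h1, decide_eq_true_eq]
      exact ⟨h2, h1⟩
  have h2 := prod_rank (R := Multiplicative ℕ) (defects g) fun r =>
    Multiplicative.ofAdd (if (defects g).card ≤ r + j then 1 else 0)
  have h3 := congrArg Multiplicative.toAdd h2
  rw [toAdd_prod, toAdd_prod] at h3
  simp only [toAdd_ofAdd] at h3
  rw [h1, Finset.card_filter]
  refine Eq.trans h3 ?_
  rw [← Finset.card_filter]
  have h4 : (Finset.range (defects g).card).filter (fun r => (defects g).card ≤ r + j) =
      Finset.Ico ((defects g).card - j) (defects g).card := by
    ext r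
    simp only [Finset.mem_filter, Finset.mem_range, Finset.mem_Ico]
    omega
  rw [h4, Nat.card_Ico]
  omega

end Links

end TypeB

namespace TypeB

section LinkVectors

variable {K : Type*} [Field K] {M : ℕ} {g : Fin M → Fin M} {ε ε' : Fin M → Bool}

/-- The left ends of the arcs. -/
def openers (g : Fin M → Fin M) : Finset (Fin M) := Finset.univ.filter fun x => x < g x

@[simp] theorem mem_openers {x : Fin M} : x ∈ openers g ↔ x < g x := by simp [openers]

/-- The weights of the states of a partial pairing with given spins at its unpaired points. -/
def linkVec (q : K) (g : Fin M → Fin M) (ε : Fin M → Bool) (σ : Fin M → Bool) : K :=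
  (∏ x ∈ openers g, wt q 1 (σ x) (σ (g x)) 0) * ∏ x ∈ defects g, if σ x = ε x then 1 else 0

/-- The sum of the ranks of the unpaired points of spin `+`. -/
def rankSum (g : Fin M → Fin M) (ε : Fin M → Bool) : ℕ :=
  ∑ x ∈ defects g, if ε x = true then rank g x else 0

namespace IsDescent

variable {a b : Fin M}

theorem mem_erase (d : IsDescent g ε a b) : b ∈ (defects g).erase a :=
  Finset.mem_erase.2 ⟨d.lt.ne', mem_defects.2 d.right⟩

theorem defects_addArc (d : IsDescent g ε a b) :
    defects (addArc g a b) = ((defects g).erase a).erase b := by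
  ext x
  rw [mem_defects, Finset.mem_erase, Finset.mem_erase, mem_defects]
  by_cases h1 : x = a
  · subst h1
    rw [d.addArc_left]
    simp [d.lt.ne']
  · by_cases h2 : x = b
    · subst h2
      rw [d.addArc_right]
      simp [d.lt.ne]
    · rw [addArc_of_ne h1 h2]
      simp [h1, h2]

theorem openers_addArc (d : IsDescent g ε a b) : openers (addArc g a b) = insert a (openers g) := by
  ext x
  rw [mem_openers, Finset.mem_insert, mem_openers]
  by_cases h1 : x = a
  · subst h1
    rw [d.addArc_left]
    simp [d.lt]
  · by_cases h2 : x = b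
    · subst h2
      rw [d.addArc_right, d.right]
      simp [d.lt.ne', d.lt.le]
    · rw [addArc_of_ne h1 h2]
      simp [h1]

theorem linkVec_eq (d : IsDescent g ε a b) (q : K) :
    linkVec q g ε = linkVec q (addArc g a b) ε + (-q⁻¹) • linkVec q g (ε ∘ Equiv.swap a b) := by
  funext σ
  have hna : a ∉ openers g := by rw [mem_openers, d.left]; exact lt_irrefl _
  have hR : ∏ x ∈ openers g, wt q 1 (σ x) (σ (addArc g a b x)) 0 =
      ∏ x ∈ openers g, wt q 1 (σ x) (σ (g x)) 0 := by
    refine Finset.prod_congr rfl fun x hx => ?_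
    rw [mem_openers] at hx
    rw [addArc_of_ne]
    · rintro rfl; rw [d.left] at hx; exact lt_irrefl _ hx
    · rintro rfl; rw [d.right] at hx; exact lt_irrefl _ hx
  have hD : ∏ x ∈ ((defects g).erase a).erase b,
      (if σ x = (ε ∘ Equiv.swap a b) x then (1 : K) else 0) =
      ∏ x ∈ ((defects g).erase a).erase b, if σ x = ε x then (1 : K) else 0 := by
    refine Finset.prod_congr rfl fun x hx => ?_
    rw [Finset.mem_erase, Finset.mem_erase] at hx
    rw [Function.comp, Equiv.swap_apply_of_ne_of_ne hx.2.1 hx.1]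
  simp only [Pi.add_apply, Pi.smul_apply, smul_eq_mul, linkVec]
  rw [d.defects_addArc, d.openers_addArc, Finset.prod_insert hna, hR, d.addArc_left,
    ← Finset.mul_prod_erase (defects g) _ (mem_defects.2 d.left),
    ← Finset.mul_prod_erase (defects g) _ (mem_defects.2 d.left),
    ← Finset.mul_prod_erase _ _ d.mem_erase, ← Finset.mul_prod_erase _ _ d.mem_erase, hD]
  simp only [Function.comp, Equiv.swap_apply_left, Equiv.swap_apply_right, d.plus, d.minus]
  rcases hσ : σ a <;> rcases hσ' : σ b <;> simp [wt]
  ring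

theorem rankSum_swap (d : IsDescent g ε a b) :
    rankSum g (ε ∘ Equiv.swap a b) = rankSum g ε + 1 := by
  have hD : ∑ x ∈ ((defects g).erase a).erase b,
      (if (ε ∘ Equiv.swap a b) x = true then rank g x else 0) =
      ∑ x ∈ ((defects g).erase a).erase b, if ε x = true then rank g x else 0 := by
    refine Finset.sum_congr rfl fun x hx => ?_
    rw [Finset.mem_erase, Finset.mem_erase] at hx
    rw [Function.comp, Equiv.swap_apply_of_ne_of_ne hx.2.1 hx.1]
  rw [rankSum, rankSum, ← Finset.add_sum_erase (defects g) _ (mem_defects.2 d.left),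
    ← Finset.add_sum_erase (defects g) _ (mem_defects.2 d.left),
    ← Finset.add_sum_erase _ _ d.mem_erase, ← Finset.add_sum_erase _ _ d.mem_erase, hD]
  simp only [Function.comp, Equiv.swap_apply_left, Equiv.swap_apply_right, d.plus, d.minus,
    d.rank_right]
  simp
  ring

end IsDescent

theorem rankSum_le (g : Fin M → Fin M) (ε : Fin M → Bool) :
    rankSum g ε ≤ ∑ x ∈ defects g, rank g x :=
  Finset.sum_le_sum fun x _ => by split_ifs <;> omega

/-- The span of the vectors of the partial pairings with fewer than `k` unpaired points. -/
def lowSpan (q : K) (M N k : ℕ) : Submodule K ((Fin M → Bool) → K) :=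
  Submodule.span K {v | ∃ g ε, IsSpin g ε ∧ (plus ε).card = N ∧ (defects g).card < k ∧
    v = linkVec q g ε}

theorem IsSpin.exists_sorted (h : IsSpin g ε) (q : K) :
    ∃ ε', IsSpin g ε' ∧ IsSorted g ε' ∧ (plus ε').card = (plus ε).card ∧
      (-q⁻¹) ^ rankSum g ε • linkVec q g ε - (-q⁻¹) ^ rankSum g ε' • linkVec q g ε' ∈
        lowSpan q M (plus ε).card (defects g).card := by
  obtain ⟨N, hN⟩ : ∃ N, ∑ x ∈ defects g, rank g x - rankSum g ε = N := ⟨_, rfl⟩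
  induction N using Nat.strong_induction_on generalizing ε with
  | _ N ih =>
  by_cases hs : IsSorted g ε
  · exact ⟨ε, h, hs, rfl, by rw [sub_self]; exact Submodule.zero_mem _⟩
  · obtain ⟨a, b, d⟩ := exists_isDescent hs
    have hr := d.rankSum_swap
    have hle := rankSum_le g (ε ∘ Equiv.swap a b)
    have hc := card_plus_comp ε (Equiv.swap a b)
    obtain ⟨ε', h1, h2, h3, h4⟩ := ih _ (by omega) (d.isSpin_swap h) rfl
    rw [hc] at h3 h4
    refine ⟨ε', h1, h2, h3, ?_⟩
    have hv := d.linkVec_eq q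
    have : (-q⁻¹) ^ rankSum g ε • linkVec q g ε - (-q⁻¹) ^ rankSum g ε' • linkVec q g ε' =
        (-q⁻¹) ^ rankSum g ε • linkVec q (addArc g a b) ε +
        ((-q⁻¹) ^ rankSum g (ε ∘ Equiv.swap a b) • linkVec q g (ε ∘ Equiv.swap a b) -
          (-q⁻¹) ^ rankSum g ε' • linkVec q g ε') := by
      rw [hr, pow_succ, mul_smul]
      nth_rw 1 [hv]
      rw [smul_add]
      abel
    rw [this]
    exact Submodule.add_mem _ (Submodule.smul_mem _ _ (Submodule.subset_span
      ⟨_, _, d.isSpin h, rfl, d.card_defects_lt, rfl⟩)) h4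

/-- Up to a power of `-q⁻¹` and lower terms, the spins at the unpaired points may be sorted. -/
theorem IsSpin.sub_mem_lowSpan (h : IsSpin g ε) (h' : IsSpin g ε') (hs : IsSorted g ε')
    (hc : (plus ε').card = (plus ε).card) (q : K) :
    (-q⁻¹) ^ rankSum g ε • linkVec q g ε - (-q⁻¹) ^ rankSum g ε' • linkVec q g ε' ∈
        lowSpan q M (plus ε).card (defects g).card := by
  obtain ⟨ε'', h1, h2, h3, h4⟩ := h.exists_sorted q
  rwa [h1.spin_unique h2 h' hs (h3.trans hc.symm)] at h4

theorem lowSpan_mono (q : K) (N : ℕ) {k l : ℕ} (h : k ≤ l) : lowSpan q M N k ≤ lowSpan q M N l :=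
  Submodule.span_mono fun _ ⟨g, ε, h1, h2, h3, h4⟩ => ⟨g, ε, h1, h2, h3.trans_le h, h4⟩

theorem lowSpan_le {q : K} (hq : q ≠ 0) (N k : ℕ) :
    lowSpan q M N k ≤ Submodule.span K {v | ∃ g ε, IsSpin g ε ∧ IsSorted g ε ∧
      (plus ε).card = N ∧ (defects g).card < k ∧ v = linkVec q g ε} := by
  induction k with
  | zero =>
    rw [lowSpan, Submodule.span_le]
    rintro v ⟨g, ε, -, -, h, -⟩
    exact absurd h (Nat.not_lt_zero _)
  | succ k ih =>
    rw [lowSpan, Submodule.span_le]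
    rintro v ⟨g, ε, h1, h2, h3, rfl⟩
    obtain ⟨ε', h4, h5, h6, h7⟩ := h1.exists_sorted q
    have hlow := (lowSpan_mono q _ (Nat.lt_succ_iff.1 h3)) h7
    rw [h2] at hlow
    have hmono : Submodule.span K {v | ∃ g ε, IsSpin (M := M) g ε ∧ IsSorted g ε ∧
        (plus ε).card = N ∧ (defects g).card < k ∧ v = linkVec q g ε} ≤
        Submodule.span K {v | ∃ g ε, IsSpin g ε ∧ IsSorted g ε ∧
        (plus ε).card = N ∧ (defects g).card < k + 1 ∧ v = linkVec q g ε} :=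
      Submodule.span_mono fun _ ⟨g, ε, h1, h2, h3, h4, h5⟩ => ⟨g, ε, h1, h2, h3, by omega, h5⟩
    have h8 := hmono (ih hlow)
    have h9 := Submodule.add_mem _ h8 (Submodule.smul_mem _ ((-q⁻¹) ^ rankSum g ε')
      (Submodule.subset_span ⟨g, ε', h4, h5, h6.trans h2, h3, rfl⟩))
    rw [sub_add_cancel] at h9
    exact (Submodule.smul_mem_iff _ (pow_ne_zero _ (neg_ne_zero.2 (inv_ne_zero hq)))).1 h9

/-- A matrix that is triangular with respect to a statistic. -/
theorem det_of_stat {R ι : Type*} [CommRing R] [Fintype ι] [DecidableEq ι] (A : Matrix ι ι R)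
    (b : ι → ℕ) (h : ∀ i j, A i j ≠ 0 → i = j ∨ b i < b j) : A.det = ∏ i, A i i := by
  rw [Matrix.det_apply, Finset.sum_eq_single (1 : Equiv.Perm ι)]
  · simp
  · intro τ _ hτ
    have hp : ∏ i, A (τ i) i = 0 := by
      by_contra hp
      have hne : ∀ i, τ i = i ∨ b (τ i) < b i := fun i =>
        h _ _ fun h0 => hp (Finset.prod_eq_zero (Finset.mem_univ i) h0)
      obtain ⟨i, hi⟩ : ∃ i, τ i ≠ i := by
        by_contra hall
        push Not at hall
        exact hτ (Equiv.ext hall)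
      have hlt : ∑ i, b (τ i) < ∑ i, b i :=
        Finset.sum_lt_sum (fun j _ => by
          rcases hne j with hj | hj
          · rw [hj]
          · exact hj.le) ⟨i, Finset.mem_univ _, (hne i).resolve_left hi⟩
      exact hlt.ne (Equiv.sum_comp τ b)
    rw [hp, smul_zero]
  · simp

end LinkVectors

end TypeB

namespace TypeB

namespace PerNC

variable {n : ℕ}

theorem val_lt (x : Fin (2 * n)) : ((x : ℕ) : ℤ) < 2 * n := by exact_mod_cast x.isLt

variable [NeZero n] (f : PerNC n)

/-- The partner of a point of the circle. -/
def partner (x : Fin (2 * n)) : Fin (2 * n) := pt _ (f ((x : ℕ) : ℤ))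

/-- The arcs that do not cross a fixed cut of the annulus. -/
def cut (x : Fin (2 * n)) : Fin (2 * n) :=
  if 0 ≤ f ((x : ℕ) : ℤ) ∧ f ((x : ℕ) : ℤ) < 2 * n then f.partner x else x

theorem val_pt_of {y : ℤ} (h : 0 ≤ y ∧ y < 2 * n) : ((pt (2 * n) y : ℕ) : ℤ) = y := by
  rw [val_pt]
  exact Int.emod_eq_of_lt h.1 (by push_cast; exact h.2)

theorem partner_partner (x : Fin (2 * n)) : f.partner (f.partner x) = x := by
  have := f.pt_two_f (pt_val (pt (2 * n) (f ((x : ℕ) : ℤ))))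
  rwa [f.inv, pt_val] at this

theorem word_partner (x : Fin (2 * n)) : f.word (f.partner x) = !f.word x := by
  rw [partner, word_pt, f.inv, word]
  have := f.ne ((x : ℕ) : ℤ)
  rw [← decide_not, decide_eq_decide]
  omega

theorem cut_of_mem {x : Fin (2 * n)} (h : 0 ≤ f ((x : ℕ) : ℤ) ∧ f ((x : ℕ) : ℤ) < 2 * n) :
    f.cut x = f.partner x ∧ ((f.cut x : ℕ) : ℤ) = f ((x : ℕ) : ℤ) := by
  rw [cut, if_pos h]
  exact ⟨rfl, val_pt_of h⟩

theorem cut_eq_iff {x : Fin (2 * n)} :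
    f.cut x = x ↔ ¬ (0 ≤ f ((x : ℕ) : ℤ) ∧ f ((x : ℕ) : ℤ) < 2 * n) := by
  constructor
  · intro h hx
    have := (f.cut_of_mem hx).2
    rw [h] at this
    exact f.ne _ this.symm
  · intro h
    rw [cut, if_neg h]

theorem val_cut {x : Fin (2 * n)} (h : f.cut x ≠ x) :
    ((f.cut x : ℕ) : ℤ) = f ((x : ℕ) : ℤ) ∧ f.cut x = f.partner x := by
  rw [Ne, cut_eq_iff, not_not] at h
  exact ⟨(f.cut_of_mem h).2, (f.cut_of_mem h).1⟩

theorem isSpin_cut : IsSpin f.cut f.word := by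
  refine ⟨⟨fun x => ?_, fun i j hij hj => ?_⟩, fun i hi => ?_⟩
  · by_cases hx : f.cut x = x
    · rw [hx, hx]
    · obtain ⟨h1, h2⟩ := f.val_cut hx
      have h3 : 0 ≤ f ((f.cut x : ℕ) : ℤ) ∧ f ((f.cut x : ℕ) : ℤ) < 2 * n := by
        rw [h1, f.inv]
        exact ⟨by omega, val_lt x⟩
      rw [(f.cut_of_mem h3).1, h2, f.partner_partner]
  · have hi : f.cut i ≠ i := (hij.trans hj).ne'
    obtain ⟨h1, -⟩ := f.val_cut hi
    have h2 : ((i : ℕ) : ℤ) < ((j : ℕ) : ℤ) := by exact_mod_cast hij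
    have h3 : ((j : ℕ) : ℤ) < f ((i : ℕ) : ℤ) := by rw [← h1]; exact_mod_cast hj
    obtain ⟨h4, h5⟩ := f.nc h2 h3
    have h6 := val_lt (f.cut i)
    have h7 : 0 ≤ f ((j : ℕ) : ℤ) ∧ f ((j : ℕ) : ℤ) < 2 * n := by omega
    obtain ⟨-, h8⟩ := f.cut_of_mem h7
    refine ⟨?_, ?_, fun h => f.cut_eq_iff.1 h h7⟩
    · rw [Fin.lt_def]; zify; omega
    · rw [Fin.lt_def]; zify; omega
  · obtain ⟨h1, h2⟩ := f.val_cut hi.ne'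
    have h3 : f.word i = true := by
      rw [word, decide_eq_true_eq, ← h1]
      exact_mod_cast hi
    rw [h2, word_partner, h3]
    simp

theorem isSorted_cut : IsSorted f.cut f.word := by
  intro a b hab ha hb hw
  rw [cut_eq_iff] at ha hb
  rw [word, decide_eq_true_eq] at hw ⊢
  have h1 := f.ne ((b : ℕ) : ℤ)
  have h2 := val_lt b
  have h3 : ((a : ℕ) : ℤ) < ((b : ℕ) : ℤ) := by exact_mod_cast hab
  by_contra h4
  have := f.nc h3 (by omega)
  omega

theorem card_plus_word : (plus f.word).card = n := f.card_word

theorem exists_cut {g : Fin (2 * n) → Fin (2 * n)} {ε : Fin (2 * n) → Bool} (h : IsSpin g ε)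
    (hs : IsSorted g ε) (hc : (plus ε).card = n) : ∃ f : PerNC n, f.cut = g ∧ f.word = ε := by
  obtain ⟨f, hf⟩ := exists_word ε hc
  refine ⟨f, ?_, hf⟩
  have h1 := f.isSpin_cut
  have h2 := f.isSorted_cut
  rw [hf] at h1 h2
  exact h1.link_unique h2 h hs

/-- The left ends of the arcs that cross the cut. -/
def wraps : Finset (Fin (2 * n)) := plus f.word ∩ defects f.cut

theorem mem_wraps {x : Fin (2 * n)} : x ∈ f.wraps ↔ 2 * (n : ℤ) ≤ f ((x : ℕ) : ℤ) := by
  have := val_lt x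
  have := f.ne ((x : ℕ) : ℤ)
  rw [wraps, Finset.mem_inter, mem_plus, mem_defects, cut_eq_iff, word, decide_eq_true_eq]
  omega

theorem card_defects : (defects f.cut).card = 2 * f.wraps.card := by
  have := f.isSpin_cut.card_plus
  rw [card_plus_word] at this
  rw [wraps]
  omega

theorem card_wraps_le : f.wraps.card ≤ n := by
  have := f.card_defects
  have h := Finset.card_le_univ (defects f.cut)
  rw [Fintype.card_fin] at h
  omega

theorem val_partner {x : Fin (2 * n)} (hx : x ∈ f.wraps) :
    ((f.partner x : ℕ) : ℤ) = f ((x : ℕ) : ℤ) - 2 * n := by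
  rw [mem_wraps] at hx
  have h1 := f.lt_add ((x : ℕ) : ℤ)
  have h2 := val_lt x
  rw [partner, val_pt, ← Int.sub_emod_right]
  push_cast
  exact Int.emod_eq_of_lt (by omega) (by omega)

theorem partner_mem {x : Fin (2 * n)} (hx : x ∈ f.wraps) :
    f.word (f.partner x) = false ∧ f.cut (f.partner x) = f.partner x := by
  have h := f.val_partner hx
  rw [mem_wraps] at hx
  have h2 := val_lt x
  have h3 : f ((f.partner x : ℕ) : ℤ) < 0 := by
    rw [h, f.per_sub, f.inv]
    omega
  constructor
  · rw [word, decide_eq_false_iff_not]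
    omega
  · rw [cut_eq_iff]
    omega

theorem partner_mem_wraps {x : Fin (2 * n)} (hx : f.cut x = x) (hw : f.word x = false) :
    f.partner x ∈ f.wraps := by
  rw [wraps, Finset.mem_inter, mem_plus, word_partner, hw, mem_defects]
  refine ⟨rfl, ?_⟩
  by_contra h
  have h1 := (f.val_cut h).2
  rw [partner_partner] at h1
  have h2 := congrArg f.cut h1
  rw [f.isSpin_cut.inv, hx] at h2
  rw [h2] at h
  exact h hx

@[to_additive]
theorem prod_defects {R : Type*} [CommMonoid R] (F : Fin (2 * n) → R) :
    ∏ x ∈ defects f.cut, F x = ∏ x ∈ f.wraps, F x * F (f.partner x) := by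
  have hinj : Set.InjOn f.partner f.wraps := fun x _ y _ h => by
    rw [← f.partner_partner x, h, f.partner_partner]
  have hd : defects f.cut = f.wraps ∪ f.wraps.image f.partner := by
    ext x
    rw [Finset.mem_union, Finset.mem_image, mem_defects]
    constructor
    · intro hx
      rcases hw : f.word x
      · exact Or.inr ⟨_, f.partner_mem_wraps hx hw, f.partner_partner x⟩
      · exact Or.inl (Finset.mem_inter.2 ⟨mem_plus.2 hw, mem_defects.2 hx⟩)
    · rintro (hx | ⟨y, hy, rfl⟩)
      · exact mem_defects.1 (Finset.mem_inter.1 hx).2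
      · exact (f.partner_mem hy).2
  rw [hd, Finset.prod_union, Finset.prod_image hinj, Finset.prod_mul_distrib]
  rw [Finset.disjoint_left]
  intro x hx hx'
  obtain ⟨y, hy, rfl⟩ := Finset.mem_image.1 hx'
  have := (f.partner_mem hy).1
  rw [mem_plus.1 (Finset.mem_inter.1 hx).1] at this
  cases this

theorem rank_partner {x : Fin (2 * n)} (hx : x ∈ f.wraps) :
    rank f.cut x = rank f.cut (f.partner x) + (2 * (f.wraps.filter fun d => d < x).card + 1) := by
  have h1 : ∀ y, rank f.cut y =
      ∑ d ∈ f.wraps, ((if d < y then 1 else 0) + if f.partner d < y then 1 else 0) := by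
    intro y
    rw [rank, Finset.card_filter, f.sum_defects]
  have h2 : 2 * (f.wraps.filter fun d => d < x).card + 1 =
      ∑ d ∈ f.wraps, ((if d < x then 2 else 0) + if d = x then 1 else 0) := by
    rw [Finset.sum_add_distrib, Finset.sum_ite_eq' f.wraps x, if_pos hx, Finset.card_filter,
      Finset.mul_sum]
    simp only [mul_ite, mul_one, mul_zero]
  rw [h1, h1, h2, ← Finset.sum_add_distrib]
  refine Finset.sum_congr rfl fun d hd => ?_
  have v1 := f.val_partner hx
  have v2 := f.val_partner hd
  have m1 := f.mem_wraps.1 hx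
  have m2 := f.mem_wraps.1 hd
  have b1 := val_lt x
  have b2 := val_lt d
  have b3 := f.lt_add ((x : ℕ) : ℤ)
  have b4 := f.lt_add ((d : ℕ) : ℤ)
  have o1 : f.partner x < x := by rw [Fin.lt_def]; zify; omega
  have o2 : f.partner d < d := by rw [Fin.lt_def]; zify; omega
  rcases lt_trichotomy d x with h | h | h
  · have h' : ((d : ℕ) : ℤ) < ((x : ℕ) : ℤ) := by exact_mod_cast h
    have := f.nc h' (by omega)
    have h3 : f.partner x < f.partner d := by rw [Fin.lt_def]; zify; omega
    simp [h, o2.trans h, (h3.trans o2).le, h3.le, h.ne]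
  · subst h
    simp [o1, o1.le]
  · have h' : ((x : ℕ) : ℤ) < ((d : ℕ) : ℤ) := by exact_mod_cast h
    have := f.nc h' (by omega)
    have h3 : f.partner d < f.partner x := by rw [Fin.lt_def]; zify; omega
    simp [h.asymm, h3.trans o1, h3, (o1.trans h).asymm, h.ne']

end PerNC

end TypeB

namespace TypeB

namespace PerNC

variable {n : ℕ} [NeZero n] (f : PerNC n) {K : Type*} [Field K]

theorem stateW_eq (q z : K) (σ : Fin (2 * n) → Bool) :
    stateW q z f σ = (∏ x ∈ openers f.cut, wt q 1 (σ x) (σ (f.cut x)) 0) *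
      ∏ x ∈ f.wraps, wt q z (σ x) (σ (f.partner x)) 1 := by
  have hn : (0 : ℤ) < 2 * n := by have := NeZero.pos n; omega
  have hu : plus f.word = openers f.cut ∪ f.wraps := by
    ext x
    rw [Finset.mem_union, mem_openers, wraps, Finset.mem_inter, mem_plus, mem_defects]
    constructor
    · intro h
      by_cases hd : f.cut x = x
      · exact Or.inr ⟨h, hd⟩
      · exact Or.inl (f.isSpin_cut.opener h hd)
    · rintro (h | h)
      · exact (f.isSpin_cut.arc x h).1
      · exact h.1
  have hdisj : Disjoint (openers f.cut) f.wraps := by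
    rw [Finset.disjoint_left]
    intro x h1 h2
    rw [mem_openers, mem_defects.1 (Finset.mem_inter.1 h2).2] at h1
    exact lt_irrefl _ h1
  have h0 : ∀ x : Fin (2 * n), ((x : ℕ) : ℤ) / (2 * n) = 0 := fun x =>
    Int.ediv_eq_zero_of_lt (by omega) (val_lt x)
  rw [stateW, ← Finset.prod_subset (Finset.subset_univ (plus f.word)), hu,
    Finset.prod_union hdisj]
  · congr 1
    · refine Finset.prod_congr rfl fun x hx => ?_
      rw [mem_openers] at hx
      obtain ⟨h1, h2⟩ := f.val_cut hx.ne'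
      have h3 : ((x : ℕ) : ℤ) < f ((x : ℕ) : ℤ) := by rw [← h1]; exact_mod_cast hx
      rw [ptW, if_pos h3, h0, ← h1, h0, pt_val, pt_val]
      simp [wt]
    · refine Finset.prod_congr rfl fun x hx => ?_
      rw [mem_wraps] at hx
      have h1 := val_lt x
      have h2 := f.lt_add ((x : ℕ) : ℤ)
      rw [ptW, if_pos (by omega), h0, pt_val, partner]
      congr 1
      rw [sub_zero]
      apply le_antisymm
      · exact Int.lt_add_one_iff.1 (Int.ediv_lt_of_lt_mul hn (by omega))
      · exact (Int.le_ediv_iff_mul_le hn).2 (by omega)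
  · intro x _ hx
    rw [mem_plus, word, decide_eq_true_eq] at hx
    rw [ptW, if_neg hx]

/-- The word of a pairing, with the spins reversed on some arcs that cross the cut. -/
def flip (S : Finset (Fin (2 * n))) (x : Fin (2 * n)) : Bool :=
  if x ∈ S ∨ f.partner x ∈ S then !f.word x else f.word x

theorem flip_empty : f.flip ∅ = f.word := by
  funext x
  simp [flip]

theorem flip_partner (S : Finset (Fin (2 * n))) (x : Fin (2 * n)) :
    f.flip S (f.partner x) = !f.flip S x := by
  simp only [flip, partner_partner, word_partner, or_comm (a := f.partner x ∈ S)]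
  split_ifs <;> rfl

theorem card_plus_of_partner {σ : Fin (2 * n) → Bool} (h : ∀ x, σ (f.partner x) = !σ x) :
    (plus σ).card = n := by
  have h1 : (plus σ).card = (Finset.univ.filter fun a => ¬ σ a = true).card := by
    refine Finset.card_nbij' f.partner f.partner
      ?_ ?_ (fun a _ => f.partner_partner a) (fun a _ => f.partner_partner a)
    all_goals
      intro a ha
      simp only [plus, Finset.coe_filter, Finset.mem_univ, true_and, Set.mem_ofPred_eq] at ha ⊢
      rw [h]
      simpa using ha
  have h2 := Finset.card_filter_add_card_filter_not (s := Finset.univ)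
    (fun a : Fin (2 * n) => σ a = true)
  rw [Finset.card_univ, Fintype.card_fin] at h2
  rw [plus] at *
  omega

theorem wraps_subset : f.wraps ⊆ defects f.cut := Finset.inter_subset_right

theorem isSpin_flip {S : Finset (Fin (2 * n))} (hS : S ⊆ f.wraps) : IsSpin f.cut (f.flip S) := by
  refine ⟨f.isSpin_cut.toIsLink, fun i hi => ?_⟩
  have key : ∀ x, f.cut x ≠ x → f.flip S x = f.word x := by
    intro x hx
    have hp := (f.val_cut hx).2
    rw [flip, if_neg]
    rintro (h | h)
    · exact hx (mem_defects.1 (f.wraps_subset (hS h)))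
    · have := mem_defects.1 (f.wraps_subset (hS h))
      rw [← hp, f.isSpin_cut.inv] at this
      exact hx this.symm
  rw [key i hi.ne', key _ (by rw [f.isSpin_cut.inv]; exact hi.ne)]
  exact f.isSpin_cut.arc i hi

theorem partner_notMem {S : Finset (Fin (2 * n))} (hS : S ⊆ f.wraps) {x : Fin (2 * n)}
    (hx : x ∈ f.wraps) : f.partner x ∉ S := fun h => by
  have h1 := mem_plus.1 (Finset.mem_inter.1 (hS h)).1
  rw [(f.partner_mem hx).1] at h1
  cases h1

theorem flip_wraps {S : Finset (Fin (2 * n))} (hS : S ⊆ f.wraps) {x : Fin (2 * n)}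
    (hx : x ∈ f.wraps) : f.flip S x = decide (x ∉ S) := by
  rw [flip, mem_plus.1 (Finset.mem_inter.1 hx).1]
  simp only [f.partner_notMem hS hx, or_false]
  by_cases h : x ∈ S <;> simp [h]

theorem linkVec_flip (q : K) {S : Finset (Fin (2 * n))} (hS : S ⊆ f.wraps)
    (σ : Fin (2 * n) → Bool) :
    linkVec q f.cut (f.flip S) σ = (∏ x ∈ openers f.cut, wt q 1 (σ x) (σ (f.cut x)) 0) *
      ((∏ x ∈ S, if σ x = false ∧ σ (f.partner x) = true then 1 else 0) *
        ∏ x ∈ f.wraps \ S, if σ x = true ∧ σ (f.partner x) = false then 1 else 0) := by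
  rw [linkVec, f.prod_defects, ← Finset.prod_sdiff hS, mul_comm (∏ x ∈ f.wraps \ S, _)]
  congr 2
  · refine Finset.prod_congr rfl fun x hx => ?_
    rw [flip_partner, f.flip_wraps hS (hS hx)]
    cases σ x <;> cases σ (f.partner x) <;> simp [hx]
  · refine Finset.prod_congr rfl fun x hx => ?_
    rw [Finset.mem_sdiff] at hx
    rw [flip_partner, f.flip_wraps hS hx.1]
    cases σ x <;> cases σ (f.partner x) <;> simp [hx.2]

theorem stateW_eq_sum (q z : K) :
    stateW q z f = ∑ S ∈ f.wraps.powerset, ((∏ _x ∈ S, q⁻¹ * z⁻¹) * ∏ _x ∈ f.wraps \ S, z) •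
      linkVec q f.cut (f.flip S) := by
  funext σ
  rw [Finset.sum_apply, stateW_eq]
  have h1 : ∀ x ∈ f.wraps, wt q z (σ x) (σ (f.partner x)) 1 =
      (q⁻¹ * z⁻¹) * (if σ x = false ∧ σ (f.partner x) = true then 1 else 0) +
      z * (if σ x = true ∧ σ (f.partner x) = false then 1 else 0) := by
    intro x _
    cases σ x <;> cases σ (f.partner x) <;> simp [wt]
  rw [Finset.prod_congr rfl h1, Finset.prod_add, Finset.mul_sum]
  refine Finset.sum_congr rfl fun S hS => ?_
  rw [Pi.smul_apply, smul_eq_mul, f.linkVec_flip q (Finset.mem_powerset.1 hS),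
    Finset.prod_mul_distrib (s := S), Finset.prod_mul_distrib (s := f.wraps \ S)]
  ring

theorem rankSum_flip {S : Finset (Fin (2 * n))} (hS : S ⊆ f.wraps) :
    rankSum f.cut f.word = rankSum f.cut (f.flip S) +
      ∑ x ∈ S, (2 * (f.wraps.filter fun d => d < x).card + 1) := by
  have h1 : ∀ T ⊆ f.wraps, rankSum f.cut (f.flip T) =
      ∑ x ∈ f.wraps, if x ∈ T then rank f.cut (f.partner x) else rank f.cut x := by
    intro T hT
    rw [rankSum, f.sum_defects]
    refine Finset.sum_congr rfl fun x hx => ?_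
    rw [flip_partner, f.flip_wraps hT hx]
    by_cases h : x ∈ T <;> simp [h]
  rw [← flip_empty, h1 ∅ (Finset.empty_subset _), h1 S hS, ← Finset.sum_sdiff hS,
    ← Finset.sum_sdiff hS (f := fun x => if x ∈ S then _ else _), add_assoc,
    ← Finset.sum_add_distrib]
  congr 1
  · refine Finset.sum_congr rfl fun x hx => ?_
    rw [if_neg (Finset.mem_sdiff.1 hx).2, if_neg (Finset.notMem_empty x)]
  · refine Finset.sum_congr rfl fun x hx => ?_
    rw [if_pos hx, if_neg (Finset.notMem_empty x), ← f.rank_partner (hS hx)]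

/-- The state vector of a pairing is, up to lower terms, a multiple of the vector of the pairing
cut open. -/
theorem stateW_sub_mem {q : K} (hq : q ≠ 0) (z : K) :
    stateW q z f - (∏ r ∈ Finset.range f.wraps.card, (q⁻¹ * z⁻¹ * (-q⁻¹) ^ (2 * r + 1) + z)) •
      linkVec q f.cut f.word ∈ lowSpan q (2 * n) n (2 * f.wraps.card) := by
  have hS : ∀ S ∈ f.wraps.powerset, linkVec q f.cut (f.flip S) -
      (∏ x ∈ S, (-q⁻¹) ^ (2 * (f.wraps.filter fun d => d < x).card + 1)) •
        linkVec q f.cut f.word ∈ lowSpan q (2 * n) n (2 * f.wraps.card) := by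
    intro S hS
    rw [Finset.mem_powerset] at hS
    have hc := f.card_plus_of_partner (f.flip_partner S)
    have h1 := (f.isSpin_flip hS).sub_mem_lowSpan f.isSpin_cut f.isSorted_cut
      (by rw [hc, card_plus_word]) q
    rw [f.rankSum_flip hS, hc, card_defects, pow_add, mul_smul, ← smul_sub,
      ← Finset.prod_pow_eq_pow_sum] at h1
    exact (Submodule.smul_mem_iff _ (pow_ne_zero _ (neg_ne_zero.2 (inv_ne_zero hq)))).1 h1
  rw [← prod_rank f.wraps fun r => q⁻¹ * z⁻¹ * (-q⁻¹) ^ (2 * r + 1) + z, Finset.prod_add,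
    Finset.sum_smul, stateW_eq_sum, ← Finset.sum_sub_distrib]
  refine Submodule.sum_mem _ fun S hS' => ?_
  have := Submodule.smul_mem _ ((∏ _x ∈ S, q⁻¹ * z⁻¹) * ∏ _x ∈ f.wraps \ S, z) (hS S hS')
  rw [smul_sub, ← mul_smul] at this
  convert this using 3
  rw [Finset.prod_mul_distrib]
  ring

theorem lowSpan_le_span {q : K} (hq : q ≠ 0) (k : ℕ) :
    lowSpan q (2 * n) n (2 * k) ≤ Submodule.span K
      ((fun f : PerNC n => linkVec q f.cut f.word) ''
        ((Finset.univ.filter fun f : PerNC n => f.wraps.card < k : Finset (PerNC n)) :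
          Set (PerNC n))) := by
  refine (lowSpan_le hq n (2 * k)).trans (Submodule.span_mono ?_)
  rintro v ⟨g, ε, h1, h2, h3, h4, rfl⟩
  obtain ⟨f, rfl, rfl⟩ := exists_cut h1 h2 h3
  refine ⟨f, ?_, rfl⟩
  rw [card_defects] at h4
  simp only [Finset.coe_filter, Finset.mem_univ, true_and, Set.mem_ofPred_eq]
  omega

/-- The matrix of the weights of the balanced states. -/
def stateMatrix (n : ℕ) [NeZero n] (q z : K) : Matrix (PerNC n) (PerNC n) K :=
  Matrix.of fun f h => stateW q z f h.word

/-- The matrix of the weights of the balanced states of the pairings cut open. -/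
def cutMatrix (n : ℕ) [NeZero n] (q : K) : Matrix (PerNC n) (PerNC n) K :=
  Matrix.of fun f h => linkVec q f.cut f.word h.word

theorem wt_self (q : K) : wt q 1 true false 0 = 1 := by simp [wt]

theorem linkVec_self (q : K) : linkVec q f.cut f.word f.word = 1 := by
  rw [linkVec, Finset.prod_eq_one, Finset.prod_eq_one, one_mul]
  · intro x _; rw [if_pos rfl]
  · intro x hx
    obtain ⟨h1, h2⟩ := f.isSpin_cut.arc x (mem_openers.1 hx)
    rw [h1, h2, wt_self]

theorem sum_univ_link {R : Type*} [AddCommMonoid R] {M : ℕ} {g : Fin M → Fin M} (hg : IsLink g)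
    (F : Fin M → R) : ∑ x, F x = ∑ x ∈ openers g, (F x + F (g x)) + ∑ x ∈ defects g, F x := by
  have hinj : Set.InjOn g (openers g) := fun x _ y _ h => by
    rw [← hg.inv x, h, hg.inv]
  have hu : Finset.univ = openers g ∪ (openers g).image g ∪ defects g := by
    ext x
    simp only [Finset.mem_univ, Finset.mem_union, mem_openers, Finset.mem_image, mem_defects,
      true_iff]
    rcases lt_trichotomy x (g x) with h | h | h
    · exact Or.inl (Or.inl h)
    · exact Or.inr h.symm
    · exact Or.inl (Or.inr ⟨g x, by rwa [hg.inv], hg.inv x⟩)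
  rw [hu, Finset.sum_union, Finset.sum_union, Finset.sum_image hinj, Finset.sum_add_distrib]
  · rw [Finset.disjoint_left]
    intro x h1 h2
    obtain ⟨y, hy, rfl⟩ := Finset.mem_image.1 h2
    rw [mem_openers] at h1 hy
    rw [hg.inv] at h1
    exact lt_asymm h1 hy
  · rw [Finset.disjoint_left]
    intro x h1 h2
    rw [mem_defects] at h2
    rcases Finset.mem_union.1 h1 with h1 | h1
    · rw [mem_openers, h2] at h1
      exact lt_irrefl _ h1
    · obtain ⟨y, hy, rfl⟩ := Finset.mem_image.1 h1
      rw [hg.inv] at h2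
      rw [mem_openers, ← h2] at hy
      exact lt_irrefl _ hy

theorem det_cutMatrix (q : K) : (cutMatrix n q).det = 1 := by
  rw [det_of_stat _ fun f : PerNC n => ∑ x : Fin (2 * n), if f.word x = true then (x : ℕ) else 0]
  · exact Finset.prod_eq_one fun f _ => f.linkVec_self q
  · intro f h hne
    rw [cutMatrix, Matrix.of_apply, linkVec] at hne
    have hd : ∀ x ∈ defects f.cut, h.word x = f.word x := by
      intro x hx
      by_contra hx'
      exact hne (mul_eq_zero_of_right _ (Finset.prod_eq_zero hx (if_neg hx')))
    have ho : ∀ x ∈ openers f.cut, h.word (f.cut x) = !h.word x := by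
      intro x hx
      by_contra hx'
      refine hne (mul_eq_zero_of_left (Finset.prod_eq_zero hx ?_) _)
      cases h1 : h.word x <;> cases h2 : h.word (f.cut x) <;> simp [wt, h1, h2] at hx' ⊢
    by_cases hall : ∀ x ∈ openers f.cut, h.word x = true
    · left
      apply word_injective
      funext x
      rcases lt_trichotomy x (f.cut x) with h1 | h1 | h1
      · rw [hall x (mem_openers.2 h1), (f.isSpin_cut.arc x h1).1]
      · exact (hd x (mem_defects.2 h1.symm)).symm
      · have h2 : f.cut x < f.cut (f.cut x) := by rwa [f.isSpin_cut.inv]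
        have h3 := (f.isSpin_cut.arc _ h2).2
        have h4 := ho _ (mem_openers.2 h2)
        rw [hall _ (mem_openers.2 h2)] at h4
        rw [f.isSpin_cut.inv] at h3 h4
        rw [h3, h4]
        rfl
    · right
      push Not at hall
      obtain ⟨y, hy, hy'⟩ := hall
      rw [sum_univ_link f.isSpin_cut.toIsLink, sum_univ_link f.isSpin_cut.toIsLink]
      refine add_lt_add_of_lt_of_le (Finset.sum_lt_sum (fun x hx => ?_) ⟨y, hy, ?_⟩)
        (Finset.sum_le_sum fun x hx => by rw [hd x hx])
      · have h1 := mem_openers.1 hx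
        obtain ⟨h2, h3⟩ := f.isSpin_cut.arc x h1
        rw [Fin.lt_def] at h1
        rw [ho x hx, h2, h3]
        cases h.word x <;> simp
        omega
      · have h1 := mem_openers.1 hy
        obtain ⟨h2, h3⟩ := f.isSpin_cut.arc y h1
        rw [Fin.lt_def] at h1
        rw [ho y hy, h2, h3, Bool.eq_false_iff.2 hy']
        simpa using h1

theorem det_stateMatrix {q : K} (hq : q ≠ 0) (z : K) :
    (stateMatrix n q z).det = ∏ f : PerNC n,
      ∏ r ∈ Finset.range f.wraps.card, (q⁻¹ * z⁻¹ * (-q⁻¹) ^ (2 * r + 1) + z) := by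
  have hex : ∀ f : PerNC n, ∃ c : PerNC n → K,
      ∑ h ∈ Finset.univ.filter (fun h : PerNC n => h.wraps.card < f.wraps.card),
        c h • linkVec q h.cut h.word = stateW q z f -
        (∏ r ∈ Finset.range f.wraps.card, (q⁻¹ * z⁻¹ * (-q⁻¹) ^ (2 * r + 1) + z)) •
      linkVec q f.cut f.word := fun f =>
    (Submodule.mem_span_image_finset_iff_exists_fun' K).1
      (lowSpan_le_span hq _ (f.stateW_sub_mem hq z))
  choose c hc using hex
  set lam : PerNC n → K := fun f =>
    ∏ r ∈ Finset.range f.wraps.card, (q⁻¹ * z⁻¹ * (-q⁻¹) ^ (2 * r + 1) + z) with hlam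
  set U : Matrix (PerNC n) (PerNC n) K := Matrix.of fun f h =>
    (if h.wraps.card < f.wraps.card then c f h else 0) + if f = h then lam f else 0 with hU
  have hmul : stateMatrix n q z = U * cutMatrix n q := by
    ext f h
    have := congrFun (hc f) h.word
    rw [Finset.sum_apply, Pi.sub_apply, eq_sub_iff_add_eq] at this
    simp only [stateMatrix, Matrix.of_apply, Matrix.mul_apply, hU, cutMatrix, add_mul,
      Finset.sum_add_distrib, ite_mul, zero_mul, Finset.sum_ite_eq, Finset.mem_univ, if_true]
    rw [← this, Finset.sum_filter]
    rfl
  rw [hmul, Matrix.det_mul, det_cutMatrix, mul_one, ← Matrix.det_transpose,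
    det_of_stat U.transpose fun f => f.wraps.card]
  · refine Finset.prod_congr rfl fun f _ => ?_
    simp [hU]
  · intro f h hne
    simp only [hU, Matrix.transpose_apply, Matrix.of_apply] at hne
    by_contra hcon
    push Not at hcon
    rw [if_neg (by omega), if_neg (Ne.symm hcon.1), add_zero] at hne
    exact hne rfl

end PerNC

end TypeB

namespace TypeB

namespace PerNC

variable {n : ℕ} [NeZero n] {K : Type*} [Field K]

theorem card_filter_wraps (i : ℕ) (hi : i ≤ n) :
    (Finset.univ.filter fun f : PerNC n => i ≤ f.wraps.card).card = (2 * n).choose (n - i) := by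
  have hs : ∀ f : PerNC n, IsSpin f.cut (sortedSpin f.cut (f.wraps.card + i)) := fun f =>
    f.isSpin_cut.toIsLink.isSpin_sortedSpin _
  have hc : ∀ f : PerNC n, i ≤ f.wraps.card →
      (plus (sortedSpin f.cut (f.wraps.card + i))).card = n + i := by
    intro f hf
    have h1 := (hs f).card_plus
    have h2 := f.card_defects
    rw [card_plus_sortedSpin _ (by omega)] at h1
    omega
  rw [← Nat.choose_symm_of_eq_add (show 2 * n = (n + i) + (n - i) by omega), ← card_balanced,
    ← Fintype.card_subtype]
  refine Fintype.card_of_bijective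
    (f := fun f => ⟨sortedSpin f.1.cut (f.1.wraps.card + i), hc f.1 f.2⟩) ⟨?_, ?_⟩
  · rintro ⟨f, hf⟩ ⟨h, hh⟩ heq
    have heq' : sortedSpin f.cut (f.wraps.card + i) = sortedSpin h.cut (h.wraps.card + i) :=
      congrArg Subtype.val heq
    have h1 := hs h
    have h2 := isSorted_sortedSpin h.cut (h.wraps.card + i)
    rw [← heq'] at h1 h2
    have hcut := (hs f).link_unique (isSorted_sortedSpin _ _) h1 h2
    have h3 := h.isSpin_cut
    have h4 := h.isSorted_cut
    rw [← hcut] at h3 h4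
    exact Subtype.ext (word_injective (f.isSpin_cut.spin_unique f.isSorted_cut h3 h4
      (by rw [card_plus_word, card_plus_word])))
  · rintro ⟨w, hw⟩
    have hw' : (plus w).card = n + i := hw
    obtain ⟨g, hg, hsort⟩ := exists_isSorted w
    have h1 := hg.card_plus
    have h2 := Finset.card_le_card (Finset.inter_subset_right (s₁ := plus w) (s₂ := defects g))
    obtain ⟨k, hk⟩ : ∃ k, (defects g).card = 2 * k :=
      ⟨(plus w ∩ defects g).card - i, by omega⟩
    have h3 := hg.toIsLink.isSpin_sortedSpin k
    have h4 := h3.card_plus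
    rw [card_plus_sortedSpin g (by omega)] at h4
    obtain ⟨f, rfl, hf⟩ := exists_cut h3 (isSorted_sortedSpin g k) (by omega)
    have h5 := f.card_defects
    have h6 : i ≤ f.wraps.card := by omega
    refine ⟨⟨f, h6⟩, Subtype.ext ?_⟩
    exact (hs f).spin_unique (isSorted_sortedSpin _ _) hg hsort (by rw [hc f h6, hw'])

theorem prod_wraps {R : Type*} [CommMonoid R] (F : ℕ → R) :
    ∏ f : PerNC n, ∏ r ∈ Finset.range f.wraps.card, F (r + 1) =
      ∏ i ∈ Finset.Icc 1 n, F i ^ (2 * n).choose (n - i) := by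
  have h1 : ∀ f : PerNC n, ∏ r ∈ Finset.range f.wraps.card, F (r + 1) =
      ∏ i ∈ Finset.Icc 1 n, if i ≤ f.wraps.card then F i else 1 := by
    intro f
    have := f.card_wraps_le
    rw [← Finset.prod_filter, Finset.range_eq_Ico, Finset.prod_Ico_add' F 0 f.wraps.card 1]
    refine Finset.prod_congr ?_ fun _ _ => rfl
    ext i
    simp only [Finset.mem_Ico, Finset.mem_filter, Finset.mem_Icc]
    omega
  simp only [h1]
  rw [Finset.prod_comm]
  refine Finset.prod_congr rfl fun i hi => ?_
  rw [← Finset.prod_filter, Finset.prod_const, card_filter_wraps i (Finset.mem_Icc.1 hi).2]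

theorem stateW_eq_zero (q z : K) (f : PerNC n) {σ : Fin (2 * n) → Bool} (hσ : (plus σ).card ≠ n) :
    stateW q z f σ = 0 := by
  by_contra hne
  refine hσ (f.card_plus_of_partner ?_)
  have key : ∀ x, f.word x = true → σ (f.partner x) = !σ x := by
    intro x hx
    by_contra hx'
    refine hne (Finset.prod_eq_zero (Finset.mem_univ x) ?_)
    rw [word, decide_eq_true_eq] at hx
    rw [ptW, if_pos hx, pt_val]
    rw [partner] at hx'
    cases h1 : σ x <;> cases h2 : σ (pt _ (f ((x : ℕ) : ℤ))) <;> simp [wt, h1, h2] at hx' ⊢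
  intro x
  cases hx : f.word x
  · have := key (f.partner x) (by rw [word_partner, hx]; rfl)
    rw [partner_partner] at this
    rw [this, Bool.not_not]
  · exact key x hx

theorem pairing_eq_mul (q z : K) (f g : PerNC n) :
    pairing q z f g = (stateMatrix n q z * (stateMatrix n q z⁻¹).transpose) f g := by
  rw [Matrix.mul_apply, pairing]
  have h1 : ∑ σ, stateW q z f σ * stateW q z⁻¹ g σ =
      ∑ σ ∈ Finset.univ.filter (fun σ : Fin (2 * n) → Bool => (plus σ).card = n),
        stateW q z f σ * stateW q z⁻¹ g σ := by
    rw [Finset.sum_filter_of_ne]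
    intro σ _ hσ
    by_contra hc
    rw [stateW_eq_zero q z f hc, zero_mul] at hσ
    exact hσ rfl
  rw [h1, Finset.sum_subtype (p := fun σ : Fin (2 * n) → Bool => (plus σ).card = n) _
    (by simp)]
  exact ((wordEquiv n).sum_comp fun σ => stateW q z f σ.1 * stateW q z⁻¹ g σ.1).symm

end PerNC

theorem sum_choose (N m : ℕ) (hm : 2 * m ≤ N) :
    ∑ k ∈ Finset.range m, (N - 2 * k) * N.choose k = m * N.choose m := by
  induction m with
  | zero => simp
  | succ m ih =>
    rw [Finset.sum_range_succ, ih (by omega), ← add_mul, mul_comm (m + 1),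
      Nat.choose_succ_right_eq, mul_comm (N.choose m)]
    congr 1
    omega

theorem sum_two_mul_choose (n : ℕ) :
    ∑ i ∈ Finset.Icc 1 n, 2 * i * (2 * n).choose (n - i) = n * (2 * n).choose n := by
  rw [← sum_choose (2 * n) n le_rfl]
  refine Finset.sum_nbij' (fun i => n - i) (fun k => n - k) ?_ ?_ ?_ ?_ ?_
  all_goals
    intro i hi
    simp only [Finset.mem_Icc, Finset.mem_range] at hi ⊢
  any_goals omega
  congr 1
  omega

theorem eval_chebyshev_C {K : Type*} [Field K] {q : K} (hq : q ≠ 0) (i : ℕ) :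
    (Polynomial.Chebyshev.C K i).eval (q + q⁻¹) = q ^ i + (q⁻¹) ^ i := by
  induction i using Nat.twoStepInduction with
  | zero => simp; norm_num
  | one => simp
  | more i h1 h2 =>
    push_cast at h2 ⊢
    rw [Polynomial.Chebyshev.C_add_two, Polynomial.eval_sub, Polynomial.eval_mul, Polynomial.eval_X,
      h1, h2]
    have : q * q⁻¹ = 1 := mul_inv_cancel₀ hq
    linear_combination (q ^ i + (q⁻¹) ^ i) * this

section Determinant

variable {n : ℕ} [NeZero n] {K : Type*} [Field K] [CharZero K]

theorem det_gram_of_ne_zero {q z : K} (hq : q ≠ 0) (hz : z ≠ 0) (hδ : q + q⁻¹ ≠ 0) :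
    (gram n (z + z⁻¹) (q + q⁻¹)).det = ∏ i ∈ Finset.Icc 1 n,
      ((Polynomial.Chebyshev.C K i).eval (q + q⁻¹) ^ 2 - (z + z⁻¹) ^ 2) ^
        (2 * n).choose (n - i) := by
  have h1 : (gram n (z + z⁻¹) (q + q⁻¹)).submatrix (PerNC.equiv n) (PerNC.equiv n) =
      q ^ n • (PerNC.stateMatrix n q z * (PerNC.stateMatrix n q z⁻¹).transpose) := by
    ext f g
    rw [Matrix.smul_apply, ← PerNC.pairing_eq_mul, smul_eq_mul, PerNC.pairing_eq hq hz hδ]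
    rfl
  have hdet : ∀ z : K, (PerNC.stateMatrix n q z).det =
      ∏ i ∈ Finset.Icc 1 n, (z - (q⁻¹) ^ (2 * i) * z⁻¹) ^ (2 * n).choose (n - i) := by
    intro z
    rw [PerNC.det_stateMatrix hq, ← PerNC.prod_wraps]
    refine Finset.prod_congr rfl fun f _ => Finset.prod_congr rfl fun r _ => ?_
    rw [Odd.neg_pow ⟨r, rfl⟩]
    ring
  rw [← Matrix.det_submatrix_equiv_self (PerNC.equiv n), h1, Matrix.det_smul, Matrix.det_mul,
    Matrix.det_transpose, hdet, hdet, PerNC.card_eq, ← pow_mul, ← sum_two_mul_choose,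
    ← Finset.prod_pow_eq_pow_sum, ← Finset.prod_mul_distrib, ← Finset.prod_mul_distrib]
  refine Finset.prod_congr rfl fun i _ => ?_
  rw [pow_mul, ← mul_pow, ← mul_pow, eval_chebyshev_C hq, inv_inv]
  congr 1
  have e1 : z * z⁻¹ = 1 := mul_inv_cancel₀ hz
  have e2 : q ^ i * (q⁻¹) ^ i = 1 := by rw [← mul_pow, mul_inv_cancel₀ hq, one_pow]
  rw [mul_comm 2 i, pow_mul, pow_mul]
  generalize q ^ i = a at *
  generalize (q⁻¹) ^ i = b at *
  generalize z⁻¹ = w at *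
  linear_combination (a * b + 1) * (b ^ 2 * (z * w) - z ^ 2 - w ^ 2) * e2 + (a ^ 2 + b ^ 2 + 2) * e1 -
    2 * e2

end Determinant

end TypeB

namespace TypeB

section Universal

variable {n : ℕ}

theorem map_gram {R S : Type*} [CommRing R] [CommRing S] (φ : R →+* S) (α δ : R) :
    φ (gram n α δ).det = (gram n (φ α) (φ δ)).det := by
  rw [RingHom.map_det]
  congr 1
  ext b b'
  simp [gram]

theorem map_chromaticJoins {R S : Type*} [CommRing R] [CommRing S] (φ : R →+* S) (α δ : R) :
    φ (chromaticJoins n α δ).det = (chromaticJoins n (φ α) (φ δ)).det := by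
  rw [RingHom.map_det]
  congr 1
  ext b b'
  simp [chromaticJoins]

/-- The product formula for the determinant of the Gram matrix. -/
noncomputable def gramProd {R : Type*} [CommRing R] (n : ℕ) (α δ : R) : R :=
  ∏ i ∈ Finset.Icc 1 n,
    ((Polynomial.Chebyshev.C R i).eval δ ^ 2 - α ^ 2) ^ (2 * n).choose (n - i)

theorem map_gramProd {R S : Type*} [CommRing R] [CommRing S] (φ : R →+* S) (α δ : R) :
    φ (gramProd n α δ) = gramProd n (φ α) (φ δ) := by
  simp only [gramProd, map_prod, map_pow, map_sub]
  refine Finset.prod_congr rfl fun i _ => ?_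
  rw [← Polynomial.Chebyshev.map_C φ, Polynomial.eval_map_apply]

theorem exists_add_inv (α : ℂ) : ∃ z : ℂ, z ≠ 0 ∧ z + z⁻¹ = α := by
  obtain ⟨s, hs⟩ := IsAlgClosed.exists_pow_nat_eq (α ^ 2 - 4) (n := 2) (by norm_num)
  have h : (α + s) / 2 * ((α - s) / 2) = 1 := by linear_combination - hs / 4
  refine ⟨(α + s) / 2, left_ne_zero_of_mul_eq_one h, ?_⟩
  rw [inv_eq_of_mul_eq_one_right h]
  ring

variable [NeZero n]

theorem det_gram_complex (α : ℂ) {δ : ℂ} (hδ : δ ≠ 0) : (gram n α δ).det = gramProd n α δ := by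
  obtain ⟨z, hz, rfl⟩ := exists_add_inv α
  obtain ⟨q, hq, rfl⟩ := exists_add_inv δ
  exact det_gram_of_ne_zero hq hz hδ

theorem det_gram_int (α : ℤ) {δ : ℤ} (hδ : δ ≠ 0) : (gram n α δ).det = gramProd n α δ := by
  apply (Int.castRingHom ℂ).injective_int
  rw [map_gram, map_gramProd]
  exact det_gram_complex _ (by simpa using hδ)

/-- The determinant of the Gram matrix of the Temperley–Lieb algebra of type B. -/
theorem det_gram {R : Type*} [CommRing R] (α δ : R) : (gram n α δ).det = gramProd n α δ := by
  have key : (gram n (MvPolynomial.X 0 : MvPolynomial (Fin 2) ℤ) (MvPolynomial.X 1)).det =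
      gramProd n (MvPolynomial.X 0) (MvPolynomial.X 1) := by
    apply mul_left_cancel₀ (MvPolynomial.X_ne_zero (R := ℤ) (1 : Fin 2))
    apply MvPolynomial.funext
    intro v
    rw [map_mul, map_mul, MvPolynomial.eval_X, map_gram, map_gramProd, MvPolynomial.eval_X,
      MvPolynomial.eval_X]
    by_cases hv : v 1 = 0
    · rw [hv, zero_mul, zero_mul]
    · rw [det_gram_int _ hv]
  have := congrArg (MvPolynomial.eval₂Hom (Int.castRingHom R) ![α, δ]) key
  rw [map_gram, map_gramProd] at this
  simpa using this

/-- The determinant of the matrix of chromatic joins in terms of the Gram matrix. -/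
theorem det_chromaticJoins {R : Type*} [CommRing R] (α δ : R) :
    (chromaticJoins n (α ^ 2) (δ ^ 2)).det = α ^ (2 * n).choose n * (gram n α δ).det := by
  have key := mul_left_cancel₀ (pow_ne_zero _ (MvPolynomial.X_ne_zero (R := ℤ) (1 : Fin 2)))
    (pow_mul_det_chromaticJoins (n := n) (MvPolynomial.X 0 : MvPolynomial (Fin 2) ℤ)
      (MvPolynomial.X 1))
  have := congrArg (MvPolynomial.eval₂Hom (Int.castRingHom R) ![α, δ]) key
  rw [map_mul, map_gram, map_chromaticJoins] at this
  simpa using this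

end Universal

end TypeB

theorem mainTheorem4 (n : ℕ) (hn : 1 ≤ n) {R : Type*} [CommRing R] :
    -- the factorization, with rows and columns identified by the boundary-arc bijection
    (∃ e : TypeB.NCPart n ≃ TypeB.NCBipart n,
      (∀ π, (e π).1 = TypeB.boundaryArcs π.1) ∧
      ∀ (α δ : R) (s : Rˣ), (s : R) ^ 2 = δ →
        TypeB.chromaticJoins n (α ^ 2) (δ ^ 2) =
          TypeB.scaling n α s * (TypeB.gram n α δ).submatrix e e * TypeB.scaling n α s) ∧
    -- the fixed-point-free involution and the determinant of the diagonal matrix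
    (∃ γ : TypeB.NCPart n → TypeB.NCPart n, Function.Involutive γ ∧ ∀ π, γ π ≠ π ∧
      TypeB.bk₀ π.1 + TypeB.bk₀ (γ π).1 = 1 ∧ TypeB.nzbk π.1 + TypeB.nzbk (γ π).1 = n) ∧
    (∀ (α : R) (s : Rˣ), (TypeB.scaling n α s).det = α ^ ((2 * n).choose n / 2)) ∧
    -- the determinant formula; Mathlib's `Chebyshev.C` is given by
    -- `C 0 = 2`, `C 1 = X`, `C (i + 2) = X * C (i + 1) - C i`
    (∀ α δ : R,
      (TypeB.chromaticJoins n (α ^ 2) (δ ^ 2)).det =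
        α ^ (2 * n).choose n * (TypeB.gram n α δ).det ∧
      (TypeB.chromaticJoins n (α ^ 2) (δ ^ 2)).det =
        α ^ (2 * n).choose n *
          ∏ i ∈ Finset.Icc 1 n,
            ((Polynomial.Chebyshev.C R i).eval δ ^ 2 - α ^ 2) ^ (2 * n).choose (n - i)) := by
  have : NeZero n := ⟨by omega⟩
  refine ⟨⟨TypeB.NCPart.equiv n, TypeB.NCPart.equiv_val, TypeB.chromaticJoins_eq⟩,
    ⟨TypeB.NCPart.complement, TypeB.NCPart.complement_involutive, fun π =>
      ⟨π.complement_ne, π.counts_complement⟩⟩, TypeB.det_scaling, fun α δ =>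
      ⟨TypeB.det_chromaticJoins α δ, ?_⟩⟩
  rw [TypeB.det_chromaticJoins, TypeB.det_gram, TypeB.gramProd]
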